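/- **Proposition 2.5 (analytic case, local asymptotic Bergman kernel).** Let $\phi$ be a real-valued function that is real-analytic and strictly plurisubharmonic near the origin of $\mathbb{C}^n$, and put $\omega_n=\det(\phi_{y_i\bar y_j})\,\beta_n$, where $\beta_n$ is Lebesgue measure (this is the volume form $\omega^n/n!$ of $\omega=\frac i2\partial\bar\partial\phi$). For $B_r=\{|y|<r\}$ write $(f,g)_{k\phi}=\int_{B_r}f\bar g\,e^{-k\phi}\omega_n$, $\|u\|_{k\phi}^2=(u,u)_{k\phi}$, and let $H_{k\phi}(B_r)$ be the space of holomorphic functions $u$ on $B_r$ with $\|u\|_{k\phi}<\infty$. Then there is $r_0>0$ such that the following holds. 1. There is a holomorphic function $\psi(x,z)$ on $|x|,|z|<r_0$ with $\psi(x,\bar x)=\phi(x)$, and with $\theta(x,y,z)=\int_0^1(\partial_1\psi)(tx+(1-t)y,z)\,dt$ (where $\partial_1$ is the holomorphic differential in the first $n$ variables) the map $(x,y,z)\mapsto(x,y,\theta)$ is biholomorphic from $|x|,|y|,|z|<r_0$ onto an open set, with inverse given by $z=z(x,y,\theta)$. Put $$\Delta_0(x,y,\theta)=\frac{\det\psi_{yz}(y,z)}{\det\theta_z(x,y,z)}\Big|_{z=z(x,y,\theta)},\qquad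 S=\sum_{m\ge0}\frac{1}{k^m\,m!}(D_\theta\cdot D_y)^m,\qquad D_\theta\cdot D_y=\sum_i\frac{\partial^2}{\partial\theta_i\partial y_i}.$$ 2. There are unique holomorphic functions $b_m(x,z)$, $m\ge 0$, all defined on $|x|,|z|<r_0$, such that, with $B=\sum_{m\ge0}b_m(x,z)k^{-m}$, $$S\big(B(x,z(x,y,\theta))\,\Delta_0(x,y,\theta)\big)\big|_{y=x}=1$$ as formal power series in $1/k$, at all points $\theta=\theta(x,x,z)$ with $|x|,|z|<r_0$; that is, $\sum_{l=0}^m\frac{(D_\theta\cdot D_y)^l}{l!}(b_{m-l}\Delta_0)|_{y=x}$ equals $1$ for $m=0$ and $0$ for $m>0$. (The case $m=0$ says $b_0\equiv1$.) 3. Let $0<r\le r_0$, let $\chi$ be a smooth real function with support in $B_r$ and equal to $1$ on $B_{r/2}$, let $N\ge0$, and define $K_{k,x}(y)=K^{(N)}_{k,x}(y)$ by $$\overline{K_{k,x}(y)}=(k/\pi)^n\big(1+b_1(x,\bar y)k^{-1}+\dots+b_N(x,\bar y)k^{-N}\big)e^{k\psi(x,\bar y)}.$$ Then $K_{k,x}$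 is a local asymptotic Bergman kernel: there are $\rho\in(0,r]$ and a constant $C$ such that for all integers $k\ge1$ and all $|x|<\rho$, the function $K_{k,x}$ is holomorphic on $B_r$, and for all $u\in H_{k\phi}(B_r)$ $$\big|u(x)-(\chi u,K_{k,x})_{k\phi}\big|\le C\,k^{n/2-N-1}\,e^{k\phi(x)/2}\,\|u\|_{k\phi}.$$ (Thus the error is $O(k^{-(N+1)})$ relative to the natural bound $|u(x)|\lesssim k^{n/2}e^{k\phi(x)/2}\|u\|_{k\phi}$.) -/

import Mathlib

open Complex MeasureTheory Metric Topology Filter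
open scoped ContDiff ComplexConjugate ComplexOrder

noncomputable section

/-- Complex Euclidean space `ℂⁿ`, with the Euclidean norm and (as a real inner product space)
Lebesgue measure. -/
abbrev Cn (n : ℕ) : Type := EuclideanSpace ℂ (Fin n)

namespace LocalBergman

variable {n : ℕ}

/-- The `i`-th standard basis vector of `ℂⁿ`. -/
def e (i : Fin n) : Cn n := EuclideanSpace.single i 1

/-- Coordinatewise complex conjugation `y ↦ ȳ`. -/
def cbar (y : Cn n) : Cn n := WithLp.toLp 2 fun i => conj (y i)

/-- The holomorphic partial derivative `∂f/∂w_i` of a holomorphic function. -/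
def cd (i : Fin n) (f : Cn n → ℂ) (w : Cn n) : ℂ := fderiv ℂ f w (e i)

/-! ### Weights, volume form and weighted spaces of holomorphic functions -/

/-- The Wirtinger derivative `∂f/∂w_i = (∂f/∂(Re w_i) - i ∂f/∂(Im w_i)) / 2`. -/
def wirtinger (i : Fin n) (f : Cn n → ℂ) (w : Cn n) : ℂ :=
  (fderiv ℝ f w (e i) - I * fderiv ℝ f w (I • e i)) / 2

/-- The Wirtinger derivative `∂f/∂w̄_i = (∂f/∂(Re w_i) + i ∂f/∂(Im w_i)) / 2`. -/
def wirtingerBar (i : Fin n) (f : Cn n → ℂ) (w : Cn n) : ℂ :=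
  (fderiv ℝ f w (e i) + I * fderiv ℝ f w (I • e i)) / 2

/-- The complex Hessian `(∂²φ/∂w_i∂w̄_j)` of a real function. -/
def complexHessian (φ : Cn n → ℝ) (w : Cn n) : Matrix (Fin n) (Fin n) ℂ :=
  Matrix.of fun i j => wirtinger i (wirtingerBar j fun v => (φ v : ℂ)) w

/-- `φ` is strictly plurisubharmonic at `w` (for `φ` of class `C²`): positive definite complex
Hessian. -/
def StrictlyPshAt (φ : Cn n → ℝ) (w : Cn n) : Prop := (complexHessian φ w).PosDef

/-- The density, with respect to Lebesgue measure `β_n`, of the volume form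
`ω_n = ωⁿ / n!`, where `ω = (i/2) ∂∂̄φ`. -/
def volDensity (φ : Cn n → ℝ) (w : Cn n) : ℝ := (complexHessian φ w).det.re

/-- The integrand of the pairing `(f, g)_{kφ} = ∫ f ḡ e^{-kφ} ω_n`, with respect to Lebesgue
measure. -/
def pairingIntegrand (φ : Cn n → ℝ) (k : ℕ) (f g : Cn n → ℂ) (y : Cn n) : ℂ :=
  f y * conj (g y) * (Real.exp (-(k * φ y)) * volDensity φ y : ℝ)

/-- The pairing `(f, g)_{kφ} = ∫_{|y| < r} f ḡ e^{-kφ} ω_n`. -/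
def pairing (φ : Cn n → ℝ) (r : ℝ) (k : ℕ) (f g : Cn n → ℂ) : ℂ :=
  ∫ y in ball (0 : Cn n) r, pairingIntegrand φ k f g y

/-- The integrand of `‖u‖²_{kφ} = ∫ |u|² e^{-kφ} ω_n`, with respect to Lebesgue measure. -/
def normSqIntegrand (φ : Cn n → ℝ) (k : ℕ) (u : Cn n → ℂ) (y : Cn n) : ℝ :=
  ‖u y‖ ^ 2 * (Real.exp (-(k * φ y)) * volDensity φ y)

/-- The weighted norm `‖u‖_{kφ}` over the ball of radius `r`. -/
def weightedNorm (φ : Cn n → ℝ) (r : ℝ) (k : ℕ) (u : Cn n → ℂ) : ℝ :=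
  Real.sqrt (∫ y in ball (0 : Cn n) r, normSqIntegrand φ k u y)

/-- `u ∈ H_{kφ}(B_r)`: `u` is holomorphic in the ball of radius `r` and has finite norm. -/
def MemH (φ : Cn n → ℝ) (r : ℝ) (k : ℕ) (u : Cn n → ℂ) : Prop :=
  DifferentiableOn ℂ u (ball 0 r) ∧ IntegrableOn (normSqIntegrand φ k u) (ball 0 r)

/-- Cutoff functions for the ball of radius `r`: smooth, supported in that ball and equal to one on
the ball of radius `r / 2`. -/
def IsCutoff (r : ℝ) (χ : Cn n → ℝ) : Prop :=
  ContDiff ℝ ∞ χ ∧ tsupport χ ⊆ ball 0 r ∧ ∀ y ∈ ball (0 : Cn n) (r / 2), χ y = 1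

/-- `K k x y = K_{k,x}(y)` is a local Bergman kernel for `H_{kφ}(B_r)` with error `O(ε k)`:
uniformly for `x` in a neighbourhood of the origin, `K_{k,x}` is holomorphic in the ball and
`u(x) = (χ u, K_{k,x})_{kφ} + O(ε k e^{kφ(x)/2}) ‖u‖_{kφ}` for all `u ∈ H_{kφ}(B_r)`. -/
def IsBergmanKernelMod (φ : Cn n → ℝ) (r : ℝ) (χ : Cn n → ℝ) (K : ℕ → Cn n → Cn n → ℂ)
    (ε : ℕ → ℝ) : Prop :=
  ∃ ρ : ℝ, 0 < ρ ∧ ρ ≤ r ∧ ∃ C : ℝ, ∀ k : ℕ, 1 ≤ k → ∀ x ∈ ball (0 : Cn n) ρ,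
    DifferentiableOn ℂ (K k x) (ball 0 r) ∧
    ∀ u : Cn n → ℂ, MemH φ r k u →
      IntegrableOn (pairingIntegrand φ k (fun y => χ y * u y) (K k x)) (ball 0 r) ∧
      ‖u x - pairing φ r k (fun y => χ y * u y) (K k x)‖
        ≤ C * ε k * Real.exp (k * φ x / 2) * weightedNorm φ r k u

/-! ### The phase -/

/-- `ψ(x, z)` is holomorphic for `|x|, |z| < r` and `ψ(x, x̄) = φ(x)`. -/
def IsPolarization (φ : Cn n → ℝ) (r : ℝ) (ψ : Cn n → Cn n → ℂ) : Prop :=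
  AnalyticOnNhd ℂ (fun p : Cn n × Cn n => ψ p.1 p.2) (ball 0 r ×ˢ ball 0 r) ∧
  ∀ x ∈ ball (0 : Cn n) r, ψ x (cbar x) = φ x

/-- `θ(x, y, z) = ∫₀¹ (∂ψ)(t x + (1 - t) y, z) dt`, where `∂` is the differential in the first `n`
variables. -/
def theta (ψ : Cn n → Cn n → ℂ) (x y z : Cn n) : Cn n :=
  WithLp.toLp 2 fun i =>
    ∫ t in (0 : ℝ)..1, cd i (fun w => ψ w z) ((t : ℂ) • x + (1 - t : ℂ) • y)

/-- The map `(x, y, z) ↦ (x, y, θ(x, y, z))`. -/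
def coordMap (ψ : Cn n → Cn n → ℂ) (p : Cn n × Cn n × Cn n) : Cn n × Cn n × Cn n :=
  (p.1, p.2.1, theta ψ p.1 p.2.1 p.2.2)

/-- The domain `|x|, |y|, |z| < r`. -/
def tripleBall (n : ℕ) (r : ℝ) : Set (Cn n × Cn n × Cn n) := ball 0 r ×ˢ ball 0 r ×ˢ ball 0 r

/-- `(x, y, z) ↦ (x, y, θ)` is a biholomorphic change of coordinates on `|x|, |y|, |z| < r`,
with inverse `(x, y, θ) ↦ (x, y, ζ(x, y, θ))`. -/
def IsCoordInverse (ψ : Cn n → Cn n → ℂ) (r : ℝ) (ζ : Cn n → Cn n → Cn n → Cn n) : Prop :=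
  AnalyticOnNhd ℂ (coordMap ψ) (tripleBall n r) ∧
  IsOpen (coordMap ψ '' tripleBall n r) ∧
  AnalyticOnNhd ℂ (fun q : Cn n × Cn n × Cn n => ζ q.1 q.2.1 q.2.2)
    (coordMap ψ '' tripleBall n r) ∧
  ∀ p ∈ tripleBall n r, ζ p.1 p.2.1 (theta ψ p.1 p.2.1 p.2.2) = p.2.2

/-! ### The amplitude -/

/-- `Δ₀ = det ψ_{yz}(y, z) / det θ_z(x, y, z)` as a function of `(x, y, ϑ)`, through
`z = ζ(x, y, ϑ)`. -/
def Delta0 (ψ : Cn n → Cn n → ℂ) (ζ : Cn n → Cn n → Cn n → Cn n) (x y ϑ : Cn n) : ℂ :=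
  (Matrix.of fun i j : Fin n => cd j (fun z => cd i (fun w => ψ w z) y) (ζ x y ϑ)).det /
    (Matrix.of fun i j : Fin n => cd j (fun z => theta ψ x y z i) (ζ x y ϑ)).det

/-- The operator `D_θ · D_y = ∑ ∂²/∂θ_i∂y_i` on functions of `(x, y, θ)`. -/
def DthetaDy (F : Cn n → Cn n → Cn n → ℂ) (x y ϑ : Cn n) : ℂ :=
  ∑ i : Fin n, cd i (fun ϑ' => cd i (fun y' => F x y' ϑ') y) ϑ

/-- The coefficient of `k^{-m}` in `S (∑ a_m k^{-m})`, where
`S = ∑ (D_θ · D_y)^l / (l! k^l)` acts on formal power series in `1/k`. -/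
def SCoeff (a : ℕ → Cn n → Cn n → Cn n → ℂ) (m : ℕ) (x y ϑ : Cn n) : ℂ :=
  ∑ l ∈ Finset.range (m + 1), (Nat.factorial l : ℂ)⁻¹ * (DthetaDy^[l] (a (m - l))) x y ϑ

/-- With `B = ∑ b_m(x, z) k^{-m}`, the identity `S (B(x, z(x, y, θ)) Δ₀(x, y, θ))|_{y = x} = 1` of
formal power series in `1/k`, at all points `(x, x, θ(x, x, z))` with `|x|, |z| < r`. -/
def SolvesAmplitude (ψ : Cn n → Cn n → ℂ) (ζ : Cn n → Cn n → Cn n → Cn n) (r : ℝ)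
    (b : ℕ → Cn n → Cn n → ℂ) : Prop :=
  ∀ m : ℕ, ∀ x ∈ ball (0 : Cn n) r, ∀ z ∈ ball (0 : Cn n) r,
    SCoeff (fun j x y ϑ => b j x (ζ x y ϑ) * Delta0 ψ ζ x y ϑ) m x x (theta ψ x x z)
      = if m = 0 then 1 else 0

/-- All `b_m(x, z)` are holomorphic for `|x|, |z| < r`. -/
def IsAnalyticFamily (r : ℝ) (b : ℕ → Cn n → Cn n → ℂ) : Prop :=
  ∀ m, AnalyticOnNhd ℂ (fun p : Cn n × Cn n => b m p.1 p.2) (ball 0 r ×ˢ ball 0 r)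

/-- `(k/π)ⁿ (1 + b₁(x, z)/k + … + b_N(x, z)/k^N) e^{kψ(x, z)}`. -/
def kernelExpr (ψ : Cn n → Cn n → ℂ) (b : ℕ → Cn n → Cn n → ℂ) (N k : ℕ) (x z : Cn n) : ℂ :=
  ((k : ℂ) / Real.pi) ^ n * (1 + ∑ m ∈ Finset.Icc 1 N, b m x z / (k : ℂ) ^ m) *
    Complex.exp (k * ψ x z)

/-- The kernel `K_{k,x}(y)`; it is antilinear in the second slot of the pairing, so
`conj K_{k,x}(y) = (k/π)ⁿ (1 + b₁(x, ȳ)/k + … + b_N(x, ȳ)/k^N) e^{kψ(x, ȳ)}`. -/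
def localKernel (ψ : Cn n → Cn n → ℂ) (b : ℕ → Cn n → Cn n → ℂ) (N k : ℕ) (x y : Cn n) : ℂ :=
  conj (kernelExpr ψ b N k x (cbar y))

end LocalBergman

end

open Complex MeasureTheory Metric Topology Filter
open scoped ContDiff ComplexConjugate ComplexOrder

noncomputable section

/-! Fix `x` and let `D(y, z) = ψ(y, z) + ψ(x, x̄) - ψ(x, z) - ψ(y, x̄)` be the polarized diastasis.
Since `k(ψ(x, ȳ) - φ(y)) = -k(ψ(y, x̄) - φ(x)) - kD(y, ȳ)`, the pairing of `χu` with the kernel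
equals `π⁻ⁿ kⁿ ∫ v · (B det ψ_yz) · e^{-kD} χ`, where `v = u e^{-k(ψ(y, x̄) - φ(x))}` is holomorphic
in `y` and `v(x) = u(x)`. Moreover `B det ψ_yz = (BΔ₀) det θ_z` and `D = (y - x)·(θ(x, y, z) - θ(x,
y, x̄))`, so in the coordinates `(y, θ)` the phase is affine in `θ`.

Three facts give the reproducing property. First, amplitudes of the form `div_θ g + k(x - y)·g` are
negligible: multiplied by `det θ_z e^{-kD}` they become a divergence in `z` by the Piola identity,
and because `v` is holomorphic, integration by parts in `ȳ` moves the derivative to the cutoff, on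
whose gradient `Re D` is bounded below (`integral_dbar_by_parts`, `integral_relation`).

Second, the amplitude `1` reproduces `v(x)` up to such boundary terms. With `g = θ(x, y, z) - θ(x,
y, x̄)` one has `div_θ g = n` and `(y - x)·g = D`, so the relation is a differential equation in `t`
saying that `tⁿ ∫ v det θ_z e^{-tD} χ` has exponentially small derivative. Its limit as `t → ∞` is
`πⁿ v(x)` by Laplace's method (`tendsto_laplace`, `integral_gaussian_form`); integrating from `k` to
infinity gives `norm_leading_term_sub_le`.

Third, by Hadamard's lemma in `y`, applied repeatedly, every amplitude `f` is congruent to the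
truncation of `S f|_{y=x}` modulo negligible amplitudes and a remainder of the next order in `1/k`
(`exists_amplitude_division`). Hence `S(BΔ₀)|_{y=x} = 1` says that the truncated amplitude is `1 +
O(k^{-N-1})` modulo relations (`IsPhase.exists_amplitude_expansion`). As `Δ₀ = 1` on `y = x`, this
system is triangular in the `b_m`, which gives existence and uniqueness on the same balls for all
`m`.

For the size of the error, `|v| e^{-k Re D} = e^{kφ(x)/2} |u| e^{-kφ/2} e^{-k Re D/2}` and `Re D ≥
δ|y - x|²`, so Cauchy–Schwarz yields a factor `k^{-n/2}` against the prefactor `kⁿ`. The division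
holds only near the base point; a small cutoff is used there, and its difference from the given `χ`
lives where `Re D` is bounded below, so contributes an exponentially small term. -/

namespace LocalBergman

/-! ### Polarization of a real-analytic germ. -/

section Polarization

variable {n : ℕ}

/-- Coordinatewise conjugation as a real-linear isometry. -/
def cbarL (n : ℕ) : Cn n →ₗᵢ[ℝ] Cn n where
  toFun := cbar
  map_add' x y := by ext i; simp [cbar]
  map_smul' c x := by ext i; simp [cbar]
  norm_map' x := by simp [EuclideanSpace.norm_eq, cbar]

@[simp] lemma cbar_apply (x : Cn n) (i : Fin n) : cbar x i = conj (x i) := rfl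

@[simp] lemma cbar_cbar (x : Cn n) : cbar (cbar x) = x := by ext i; simp

@[simp] lemma norm_cbar (x : Cn n) : ‖cbar x‖ = ‖x‖ := (cbarL n).norm_map x

@[simp] lemma cbar_zero : cbar (0 : Cn n) = 0 := (cbarL n).map_zero

lemma cbar_sub (x y : Cn n) : cbar (x - y) = cbar x - cbar y := (cbarL n).map_sub x y

lemma cbar_add (x y : Cn n) : cbar (x + y) = cbar x + cbar y := (cbarL n).map_add x y

lemma cbar_mem_ball {x : Cn n} {r : ℝ} : cbar x ∈ ball (0 : Cn n) r ↔ x ∈ ball (0 : Cn n) r := by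
  simp

lemma continuous_cbar : Continuous (cbar : Cn n → Cn n) := (cbarL n).continuous

@[simp] lemma e_apply (i j : Fin n) : (e i : Cn n) j = if j = i then 1 else 0 := by
  simp [e]

lemma sum_smul_e (x : Cn n) : ∑ i, x i • e i = x := by
  ext j; simp

/-- The real basis `e_i, I e_i` of `ℂⁿ`. -/
def realBasisVec (s : Fin n × Bool) : Cn n := if s.2 then I • e s.1 else e s.1

/-- The complexified real coordinates, as linear forms in `(x, z)`; at `z = x̄` these are the real
and imaginary parts. -/
def polCoord (s : Fin n × Bool) : (Cn n × Cn n) →L[ℂ] ℂ :=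
  if s.2 then (-(I / 2)) •
    ((EuclideanSpace.proj s.1).comp (ContinuousLinearMap.fst ℂ (Cn n) (Cn n)) -
    (EuclideanSpace.proj s.1).comp (ContinuousLinearMap.snd ℂ (Cn n) (Cn n)))
  else (1 / 2 : ℂ) • ((EuclideanSpace.proj s.1).comp (ContinuousLinearMap.fst ℂ (Cn n) (Cn n)) +
    (EuclideanSpace.proj s.1).comp (ContinuousLinearMap.snd ℂ (Cn n) (Cn n)))

/-- Real coordinates of `x` in the basis `realBasisVec`. -/
def realCoord (s : Fin n × Bool) (x : Cn n) : ℝ := if s.2 then (x s.1).im else (x s.1).re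

lemma polCoord_cbar (s : Fin n × Bool) (x : Cn n) : polCoord s (x, cbar x) = realCoord s x := by
  rcases s with ⟨i, _ | _⟩ <;> apply Complex.ext <;> simp [polCoord, realCoord] <;> ring

lemma sum_realCoord_smul (x : Cn n) : ∑ s, realCoord s x • realBasisVec s = x := by
  ext j
  simp only [Fintype.sum_prod_type, realCoord, realBasisVec, Fintype.sum_bool]
  simp
  simp [Finset.sum_add_distrib, mul_comm]
  rw [add_comm, mul_comm I]; exact Complex.re_add_im _

/-- The form is a real coordinate on the totally real subspace `z = x̄`, which is the fixed set of
the antilinear involution `(x, z) ↦ (z̄, x̄)`. This is the source of the Hermitian symmetry of `ψ`.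
-/
lemma conj_polCoord (s : Fin n × Bool) (p : Cn n × Cn n) :
    conj (polCoord s p) = polCoord s (cbar p.2, cbar p.1) := by
  rcases s with ⟨i, _ | _⟩ <;> simp [polCoord, map_ofNat] <;> ring

/-- Polarization of a real power series on `ℂⁿ`. -/
def polSeries (p : FormalMultilinearSeries ℝ (Cn n) ℝ) :
    FormalMultilinearSeries ℂ (Cn n × Cn n) ℂ := fun k =>
  ∑ s : Fin k → Fin n × Bool, ((p k fun j => realBasisVec (s j) : ℝ) : ℂ) •
    (ContinuousMultilinearMap.mkPiAlgebra ℂ (Fin k) ℂ).compContinuousLinearMap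
      fun j => polCoord (s j)

lemma polSeries_apply (p : FormalMultilinearSeries ℝ (Cn n) ℝ) (k : ℕ) (w : Cn n × Cn n) :
    polSeries p k (fun _ => w) = ∑ s : Fin k → Fin n × Bool,
      ((p k fun j => realBasisVec (s j) : ℝ) : ℂ) * ∏ j, polCoord (s j) w := by
  simp [polSeries]

/-- On `z = x̄` the forms `polCoord` are the real coordinates of `x`, so the sum is the multilinear
expansion of `p k` in the real basis. -/
lemma polSeries_cbar (p : FormalMultilinearSeries ℝ (Cn n) ℝ) (k : ℕ) (x : Cn n) :
    polSeries p k (fun _ => (x, cbar x)) = (p k fun _ => x : ℝ) := by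
  rw [polSeries_apply]
  have h : (p k fun _ => x) = ∑ s : Fin k → Fin n × Bool,
      (p k fun j => realBasisVec (s j)) * ∏ j, realCoord (s j) x := by
    conv_lhs => rw [← sum_realCoord_smul x]
    rw [ContinuousMultilinearMap.map_sum]
    refine Finset.sum_congr rfl fun s _ => ?_
    rw [ContinuousMultilinearMap.map_smul_univ, smul_eq_mul, mul_comm]
  rw [h]
  push_cast
  simp [polCoord_cbar]

lemma conj_polSeries (p : FormalMultilinearSeries ℝ (Cn n) ℝ) (k : ℕ) (w : Cn n × Cn n) :
    conj (polSeries p k (fun _ => w)) = polSeries p k (fun _ => (cbar w.2, cbar w.1)) := by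
  simp [polSeries_apply, conj_polCoord]

lemma norm_e (i : Fin n) : ‖(e i : Cn n)‖ = 1 := by simp [e]

lemma norm_realBasisVec (s : Fin n × Bool) : ‖realBasisVec s‖ = 1 := by
  rcases s with ⟨i, _ | _⟩ <;> simp [realBasisVec, norm_smul, norm_e]

lemma norm_polCoord_le (s : Fin n × Bool) : ‖polCoord s‖ ≤ 1 := by
  refine ContinuousLinearMap.opNorm_le_bound _ zero_le_one fun p => ?_
  have h1 : ‖p.1 s.1‖ ≤ ‖p‖ := (PiLp.norm_apply_le p.1 s.1).trans (norm_fst_le p)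
  have h2 : ‖p.2 s.1‖ ≤ ‖p‖ := (PiLp.norm_apply_le p.2 s.1).trans (norm_snd_le p)
  rcases s with ⟨i, _ | _⟩ <;> simp only [polCoord]
  · have := norm_add_le (p.1 i) (p.2 i)
    simp [-smul_add] at h1 h2 ⊢
    linarith
  · have := norm_sub_le (p.1 i) (p.2 i)
    simp at h1 h2 ⊢
    linarith

/-- There are `(2n)^k` words, each contributing at most `‖p k‖` because basis vectors and forms have
norm at most one. The loss is geometric in `k`, so the radius of convergence stays positive. -/
lemma norm_polSeries_le (p : FormalMultilinearSeries ℝ (Cn n) ℝ) (k : ℕ) :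
    ‖polSeries p k‖ ≤ (Fintype.card (Fin n × Bool)) ^ k * ‖p k‖ := by
  have hs : ∀ s : Fin k → Fin n × Bool, ‖((p k fun j => realBasisVec (s j) : ℝ) : ℂ) •
      (ContinuousMultilinearMap.mkPiAlgebra ℂ (Fin k) ℂ).compContinuousLinearMap
      (fun j => polCoord (s j))‖ ≤ ‖p k‖ := by
    intro s
    rw [norm_smul, Complex.norm_real]
    have h1 : ‖p k fun j => realBasisVec (s j)‖ ≤ ‖p k‖ := by
      simpa [norm_realBasisVec] using (p k).le_opNorm fun j => realBasisVec (s j)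
    have h2 : ‖(ContinuousMultilinearMap.mkPiAlgebra ℂ (Fin k) ℂ).compContinuousLinearMap
      (fun j => polCoord (s j))‖ ≤ 1 := by
      refine (ContinuousMultilinearMap.norm_compContinuousLinearMap_le _ _).trans ?_
      rw [ContinuousMultilinearMap.norm_mkPiAlgebra, one_mul]
      exact Finset.prod_le_one (fun _ _ => norm_nonneg _) fun j _ => norm_polCoord_le _
    calc _ ≤ ‖p k‖ * 1 := mul_le_mul h1 h2 (norm_nonneg _) (norm_nonneg _)
      _ = _ := mul_one _
  refine (norm_sum_le _ _).trans ((Finset.sum_le_sum fun s _ => hs s).trans ?_)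
  simp

/-- Polarization of a real-analytic function at the origin of `ℂⁿ`. -/
theorem exists_polarization {φ : Cn n → ℝ} (hφ : AnalyticAt ℝ φ 0) :
    ∃ Ψ : Cn n × Cn n → ℂ, AnalyticAt ℂ Ψ 0 ∧ (∀ᶠ x in 𝓝 (0 : Cn n), Ψ (x, cbar x) = φ x) ∧
      ∀ᶠ p in 𝓝 (0 : Cn n × Cn n), conj (Ψ p) = Ψ (cbar p.2, cbar p.1) := by
  obtain ⟨p, r, hp⟩ := hφ
  obtain ⟨ρ, hρ0, hρ⟩ := ENNReal.lt_iff_exists_nnreal_btwn.1 hp.r_pos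
  obtain ⟨C, hC0, hC⟩ := p.norm_mul_pow_le_of_lt_radius (hρ.trans_le hp.r_le)
  -- The added one keeps `M` positive when `n = 0`, so that `ρ / M` is a genuine radius.
  set M : NNReal := (Fintype.card (Fin n × Bool) : NNReal) + 1 with hM
  have hM0 : 0 < M := by positivity
  have hrad : ((ρ / M : NNReal) : ENNReal) ≤ (polSeries p).radius := by
    refine (polSeries p).le_radius_of_bound C fun k => ?_
    refine le_trans ?_ (hC k)
    have h1 := norm_polSeries_le p k
    have h2 : (Fintype.card (Fin n × Bool) : ℝ) ^ k ≤ (M : ℝ) ^ k := by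
      gcongr; simp [hM]
    have hMr : (0 : ℝ) < M := hM0
    calc ‖polSeries p k‖ * ((ρ / M : NNReal) : ℝ) ^ k
        ≤ ((M : ℝ) ^ k * ‖p k‖) * ((ρ / M : NNReal) : ℝ) ^ k := by
          gcongr; exact h1.trans (by gcongr)
      _ = ‖p k‖ * (ρ : ℝ) ^ k := by
          rw [NNReal.coe_div, div_pow]; field_simp
  have hpos : 0 < (polSeries p).radius := by
    refine lt_of_lt_of_le ?_ hrad
    have : (0 : NNReal) < ρ := by simpa using hρ0
    exact ENNReal.coe_pos.2 (div_pos this hM0)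
  have hq := (polSeries p).hasFPowerSeriesOnBall hpos
  refine ⟨(polSeries p).sum, hq.analyticAt, ?_, ?_⟩
  · have h1 : ∀ᶠ x in 𝓝 (0 : Cn n), x ∈ Metric.eball (0 : Cn n) r :=
      Metric.eball_mem_nhds _ hp.r_pos
    filter_upwards [h1] with x hx
    have h3 := (hp.hasSum hx).mapL Complex.ofRealCLM
    rw [FormalMultilinearSeries.sum]
    simp only [polSeries_cbar]
    simpa using h3.tsum_eq
  · refine Eventually.of_forall fun w => ?_
    simp only [FormalMultilinearSeries.sum, ← conj_polSeries]
    exact Complex.conj_tsum _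

end Polarization

/-! ### Analyticity of averages along paths of linear maps. -/

section ParametricIntegrals

variable {E E' F : Type*} [NormedAddCommGroup E] [NormedSpace ℂ E] [NormedAddCommGroup E']
  [NormedSpace ℂ E'] [NormedAddCommGroup F] [NormedSpace ℂ F] [CompleteSpace F]

/-- Averages of an analytic germ over a path of linear maps with a common fixed base point are
analytic. -/
theorem analyticAt_integral_comp_linear {f : E' → F} {a : E} {a' : E'} (hf : AnalyticAt ℂ f a')
    {g : ℝ → ℂ} (hg : Continuous g) {A : ℝ → E →L[ℂ] E'} (hA : Continuous A)
    (hA1 : ∀ t ∈ Set.Icc (0 : ℝ) 1, ‖A t‖ ≤ 1) (hAa : ∀ t, A t a = a') :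
    AnalyticAt ℂ (fun w => ∫ t in (0 : ℝ)..1, g t • f (A t w)) a := by
  obtain ⟨p, r, hp⟩ := hf
  obtain ⟨ρ, hρ0, hρ⟩ := ENNReal.lt_iff_exists_nnreal_btwn.1 hp.r_pos
  obtain ⟨G, hG⟩ := (isCompact_Icc (a := (0 : ℝ)) (b := 1)).exists_bound_of_continuousOn
    hg.continuousOn
  have hG0 : 0 ≤ G := (norm_nonneg _).trans (hG 0 (by simp))
  obtain ⟨C, hC0, hC⟩ := p.norm_mul_pow_le_of_lt_radius (hρ.trans_le hp.r_le)
  have hcont : ∀ k, Continuous fun t => g t •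
      (p k).compContinuousLinearMap fun _ : Fin k => A t := by
    intro k
    refine hg.smul ?_
    have h1 : Continuous fun t => ContinuousMultilinearMap.compContinuousLinearMapContinuousMultilinear
      ℂ (fun _ : Fin k => E) (fun _ : Fin k => E') F (fun _ => A t) :=
      (ContinuousMultilinearMap.cont _).comp (continuous_pi fun _ => hA)
    exact h1.clm_apply continuous_const
  have hnorm : ∀ k, ∀ t ∈ Set.Icc (0 : ℝ) 1, ‖g t •
      (p k).compContinuousLinearMap (fun _ : Fin k => A t)‖ ≤ G * ‖p k‖ := by
    intro k t ht
    rw [norm_smul]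
    refine mul_le_mul (hG t ht) ?_ (norm_nonneg _) hG0
    refine (ContinuousMultilinearMap.norm_compContinuousLinearMap_le _ _).trans ?_
    refine mul_le_of_le_one_right (norm_nonneg _) ?_
    exact Finset.prod_le_one (fun _ _ => norm_nonneg _) fun _ _ => hA1 t ht
  -- The average is expanded term by term. Contractions `A t` do not increase the norm of `p k`, so
  -- the averaged series keeps the radius `ρ`.
  set q : FormalMultilinearSeries ℂ E F := fun k => ∫ t in (0 : ℝ)..1, g t •
      (p k).compContinuousLinearMap fun _ : Fin k => A t with hq
  have hIoc : ∀ t ∈ Set.uIoc (0 : ℝ) 1, t ∈ Set.Icc (0 : ℝ) 1 := by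
    intro t ht
    rw [Set.uIoc_of_le zero_le_one] at ht
    exact ⟨ht.1.le, ht.2⟩
  have hqnorm : ∀ k, ‖q k‖ ≤ G * ‖p k‖ := by
    intro k
    have := intervalIntegral.norm_integral_le_of_norm_le_const
      (fun t ht => hnorm k t (hIoc t ht))
    simpa using this
  refine ⟨q, ρ, ⟨?_, hρ0, ?_⟩⟩
  · refine q.le_radius_of_bound (G * C) fun k => ?_
    calc ‖q k‖ * (ρ : ℝ) ^ k ≤ (G * ‖p k‖) * (ρ : ℝ) ^ k := by gcongr; exact hqnorm k
      _ = G * (‖p k‖ * (ρ : ℝ) ^ k) := by ring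
      _ ≤ G * C := by gcongr; exact hC k
  · intro y hy
    have hyρ : ‖y‖ < ρ := by
      have := hy
      rw [Metric.mem_eball, edist_zero_right] at this
      exact_mod_cast (show (‖y‖₊ : ENNReal) < ρ from this)
    have hAy : ∀ t ∈ Set.Icc (0 : ℝ) 1, ‖A t y‖ ≤ ‖y‖ := fun t ht => by
      simpa using (A t).le_of_opNorm_le (hA1 t ht) y
    have hsum : Summable fun k => ‖p k‖ * ‖y‖ ^ k := by
      have : ((‖y‖₊ : NNReal) : ENNReal) < p.radius := by
        refine lt_of_lt_of_le ?_ (hρ.le.trans hp.r_le)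
        exact_mod_cast hyρ
      simpa using p.summable_norm_mul_pow this
    have hval : ∀ k, (q k fun _ => y) = ∫ t in (0 : ℝ)..1, g t • p k fun _ => A t y := by
      intro k
      have h2 := (ContinuousMultilinearMap.apply ℂ (fun _ : Fin k => E) F
        (fun _ => y)).intervalIntegral_comp_comm ((hcont k).intervalIntegrable (μ := volume) 0 1)
      simp only [hq]
      rw [← ContinuousMultilinearMap.apply_apply (𝕜 := ℂ), ← h2]
      rfl
    simp only [hval]
    refine intervalIntegral.hasSum_integral_of_dominated_convergence
      (fun k _ => G * (‖p k‖ * ‖y‖ ^ k)) ?_ ?_ ?_ ?_ ?_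
    · intro k
      refine (Continuous.aestronglyMeasurable ?_)
      exact hg.smul ((p k).cont.comp (continuous_pi fun _ => hA.clm_apply continuous_const))
    · intro k
      refine Eventually.of_forall fun t ht => ?_
      have ht' := hIoc t ht
      rw [norm_smul]
      refine mul_le_mul (hG t ht') ?_ (norm_nonneg _) hG0
      refine ((p k).le_opNorm _).trans ?_
      simp only [Finset.prod_const, Finset.card_univ, Fintype.card_fin]
      gcongr
      exact hAy t ht'
    · exact Eventually.of_forall fun t _ => hsum.mul_left G
    · exact intervalIntegrable_const
    · refine Eventually.of_forall fun t ht => ?_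
      have ht' := hIoc t ht
      rw [map_add, hAa]
      refine (hp.hasSum ?_).const_smul (g t)
      rw [Metric.mem_eball, edist_zero_right]
      refine lt_of_le_of_lt ?_ hρ
      have h3 := (hAy t ht').trans hyρ.le
      have : ‖A t y‖₊ ≤ ρ := by exact_mod_cast h3
      exact_mod_cast this

/-- Differentiation of averages of an analytic germ over a path of linear maps. -/
theorem eventually_hasFDerivAt_integral_comp_linear {f : E' → F} {a : E} {a' : E'}
    (hf : AnalyticAt ℂ f a')
    {g : ℝ → ℂ} (hg : Continuous g) {A : ℝ → E →L[ℂ] E'} (hA : Continuous A)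
    (hA1 : ∀ t ∈ Set.Icc (0 : ℝ) 1, ‖A t‖ ≤ 1) (hAa : ∀ t, A t a = a') :
    ∀ᶠ w in 𝓝 a, HasFDerivAt (fun w => ∫ t in (0 : ℝ)..1, g t • f (A t w))
      (∫ t in (0 : ℝ)..1, g t • (fderiv ℂ f (A t w)).comp (A t)) w := by
  have h1 := hf.eventually_analyticAt
  have h2 : ∀ᶠ y in 𝓝 a', ‖fderiv ℂ f y‖ < ‖fderiv ℂ f a'‖ + 1 :=
    hf.fderiv.continuousAt.norm.eventually_lt continuousAt_const (by simp)
  obtain ⟨ε, hε, hball⟩ := Metric.eventually_nhds_iff_ball.1 (h1.and h2)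
  obtain ⟨G, hG⟩ := (isCompact_Icc (a := (0 : ℝ)) (b := 1)).exists_bound_of_continuousOn
    hg.continuousOn
  have hG0 : 0 ≤ G := (norm_nonneg _).trans (hG 0 (by simp))
  -- A common base point and norm at most one give a neighbourhood that works for all `t` at once.
  have hmem : ∀ w ∈ ball a ε, ∀ t ∈ Set.Icc (0 : ℝ) 1, A t w ∈ ball a' ε := by
    intro w hw t ht
    rw [mem_ball, dist_eq_norm, ← hAa t, ← map_sub]
    refine lt_of_le_of_lt ((A t).le_of_opNorm_le (hA1 t ht) _) ?_
    simpa [dist_eq_norm] using hw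
  filter_upwards [ball_mem_nhds a hε] with w hw
  have hIoc : ∀ t ∈ Set.uIoc (0 : ℝ) 1, t ∈ Set.Icc (0 : ℝ) 1 := by
    intro t ht
    rw [Set.uIoc_of_le zero_le_one] at ht
    exact ⟨ht.1.le, ht.2⟩
  have hpath : ∀ w, Continuous fun t => A t w := fun w => hA.clm_apply continuous_const
  have hc1 : ∀ w ∈ ball a ε, ContinuousOn (fun t => g t • f (A t w)) (Set.Icc 0 1) := by
    intro w hw
    refine hg.continuousOn.smul fun t ht => ?_
    exact ((hball _ (hmem w hw t ht)).1.continuousAt.comp (f := fun t => A t w)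
      (hpath w).continuousAt).continuousWithinAt
  have hc2 : ContinuousOn (fun t => g t • (fderiv ℂ f (A t w)).comp (A t)) (Set.Icc 0 1) := by
    refine hg.continuousOn.smul (ContinuousOn.clm_comp (fun t ht => ?_) hA.continuousOn)
    exact ((hball _ (hmem w hw t ht)).1.fderiv.continuousAt.comp
      (f := fun t => A t w) (hpath w).continuousAt).continuousWithinAt
  refine intervalIntegral.hasFDerivAt_integral_of_dominated_of_fderiv_le
    (F := fun w t => g t • f (A t w))
    (F' := fun w t => g t • (fderiv ℂ f (A t w)).comp (A t))
    (bound := fun _ => G * (‖fderiv ℂ f a'‖ + 1)) (isOpen_ball.mem_nhds hw) ?_ ?_ ?_ ?_ ?_ ?_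
  · filter_upwards [isOpen_ball.mem_nhds hw] with w' hw'
    rw [Set.uIoc_of_le zero_le_one]
    exact ((hc1 w' hw').mono Set.Ioc_subset_Icc_self).aestronglyMeasurable measurableSet_Ioc
  · refine ContinuousOn.intervalIntegrable ?_
    rw [Set.uIcc_of_le zero_le_one]
    exact hc1 w hw
  · rw [Set.uIoc_of_le zero_le_one]
    exact (hc2.mono Set.Ioc_subset_Icc_self).aestronglyMeasurable measurableSet_Ioc
  · refine Eventually.of_forall fun t ht w' hw' => ?_
    have ht' := hIoc t ht
    rw [norm_smul]
    refine mul_le_mul (hG t ht') ?_ (norm_nonneg _) hG0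
    refine (ContinuousLinearMap.opNorm_comp_le _ _).trans ?_
    calc _ ≤ ‖fderiv ℂ f (A t w')‖ * 1 := by gcongr; exact hA1 t ht'
      _ ≤ _ := by rw [mul_one]; exact (hball _ (hmem w' hw' t ht')).2.le
  · exact intervalIntegrable_const
  · refine Eventually.of_forall fun t ht w' hw' => ?_
    have h3 := (hball _ (hmem w' hw' t (hIoc t ht))).1.differentiableAt.hasFDerivAt
    exact (h3.comp w' (A t).hasFDerivAt).const_smul (g t)

/-- The fundamental theorem of calculus along a path of linear maps: only segments are needed. -/
theorem eventually_segment_sub_eq {f : E' → F} {a : E} {a' : E'} (hf : AnalyticAt ℂ f a')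
    {A B : E →L[ℂ] E'} (hA1 : ∀ t ∈ Set.Icc (0 : ℝ) 1, ‖B + (t : ℂ) • (A - B)‖ ≤ 1)
    (hA : A a = a') (hB : B a = a') :
    ∀ᶠ w in 𝓝 a, f (A w) - f (B w) =
      ∫ t in (0 : ℝ)..1, fderiv ℂ f ((B + (t : ℂ) • (A - B)) w) (A w - B w) := by
  obtain ⟨ε, hε, hball⟩ := Metric.eventually_nhds_iff_ball.1 hf.eventually_analyticAt
  filter_upwards [ball_mem_nhds a hε] with w hw
  have hmem : ∀ t ∈ Set.Icc (0 : ℝ) 1, (B + (t : ℂ) • (A - B)) w ∈ ball a' ε := by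
    intro t ht
    have : (B + (t : ℂ) • (A - B)) a = a' := by simp [hA, hB]
    rw [mem_ball, dist_eq_norm, ← this, ← map_sub]
    refine lt_of_le_of_lt (ContinuousLinearMap.le_of_opNorm_le _ (hA1 t ht) _) ?_
    simpa [dist_eq_norm] using hw
  have hpath : ∀ t : ℝ, HasDerivAt (fun t : ℝ => (B + (t : ℂ) • (A - B)) w) (A w - B w) t := by
    intro t
    have h1 : HasDerivAt (fun t : ℝ => (t : ℂ) • (A w - B w)) ((1 : ℂ) • (A w - B w)) t :=
      (Complex.ofRealCLM.hasDerivAt (x := t)).smul_const _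
    simpa using h1.const_add (B w)
  rw [intervalIntegral.integral_eq_sub_of_hasDerivAt
      (f := fun t : ℝ => f ((B + (t : ℂ) • (A - B)) w)) ?_ ?_]
  · simp
  · intro t ht
    rw [Set.uIcc_of_le zero_le_one] at ht
    exact ((hball _ (hmem t ht)).differentiableAt.hasFDerivAt.restrictScalars ℝ).comp_hasDerivAt t
      (hpath t)
  · refine ContinuousOn.intervalIntegrable fun t ht => ?_
    rw [Set.uIcc_of_le zero_le_one] at ht
    refine ContinuousAt.continuousWithinAt ?_
    exact ((hball _ (hmem t ht)).fderiv.continuousAt.comp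
      (f := fun t : ℝ => (B + (t : ℂ) • (A - B)) w) (hpath t).continuousAt).clm_apply
      continuousAt_const

end ParametricIntegrals

/-! ### Division of amplitudes near the diagonal `y = x`. -/

section AmplitudeDivision

variable {n : ℕ}

/-- `ℂⁿ × ℂⁿ × ℂⁿ`, with points `(x, y, θ)`. -/
abbrev Cn3 (n : ℕ) : Type := Cn n × Cn n × Cn n

/-- `∂f/∂y_i` for `f(x, y, θ)`. -/
def pY (i : Fin n) (f : Cn3 n → ℂ) (q : Cn3 n) : ℂ := fderiv ℂ f q (0, e i, 0)

/-- `∂f/∂θ_i` for `f(x, y, θ)`. -/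
def pT (i : Fin n) (f : Cn3 n → ℂ) (q : Cn3 n) : ℂ := fderiv ℂ f q (0, 0, e i)

/-- `∑ ∂²f/∂θ_i∂y_i` for `f(x, y, θ)`. -/
def LL (f : Cn3 n → ℂ) (q : Cn3 n) : ℂ := ∑ i, pT i (pY i f) q

lemma analyticAt_pY {f : Cn3 n → ℂ} {p : Cn3 n} (hf : AnalyticAt ℂ f p) (i : Fin n) :
    AnalyticAt ℂ (pY i f) p :=
  ((ContinuousLinearMap.apply ℂ ℂ ((0, e i, 0) : Cn3 n)).analyticAt _).comp hf.fderiv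

lemma analyticAt_pT {f : Cn3 n → ℂ} {p : Cn3 n} (hf : AnalyticAt ℂ f p) (i : Fin n) :
    AnalyticAt ℂ (pT i f) p :=
  ((ContinuousLinearMap.apply ℂ ℂ ((0, 0, e i) : Cn3 n)).analyticAt _).comp hf.fderiv

lemma analyticAt_LL {f : Cn3 n → ℂ} {p : Cn3 n} (hf : AnalyticAt ℂ f p) :
    AnalyticAt ℂ (LL f) p :=
  Finset.analyticAt_fun_sum _ fun i _ => analyticAt_pT (analyticAt_pY hf i) i

lemma analyticAt_iterate_LL {f : Cn3 n → ℂ} {p : Cn3 n} (hf : AnalyticAt ℂ f p) (l : ℕ) :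
    AnalyticAt ℂ (LL^[l] f) p := by
  induction l with
  | zero => exact hf
  | succ l ih => rw [Function.iterate_succ_apply']; exact analyticAt_LL ih

lemma pY_congr {f g : Cn3 n → ℂ} {p : Cn3 n} (h : f =ᶠ[𝓝 p] g) (i : Fin n) :
    pY i f =ᶠ[𝓝 p] pY i g := by
  filter_upwards [h.fderiv (𝕜 := ℂ)] with q hq
  simp [pY, hq]

lemma pT_congr {f g : Cn3 n → ℂ} {p : Cn3 n} (h : f =ᶠ[𝓝 p] g) (i : Fin n) :
    pT i f =ᶠ[𝓝 p] pT i g := by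
  filter_upwards [h.fderiv (𝕜 := ℂ)] with q hq
  simp [pT, hq]

lemma LL_congr {f g : Cn3 n → ℂ} {p : Cn3 n} (h : f =ᶠ[𝓝 p] g) : LL f =ᶠ[𝓝 p] LL g := by
  filter_upwards [eventually_all.2 fun i => pT_congr (pY_congr h i) i] with q hq
  simp [LL, hq]

/-- The projection `(x, y, θ) ↦ (x, x, θ)`. -/
def diagL (n : ℕ) : Cn3 n →L[ℂ] Cn3 n :=
  (ContinuousLinearMap.fst ℂ _ _).prod ((ContinuousLinearMap.fst ℂ _ _).prod
    ((ContinuousLinearMap.snd ℂ _ _).comp (ContinuousLinearMap.snd ℂ _ _)))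

@[simp] lemma diagL_apply (q : Cn3 n) : diagL n q = (q.1, q.1, q.2.2) := rfl

/-- The contraction `(x, y, θ) ↦ (x, x + t (y - x), θ)`. -/
def pathL (n : ℕ) (t : ℝ) : Cn3 n →L[ℂ] Cn3 n :=
  diagL n + (t : ℂ) • (ContinuousLinearMap.id ℂ (Cn3 n) - diagL n)

lemma pathL_apply (t : ℝ) (q : Cn3 n) :
    pathL n t q = (q.1, q.1 + (t : ℂ) • (q.2.1 - q.1), q.2.2) := by
  obtain ⟨x, y, z⟩ := q
  simp [pathL]

lemma continuous_pathL : Continuous (pathL n) := by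
  unfold pathL; fun_prop

lemma norm_add_smul_sub_le {V : Type*} [NormedAddCommGroup V] [NormedSpace ℂ V] {a b : V} {R t : ℝ}
    (ha : ‖a‖ ≤ R) (hb : ‖b‖ ≤ R) (ht : t ∈ Set.Icc (0 : ℝ) 1) : ‖a + (t : ℂ) • (b - a)‖ ≤ R := by
  have h : a + (t : ℂ) • (b - a) = ((1 - t : ℝ) : ℂ) • a + (t : ℂ) • b := by
    push_cast; module
  rw [h]
  refine (norm_add_le _ _).trans ?_
  rw [norm_smul, norm_smul, Complex.norm_real, Complex.norm_real,
    Real.norm_of_nonneg ht.1, Real.norm_of_nonneg (by linarith [ht.2])]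
  nlinarith [ht.1, ht.2]

lemma norm_pathL_le {t : ℝ} (ht : t ∈ Set.Icc (0 : ℝ) 1) : ‖pathL n t‖ ≤ 1 := by
  refine ContinuousLinearMap.opNorm_le_bound _ zero_le_one fun q => ?_
  rw [pathL_apply, one_mul]
  have h1 : ‖q.1‖ ≤ ‖q‖ := norm_fst_le q
  have h2 : ‖q.2‖ ≤ ‖q‖ := norm_snd_le q
  refine norm_prod_le_iff.2 ⟨h1, norm_prod_le_iff.2 ⟨?_, (norm_snd_le q.2).trans h2⟩⟩
  exact norm_add_smul_sub_le h1 ((norm_fst_le q.2).trans h2) ht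

lemma diagL_fix {p : Cn3 n} (hp : p.2.1 = p.1) : diagL n p = p := by
  obtain ⟨x, y, z⟩ := p
  simp at hp
  simp [hp]

lemma pathL_fix {p : Cn3 n} (hp : p.2.1 = p.1) (t : ℝ) : pathL n t p = p := by
  simp only [pathL, add_apply, smul_apply, sub_apply, diagL_fix hp, ContinuousLinearMap.id_apply]
  simp

/-- `∫₀¹ tᶜ f(x, x + t (y - x), θ) dt`. -/
def EE (c : ℕ) (f : Cn3 n → ℂ) (q : Cn3 n) : ℂ :=
  ∫ t in (0 : ℝ)..1, ((t : ℂ) ^ c) • f (pathL n t q)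

lemma analyticAt_EE {f : Cn3 n → ℂ} {p : Cn3 n} (hp : p.2.1 = p.1) (hf : AnalyticAt ℂ f p)
    (c : ℕ) : AnalyticAt ℂ (EE c f) p :=
  analyticAt_integral_comp_linear hf (by fun_prop) continuous_pathL (fun _ ht => norm_pathL_le ht)
    (pathL_fix hp)

/-- The contraction fixes the diagonal, leaving `∫₀¹ tᶜ dt`. These factors accumulate to the `1/l!`
in the operator `S`. -/
lemma EE_diag (c : ℕ) (f : Cn3 n → ℂ) (q : Cn3 n) :
    EE c f (diagL n q) = ((c : ℂ) + 1)⁻¹ * f (diagL n q) := by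
  have h : ∀ t, pathL n t (diagL n q) = diagL n q := fun t => pathL_fix rfl t
  simp only [EE, h]
  rw [intervalIntegral.integral_smul_const, smul_eq_mul]
  congr 1
  have : ∀ t : ℝ, (t : ℂ) ^ c = ((t ^ c : ℝ) : ℂ) := fun t => by push_cast; rfl
  simp only [this]
  rw [intervalIntegral.integral_ofReal, integral_pow]
  simp

lemma eventually_intervalIntegrable {F : Type*} [NormedAddCommGroup F] [NormedSpace ℂ F]
    {f : Cn3 n → F} {p : Cn3 n} (hp : p.2.1 = p.1)
    (hf : ∀ᶠ q in 𝓝 p, ContinuousAt f q) {G : ℝ → ℂ} (hG : Continuous G) :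
    ∀ᶠ q in 𝓝 p, IntervalIntegrable (fun t => G t • f (pathL n t q)) volume 0 1 := by
  obtain ⟨ε, hε, hball⟩ := Metric.eventually_nhds_iff_ball.1 hf
  filter_upwards [ball_mem_nhds p hε] with q hq
  refine ContinuousOn.intervalIntegrable fun t ht => ?_
  rw [Set.uIcc_of_le zero_le_one] at ht
  have : pathL n t q ∈ ball p ε := by
    rw [mem_ball, dist_eq_norm, ← pathL_fix hp t, ← map_sub]
    refine lt_of_le_of_lt ((pathL n t).le_of_opNorm_le (norm_pathL_le ht) _) ?_
    simpa [dist_eq_norm] using hq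
  refine ContinuousAt.continuousWithinAt (hG.continuousAt.smul ?_)
  exact (hball _ this).comp (f := fun t => pathL n t q)
    (continuous_pathL.clm_apply continuous_const).continuousAt

lemma fderiv_EE_apply {f : Cn3 n → ℂ} {p : Cn3 n} (hp : p.2.1 = p.1) (hf : AnalyticAt ℂ f p)
    (c : ℕ) (d : Cn3 n) : ∀ᶠ q in 𝓝 p, fderiv ℂ (EE c f) q d =
      ∫ t in (0 : ℝ)..1, ((t : ℂ) ^ c) • fderiv ℂ f (pathL n t q) (pathL n t d) := by
  have h1 := eventually_hasFDerivAt_integral_comp_linear hf (g := fun t => (t : ℂ) ^ c)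
    (by fun_prop) continuous_pathL (fun _ ht => norm_pathL_le ht) (pathL_fix hp)
  obtain ⟨ε, hε, hball⟩ := Metric.eventually_nhds_iff_ball.1 hf.eventually_analyticAt
  filter_upwards [h1, ball_mem_nhds p hε] with q hq hqε
  have h2 : fderiv ℂ (EE c f) q = _ := hq.fderiv
  rw [h2, ContinuousLinearMap.intervalIntegral_apply]
  · rfl
  · refine ContinuousOn.intervalIntegrable fun t ht => ?_
    rw [Set.uIcc_of_le zero_le_one] at ht
    have : pathL n t q ∈ ball p ε := by
      rw [mem_ball, dist_eq_norm, ← pathL_fix hp t, ← map_sub]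
      refine lt_of_le_of_lt ((pathL n t).le_of_opNorm_le (norm_pathL_le ht) _) ?_
      simpa [dist_eq_norm] using hqε
    refine ContinuousAt.continuousWithinAt (ContinuousAt.smul
      (by fun_prop : Continuous fun t : ℝ => (t : ℂ) ^ c).continuousAt ?_)
    exact ((hball _ this).fderiv.continuousAt.comp (f := fun t => pathL n t q)
      (continuous_pathL.clm_apply continuous_const).continuousAt).clm_comp
      continuous_pathL.continuousAt

/-- The contraction scales the `y`-directions by `t`, so a `y`-derivative raises the exponent by
one. The `θ`-directions are not scaled, and `pT_EE` leaves the exponent alone. -/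
lemma pY_EE {f : Cn3 n → ℂ} {p : Cn3 n} (hp : p.2.1 = p.1) (hf : AnalyticAt ℂ f p) (c : ℕ)
    (i : Fin n) : pY i (EE c f) =ᶠ[𝓝 p] EE (c + 1) (pY i f) := by
  filter_upwards [fderiv_EE_apply hp hf c (0, e i, 0)] with q hq
  rw [pY, hq, EE]
  refine intervalIntegral.integral_congr fun t _ => ?_
  have : pathL n t (0, e i, 0) = (t : ℂ) • (0, e i, 0) := by simp [pathL_apply]
  simp only [this, map_smul, pY, smul_eq_mul]
  ring

lemma pT_EE {f : Cn3 n → ℂ} {p : Cn3 n} (hp : p.2.1 = p.1) (hf : AnalyticAt ℂ f p) (c : ℕ)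
    (i : Fin n) : pT i (EE c f) =ᶠ[𝓝 p] EE c (pT i f) := by
  filter_upwards [fderiv_EE_apply hp hf c (0, 0, e i)] with q hq
  rw [pT, hq, EE]
  refine intervalIntegral.integral_congr fun t _ => ?_
  have : pathL n t (0, 0, e i) = (0, 0, e i) := by simp [pathL_apply]
  simp only [this, pT]

lemma EE_sum {f : Fin n → Cn3 n → ℂ} {p : Cn3 n} (hp : p.2.1 = p.1)
    (hf : ∀ i, AnalyticAt ℂ (f i) p) (c : ℕ) :
    (fun q => ∑ i, EE c (f i) q) =ᶠ[𝓝 p] EE c fun q => ∑ i, f i q := by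
  have h := fun i => eventually_intervalIntegrable hp
    ((hf i).eventually_analyticAt.mono fun q hq => hq.continuousAt)
    (G := fun t => (t : ℂ) ^ c) (by fun_prop)
  filter_upwards [eventually_all.2 h] with q hq
  simp only [EE]
  rw [← intervalIntegral.integral_finsetSum fun i _ => hq i]
  simp only [Finset.smul_sum]

lemma sum_pT_EE_pY {f : Cn3 n → ℂ} {p : Cn3 n} (hp : p.2.1 = p.1) (hf : AnalyticAt ℂ f p)
    (c : ℕ) : (fun q => ∑ i, pT i (EE c (pY i f)) q) =ᶠ[𝓝 p] EE c (LL f) := by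
  have h1 := fun i => pT_EE hp (analyticAt_pY hf i) c i
  have h2 := EE_sum hp (fun i => analyticAt_pT (analyticAt_pY hf i) i) c
  filter_upwards [eventually_all.2 h1, h2] with q h1 h2
  simp only [h1]
  exact h2

lemma LL_EE {f : Cn3 n → ℂ} {p : Cn3 n} (hp : p.2.1 = p.1) (hf : AnalyticAt ℂ f p) (c : ℕ) :
    LL (EE c f) =ᶠ[𝓝 p] EE (c + 1) (LL f) := by
  have h1 := fun i => pT_congr (pY_EE hp hf c i) i
  filter_upwards [eventually_all.2 h1, sum_pT_EE_pY hp hf (c + 1)] with q h1 h2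
  rw [LL, ← h2]
  exact Finset.sum_congr rfl fun i _ => h1 i

lemma iterate_LL_EE {f : Cn3 n → ℂ} {p : Cn3 n} (hp : p.2.1 = p.1) (hf : AnalyticAt ℂ f p)
    (c m : ℕ) : LL^[m] (EE c f) =ᶠ[𝓝 p] EE (c + m) (LL^[m] f) := by
  induction m with
  | zero => exact EventuallyEq.rfl
  | succ m ih =>
    simp only [Function.iterate_succ_apply']
    exact (LL_congr ih).trans (LL_EE hp (analyticAt_iterate_LL hf m) (c + m))

/-- The operator `f ↦ ∫₀¹ (D_θ·D_y f)(x, x + t (y - x), θ) dt`. -/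
def TT (f : Cn3 n → ℂ) : Cn3 n → ℂ := EE 0 (LL f)

lemma analyticAt_iterate_TT {f : Cn3 n → ℂ} {p : Cn3 n} (hp : p.2.1 = p.1)
    (hf : AnalyticAt ℂ f p) (m : ℕ) : AnalyticAt ℂ (TT^[m] f) p := by
  induction m with
  | zero => exact hf
  | succ m ih => rw [Function.iterate_succ_apply']; exact analyticAt_EE hp (analyticAt_LL ih) 0

lemma eventually_diagL {p : Cn3 n} (hp : p.2.1 = p.1) {P : Cn3 n → Prop} (h : ∀ᶠ q in 𝓝 p, P q) :
    ∀ᶠ q in 𝓝 p, P (diagL n q) := by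
  have : Tendsto (diagL n) (𝓝 p) (𝓝 p) := by
    have := (diagL n).continuous.tendsto p
    rwa [diagL_fix hp] at this
  exact this.eventually h

/-- Induction with the innermost `TT` peeled off: writing `L` for `LL`, one has `Lᵐ (EE 0 (L f)) =
EE m (L^{m+1} f)`, and on the diagonal `EE m` contributes `1/(m+1)`, turning `1/m!` into `1/(m+1)!`.
-/
lemma iterate_TT_diag {p : Cn3 n} (hp : p.2.1 = p.1) (m : ℕ) : ∀ {f : Cn3 n → ℂ},
    AnalyticAt ℂ f p → ∀ᶠ q in 𝓝 p,
      (TT^[m] f) (diagL n q) = (m.factorial : ℂ)⁻¹ * (LL^[m] f) (diagL n q) := by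
  induction m with
  | zero => intro f _; simp
  | succ m ih =>
    intro f hf
    filter_upwards [ih (analyticAt_EE hp (analyticAt_LL hf) 0),
      eventually_diagL hp (iterate_LL_EE hp (analyticAt_LL hf) 0 m)] with q h1 h2
    rw [Function.iterate_succ_apply, TT, h1, h2, EE_diag, ← Function.iterate_succ_apply,
      Nat.factorial_succ]
    push_cast
    rw [mul_inv]
    ring

/-- Hadamard's lemma in the variable `y`. -/
lemma hadamard {f : Cn3 n → ℂ} {p : Cn3 n} (hp : p.2.1 = p.1) (hf : AnalyticAt ℂ f p) :
    ∀ᶠ q in 𝓝 p, f q = f (diagL n q) + ∑ i, (q.2.1 i - q.1 i) * EE 0 (pY i f) q := by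
  have h1 := eventually_segment_sub_eq hf (A := ContinuousLinearMap.id ℂ (Cn3 n)) (B := diagL n)
    (fun t ht => norm_pathL_le ht) rfl (diagL_fix hp)
  have h2 := fun i => eventually_intervalIntegrable hp
    ((analyticAt_pY hf i).eventually_analyticAt.mono fun q hq => hq.continuousAt)
    (G := fun t => (t : ℂ) ^ 0) (by fun_prop)
  filter_upwards [h1, eventually_all.2 h2] with q h1 h2
  have h3 : f q = f (diagL n q) + (f (ContinuousLinearMap.id ℂ (Cn3 n) q) - f (diagL n q)) := by
    simp
  rw [h3, h1]
  congr 1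
  simp only [EE, ← smul_eq_mul]
  simp only [← intervalIntegral.integral_smul]
  rw [← intervalIntegral.integral_finsetSum
    (f := fun i (t : ℝ) => (q.2.1 i - q.1 i) • (t : ℂ) ^ 0 • pY i f (pathL n t q))
    fun i _ => (h2 i).smul (q.2.1 i - q.1 i)]
  refine intervalIntegral.integral_congr fun t _ => ?_
  have h4 : ContinuousLinearMap.id ℂ (Cn3 n) q - diagL n q =
      ∑ i, (q.2.1 i - q.1 i) • ((0, e i, 0) : Cn3 n) := by
    have h5 := sum_smul_e (q.2.1 - q.1)
    have h6 : ∑ i, (q.2.1 i - q.1 i) • ((0, e i, 0) : Cn3 n) =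
        (0, ∑ i, (q.2.1 - q.1) i • e i, 0) := by
      simp only [Prod.smul_mk, smul_zero, PiLp.sub_apply]
      rw [Prod.ext_iff]
      refine ⟨by simp [Prod.fst_sum], Prod.ext ?_ ?_⟩ <;> simp [Prod.fst_sum, Prod.snd_sum]
    rw [h6, h5]
    exact Prod.ext (by simp) (Prod.ext (by simp) (by simp))
  simp only [h4, map_sum, map_smul, pY, pow_zero, smul_eq_mul, one_mul]
  rfl

/-- Division of an amplitude by the relations `∂_{θ_i} + k (x_i - y_i) ≡ 0`. -/
theorem exists_amplitude_division {f : Cn3 n → ℂ} {p : Cn3 n} (hp : p.2.1 = p.1)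
    (hf : AnalyticAt ℂ f p) (M : ℕ) :
    ∃ g : ℕ → Fin n → Cn3 n → ℂ, (∀ l i, AnalyticAt ℂ (g l i) p) ∧
      ∀ᶠ q in 𝓝 p, ∀ κ : ℂ, κ ≠ 0 →
        f q = ∑ l ∈ Finset.range M, (κ ^ l)⁻¹ * ((l.factorial : ℂ)⁻¹ * (LL^[l] f) (diagL n q))
          + (κ ^ M)⁻¹ * (TT^[M] f) q
          + ∑ l ∈ Finset.range M, (κ ^ (l + 1))⁻¹ *
              ∑ i, (pT i (g l i) q + κ * ((q.1 i - q.2.1 i) * g l i q)) := by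
  have hT := fun l => analyticAt_iterate_TT hp hf l
  -- Minus the Hadamard quotients of `TT^[l] f`. With `g` so chosen, `(x - y)·g` is the off-diagonal
  -- part of `TT^[l] f` and `div_θ g = -TT^[l+1] f`.
  refine ⟨fun l i => EE 0 (fun q => - pY i (TT^[l] f) q), fun l i =>
    analyticAt_EE hp (analyticAt_pY (hT l) i).neg 0, ?_⟩
  have hneg : ∀ l i, EE 0 (fun q => - pY i (TT^[l] f) q) = fun q => - EE 0 (pY i (TT^[l] f)) q := by
    intro l i
    ext q
    simp [EE]
  simp only [hneg]
  induction M with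
  | zero => exact Eventually.of_forall fun q κ _ => by simp
  | succ M ih =>
    -- The old remainder is split by Hadamard's lemma: its diagonal part is the new term `l = M`,
    -- and trading `(x - y)·g` for the relation leaves `κ⁻¹ TT^[M+1] f`.
    filter_upwards [ih, hadamard hp (hT M), iterate_TT_diag hp M hf, sum_pT_EE_pY hp (hT M) 0]
      with q h1 h2 h3 h4 κ hκ
    rw [Finset.sum_range_succ, Finset.sum_range_succ, h1 κ hκ, h2, h3,
      Function.iterate_succ_apply' TT, TT, ← h4]
    have h5 : ∀ i, pT i (fun q => -EE 0 (pY i (TT^[M] f)) q) q =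
        - pT i (EE 0 (pY i (TT^[M] f))) q := by
      intro i
      rw [pT, fderiv_fun_neg]
      rfl
    simp only [h5, Finset.sum_add_distrib, Finset.sum_neg_distrib, ← Finset.mul_sum]
    have h6 : ∑ i, (q.1 i - q.2.1 i) * -EE 0 (pY i (TT^[M] f)) q =
        ∑ i, (q.2.1 i - q.1 i) * EE 0 (pY i (TT^[M] f)) q :=
      Finset.sum_congr rfl fun i _ => by ring
    rw [h6, pow_succ]
    field_simp
    ring

end AmplitudeDivision

/-! ### The Piola identity and integration by parts in `ȳ`. -/

section IntegrationByParts

variable {n : ℕ}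

/-! ### Jacobi's formula and the Piola identity -/

/-- Jacobi's formula for the derivative of a determinant. -/
lemma hasFDerivAt_det {E : Type*} [NormedAddCommGroup E] [NormedSpace ℂ E]
    {M : E → Matrix (Fin n) (Fin n) ℂ} {M' : Fin n → Fin n → E →L[ℂ] ℂ} {q : E}
    (h : ∀ i j, HasFDerivAt (fun q => M q i j) (M' i j) q) :
    HasFDerivAt (fun q => (M q).det) (∑ i, ∑ j, (M q).adjugate i j • M' j i) q := by
  have h1 : HasFDerivAt (fun q => (M q).det)
      (∑ σ : Equiv.Perm (Fin n), (Equiv.Perm.sign σ : ℂ) •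
        ∑ i, (∏ k ∈ Finset.univ.erase i, M q (σ k) k) • M' (σ i) i) q := by
    simp only [Matrix.det_apply']
    refine HasFDerivAt.fun_sum fun σ _ => ?_
    exact (HasFDerivAt.finsetProd fun i _ => h (σ i) i).const_mul _
  convert h1 using 1
  ext d
  simp only [sum_apply, smul_apply, smul_eq_mul]
  -- By Cramer's rule the sum over `j` is the determinant with column `i` replaced by its
  -- derivative; the permutation expansions then match term by term.
  have h2 : ∀ i, ∑ j, (M q).adjugate i j * M' j i d =
      ((M q).updateCol i fun j => M' j i d).det := by
    intro i
    rw [← Matrix.cramer_apply, Matrix.cramer_eq_adjugate_mulVec]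
    rfl
  simp only [h2, Matrix.det_apply', Finset.mul_sum]
  rw [Finset.sum_comm]
  refine Finset.sum_congr rfl fun σ _ => Finset.sum_congr rfl fun i _ => ?_
  congr 1
  rw [← Finset.prod_erase_mul _ _ (Finset.mem_univ i)]
  congr 1
  · refine Finset.prod_congr rfl fun k hk => ?_
    rw [Matrix.updateCol_ne (Finset.ne_of_mem_erase hk)]
  · simp

/-- The Jacobian matrix of `Θ(y, z)` in the variable `z`. -/
def jac (Θ : Cn n × Cn n → Cn n) (q : Cn n × Cn n) : Matrix (Fin n) (Fin n) ℂ :=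
  Matrix.of fun j i => fderiv ℂ Θ q (0, e i) j

lemma analyticAt_jac {Θ : Cn n × Cn n → Cn n} {q : Cn n × Cn n} (h : AnalyticAt ℂ Θ q)
    (j i : Fin n) : AnalyticAt ℂ (fun q => jac Θ q j i) q :=
  (((EuclideanSpace.proj j : Cn n →L[ℂ] ℂ).comp
    (ContinuousLinearMap.apply ℂ (Cn n) ((0, e i) : Cn n × Cn n))).analyticAt _).comp h.fderiv

lemma analyticAt_det {E : Type*} [NormedAddCommGroup E] [NormedSpace ℂ E]
    {M : E → Matrix (Fin n) (Fin n) ℂ} {q : E} (h : ∀ i j, AnalyticAt ℂ (fun q => M q i j) q) :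
    AnalyticAt ℂ (fun q => (M q).det) q := by
  simp only [Matrix.det_apply']
  exact Finset.analyticAt_fun_sum _ fun σ _ => analyticAt_const.mul
    (Finset.analyticAt_fun_prod _ fun i _ => h _ _)

lemma analyticAt_adjugate {E : Type*} [NormedAddCommGroup E] [NormedSpace ℂ E]
    {M : E → Matrix (Fin n) (Fin n) ℂ} {q : E} (h : ∀ i j, AnalyticAt ℂ (fun q => M q i j) q)
    (i j : Fin n) : AnalyticAt ℂ (fun q => (M q).adjugate i j) q := by
  simp only [Matrix.adjugate_apply]
  refine analyticAt_det fun k l => ?_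
  by_cases hk : k = j
  · subst hk
    simpa using analyticAt_const
  · simpa [Matrix.updateRow_ne hk] using h k l

lemma fderiv_jac_symm {Θ : Cn n × Cn n → Cn n} {q : Cn n × Cn n} (h : AnalyticAt ℂ Θ q)
    (j i m : Fin n) : fderiv ℂ (fun q => jac Θ q j i) q (0, e m) =
      fderiv ℂ (fun q => jac Θ q j m) q (0, e i) := by
  have h1 : ∀ (d d' : Cn n × Cn n), fderiv ℂ (fun q => fderiv ℂ Θ q d j) q d' =
      fderiv ℂ (fderiv ℂ Θ) q d' d j := by
    intro d d'
    have h3 : HasFDerivAt (fun q => fderiv ℂ Θ q d j)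
        (((EuclideanSpace.proj j : Cn n →L[ℂ] ℂ).comp (ContinuousLinearMap.apply ℂ (Cn n) d)).comp
          (fderiv ℂ (fderiv ℂ Θ) q)) q :=
      ((EuclideanSpace.proj j : Cn n →L[ℂ] ℂ).comp
      (ContinuousLinearMap.apply ℂ (Cn n) d)).hasFDerivAt.comp q
      h.fderiv.differentiableAt.hasFDerivAt
    rw [h3.fderiv]
    rfl
  have h2 : IsSymmSndFDerivAt ℂ Θ q :=
    (h.contDiffAt (n := 2)).isSymmSndFDerivAt (by simp)
  simp only [jac, Matrix.of_apply, h1]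
  rw [h2]

/-- The Piola identity: the adjugate of a Jacobian matrix is divergence free. -/
lemma piola {Θ : Cn n × Cn n → Cn n} {q : Cn n × Cn n} (h : AnalyticAt ℂ Θ q)
    (hdet : (jac Θ q).det ≠ 0) (j : Fin n) :
    ∑ i, fderiv ℂ (fun q => (jac Θ q).adjugate i j) q (0, e i) = 0 := by
  have hJ : ∀ i j, HasFDerivAt (fun q => jac Θ q i j) (fderiv ℂ (fun q => jac Θ q i j) q) q :=
    fun i j => (analyticAt_jac h i j).differentiableAt.hasFDerivAt
  have hA : ∀ i j, HasFDerivAt (fun q => (jac Θ q).adjugate i j)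
      (fderiv ℂ (fun q => (jac Θ q).adjugate i j) q) q :=
    fun i j => (analyticAt_adjugate (analyticAt_jac h) i j).differentiableAt.hasFDerivAt
  have hD := hasFDerivAt_det hJ
  set c : Fin n → ℂ := fun j => ∑ i, fderiv ℂ (fun q => (jac Θ q).adjugate i j) q (0, e i) with hc
  -- The row `c` of divergences is killed by the invertible matrix `J`: differentiate `adj(J) J =
  -- det(J) 1` and sum over `i`. Jacobi's formula gives `∂_m det J` on the right, which cancels the
  -- terms `adj(J) ∂J` on the left by symmetry of second derivatives.
  suffices Matrix.vecMul c (jac Θ q) = 0 from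
    congrFun (Matrix.eq_zero_of_vecMul_eq_zero hdet this) j
  ext m
  have key : ∀ i, ∑ j, (fderiv ℂ (fun q => (jac Θ q).adjugate i j) q (0, e i) * jac Θ q j m +
      (jac Θ q).adjugate i j * fderiv ℂ (fun q => jac Θ q j m) q (0, e i)) =
      if i = m then ∑ i, ∑ j, (jac Θ q).adjugate i j *
        fderiv ℂ (fun q => jac Θ q j i) q (0, e m) else 0 := by
    intro i
    have h1 : HasFDerivAt (fun q => ∑ j, (jac Θ q).adjugate i j * jac Θ q j m)
      (∑ j, ((jac Θ q).adjugate i j • fderiv ℂ (fun q => jac Θ q j m) q +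
        jac Θ q j m • fderiv ℂ (fun q => (jac Θ q).adjugate i j) q)) q :=
      HasFDerivAt.fun_sum fun j _ => (hA i j).mul (hJ j m)
    have h2 : (fun q => ∑ j, (jac Θ q).adjugate i j * jac Θ q j m) =
        fun q => if i = m then (jac Θ q).det else 0 := by
      ext q
      have := congrFun (congrFun (Matrix.adjugate_mul (jac Θ q)) i) m
      rw [Matrix.mul_apply] at this
      rw [this]
      simp [Matrix.one_apply]
    rw [h2] at h1
    have h3 := congrArg (fun L => L (0, e i)) h1.fderiv
    have h4 : fderiv ℂ (fun q => if i = m then (jac Θ q).det else 0) q (0, e i) =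
      if i = m then ∑ i, ∑ j, (jac Θ q).adjugate i j *
        fderiv ℂ (fun q => jac Θ q j i) q (0, e m) else 0 := by
      split_ifs with him
      · subst him
        rw [hD.fderiv]
        simp
      · simp
    rw [← h4, h3]
    simp only [sum_apply, add_apply, smul_apply, smul_eq_mul]
    exact Finset.sum_congr rfl fun j _ => by ring
  have key2 := Finset.sum_congr (rfl : (Finset.univ : Finset (Fin n)) = _) fun i _ => key i
  simp only [Finset.sum_add_distrib, Finset.sum_ite_eq', Finset.mem_univ, if_true] at key2
  have h5 : ∑ i, ∑ j, (jac Θ q).adjugate i j * fderiv ℂ (fun q => jac Θ q j m) q (0, e i) =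
      ∑ i, ∑ j, (jac Θ q).adjugate i j * fderiv ℂ (fun q => jac Θ q j i) q (0, e m) :=
    Finset.sum_congr rfl fun i _ => Finset.sum_congr rfl fun j _ => by
      rw [fderiv_jac_symm h j m i]
  rw [h5, add_eq_right, Finset.sum_comm] at key2
  simp only [Matrix.vecMul, dotProduct, hc, Finset.sum_mul, Pi.zero_apply]
  exact key2

/-! ### Integration by parts in `z = ȳ` -/

/-- Cauchy's estimate on the complex line through `y` in direction `d`; the radius `δ/(‖d‖ + 1)`
keeps the disc inside the closed `δ`-thickening of `K`. With measurability of the derivative, this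
is enough for the integrability needed below. -/
lemma exists_bound_fderiv {v : Cn n → ℂ} {s : ℝ} (hv : DifferentiableOn ℂ v (ball 0 s))
    {K : Set (Cn n)} (hK : IsCompact K) (hKs : K ⊆ ball 0 s) (d : Cn n) :
    ∃ C, ∀ y ∈ K, ‖fderiv ℂ v y d‖ ≤ C := by
  obtain ⟨δ, hδ, hδs⟩ := hK.exists_cthickening_subset_open isOpen_ball hKs
  obtain ⟨M, hM⟩ := (hK.cthickening (r := δ)).exists_bound_of_continuousOn
    (hv.continuousOn.mono hδs)
  set R : ℝ := δ / (‖d‖ + 1) with hR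
  have hd1 : 0 < ‖d‖ + 1 := by positivity
  have hR0 : 0 < R := by positivity
  refine ⟨M / R, fun y hy => ?_⟩
  have hmem : ∀ τ : ℂ, ‖τ‖ ≤ R → y + τ • d ∈ cthickening δ K := by
    intro τ hτ
    refine mem_cthickening_of_dist_le _ y _ _ hy ?_
    rw [dist_eq_norm, add_sub_cancel_left, norm_smul]
    calc ‖τ‖ * ‖d‖ ≤ R * (‖d‖ + 1) := by gcongr; linarith
      _ = δ := by rw [hR]; field_simp
  have hdiff : ∀ τ : ℂ, ‖τ‖ ≤ R → HasDerivAt (fun τ : ℂ => v (y + τ • d))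
      (fderiv ℂ v (y + τ • d) d) τ := by
    intro τ hτ
    have h1 := (hv.differentiableAt (isOpen_ball.mem_nhds (hδs (hmem τ hτ)))).hasFDerivAt
    refine h1.comp_hasDerivAt τ ?_
    simpa using ((hasDerivAt_id τ).smul_const d).const_add y
  have h2 := Complex.norm_deriv_le_of_forall_mem_sphere_norm_le (f := fun τ : ℂ => v (y + τ • d))
    (c := 0) (C := M) hR0 ?_ ?_
  · rw [(hdiff 0 (by simpa using hR0.le)).deriv] at h2
    simpa using h2
  · refine DifferentiableOn.diffContOnCl fun τ hτ => ?_
    rw [closure_ball _ hR0.ne', mem_closedBall_zero_iff] at hτ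
    exact (hdiff τ hτ).differentiableAt.differentiableWithinAt
  · intro τ hτ
    rw [mem_sphere_zero_iff_norm] at hτ
    exact hM _ (hmem τ hτ.le)

lemma integrable_of_bounded_tsupport {χ w : Cn n → ℂ} (hχ : Continuous χ)
    (hcpt : HasCompactSupport χ) (hw : AEStronglyMeasurable w (volume.restrict (tsupport χ)))
    {C : ℝ} (hC : ∀ y ∈ tsupport χ, ‖w y‖ ≤ C) : Integrable (fun y => w y * χ y) := by
  have h1 : IntegrableOn (fun y => w y * χ y) (tsupport χ) := by
    have h2 : IntegrableOn w (tsupport χ) := by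
      refine ⟨hw, .restrict_of_bounded C hcpt.isCompact.measure_lt_top ?_⟩
      exact (ae_restrict_iff' (isClosed_tsupport χ).measurableSet).2 (Eventually.of_forall hC)
    exact h2.mul_continuousOn hχ.continuousOn hcpt.isCompact
  refine (integrableOn_iff_integrable_of_support_subset ?_).1 h1
  intro y hy
  refine subset_tsupport χ ?_
  rw [Function.mem_support] at hy ⊢
  exact right_ne_zero_of_mul hy

lemma integrable_mul_tsupport {χ w : Cn n → ℂ} (hχ : Continuous χ)
    (hcpt : HasCompactSupport χ) (hw : ContinuousOn w (tsupport χ)) :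
    Integrable (fun y => w y * χ y) := by
  obtain ⟨C, hC⟩ := hcpt.isCompact.exists_bound_of_continuousOn hw
  exact integrable_of_bounded_tsupport hχ hcpt
    (hw.aestronglyMeasurable (isClosed_tsupport χ).measurableSet) hC

lemma cbar_e (i : Fin n) : cbar (e i : Cn n) = e i := by
  ext j; simp only [cbar_apply, e_apply]; split_ifs <;> simp

lemma cbar_I_smul_e (i : Fin n) : cbar (I • e i : Cn n) = -(I • e i) := by
  ext j
  simp only [cbar_apply, PiLp.smul_apply, PiLp.neg_apply, e_apply, smul_eq_mul]
  split_ifs <;> simp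

/-- Restriction to `z = ȳ`. -/
def graphL (n : ℕ) : Cn n →L[ℝ] Cn n × Cn n :=
  (ContinuousLinearMap.id ℝ (Cn n)).prod (cbarL n).toContinuousLinearMap

@[simp] lemma graphL_apply (y : Cn n) : graphL n y = (y, cbar y) := rfl

lemma graph_mem {s : ℝ} {y : Cn n} (hy : y ∈ ball (0 : Cn n) s) :
    (y, cbar y) ∈ ball (0 : Cn n) s ×ˢ ball (0 : Cn n) s := ⟨hy, cbar_mem_ball.2 hy⟩

/-- Integration by parts in `ȳ` against a holomorphic function. -/
theorem integral_dbar_by_parts {s : ℝ} {χ : Cn n → ℝ} (hχ : ContDiff ℝ ∞ χ)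
    (hsupp : tsupport χ ⊆ ball 0 s) {v : Cn n → ℂ} (hv : DifferentiableOn ℂ v (ball 0 s))
    {H : Cn n × Cn n → ℂ} (hH : AnalyticOnNhd ℂ H (ball 0 s ×ˢ ball 0 s)) (i : Fin n) :
    Integrable (fun y => v y * fderiv ℂ H (y, cbar y) (0, e i) * (χ y : ℂ)) ∧
    Integrable (fun y => v y * H (y, cbar y) * wirtingerBar i (fun y => (χ y : ℂ)) y) ∧
    ∫ y, v y * fderiv ℂ H (y, cbar y) (0, e i) * (χ y : ℂ) =
      -∫ y, v y * H (y, cbar y) * wirtingerBar i (fun y => (χ y : ℂ)) y := by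
  set g : Cn n → ℂ := fun y => (χ y : ℂ) with hg
  have hgd : ContDiff ℝ ∞ g := Complex.ofRealCLM.contDiff.comp hχ
  have htg : tsupport g ⊆ tsupport χ := by
    refine closure_mono fun y hy => ?_
    rw [Function.mem_support] at hy ⊢
    simpa [hg] using hy
  have hcχ : IsCompact (tsupport χ) := by
    refine Metric.isCompact_of_isClosed_isBounded (isClosed_tsupport χ)
      (isBounded_ball.subset hsupp)
  have hcg : HasCompactSupport g := hcχ.of_isClosed_subset (isClosed_tsupport g) htg
  have hgs : tsupport g ⊆ ball 0 s := htg.trans hsupp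
  set f : Cn n → ℂ := fun y => v y * H (y, cbar y) with hf
  have hHy : ∀ y ∈ ball (0 : Cn n) s, HasFDerivAt (fun y => H (y, cbar y))
      (((fderiv ℂ H (y, cbar y)).restrictScalars ℝ).comp (graphL n)) y := by
    intro y hy
    have h1 := ((hH _ (graph_mem hy)).differentiableAt.hasFDerivAt).restrictScalars ℝ
    exact h1.comp y (graphL n).hasFDerivAt
  have hvy : ∀ y ∈ ball (0 : Cn n) s, HasFDerivAt v (fderiv ℂ v y) y := fun y hy =>
    (hv.differentiableAt (isOpen_ball.mem_nhds hy)).hasFDerivAt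
  have hfy : ∀ y ∈ ball (0 : Cn n) s, HasFDerivAt f
      (v y • ((fderiv ℂ H (y, cbar y)).restrictScalars ℝ).comp (graphL n) +
        H (y, cbar y) • (fderiv ℂ v y).restrictScalars ℝ) y := fun y hy =>
    ((hvy y hy).restrictScalars ℝ).mul (hHy y hy)
  have hfd : ∀ d, ∀ y ∈ ball (0 : Cn n) s, fderiv ℝ f y d =
      v y * fderiv ℂ H (y, cbar y) (d, cbar d) + H (y, cbar y) * fderiv ℂ v y d := by
    intro d y hy
    rw [(hfy y hy).fderiv]
    simp
  have hcH : ContinuousOn (fun y => H (y, cbar y)) (ball 0 s) := fun y hy =>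
    (hHy y hy).continuousAt.continuousWithinAt
  have hcdH : ∀ d, ContinuousOn (fun y => fderiv ℂ H (y, cbar y) d) (ball 0 s) := fun d y hy =>
    (((hH _ (graph_mem hy)).fderiv.continuousAt.comp (f := fun y => (y, cbar y))
      (graphL n).continuous.continuousAt).clm_apply continuousAt_const).continuousWithinAt
  have hcv := hv.continuousOn
  have hcf : ContinuousOn f (ball 0 s) := hcv.mul hcH
  have hint1 : ∀ d, Integrable (fun y => fderiv ℝ f y d * g y) := by
    intro d
    obtain ⟨C1, hC1⟩ := exists_bound_fderiv hv hcg.isCompact hgs d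
    obtain ⟨C2, hC2⟩ := hcg.isCompact.exists_bound_of_continuousOn (hcH.mono hgs)
    obtain ⟨C3, hC3⟩ := hcg.isCompact.exists_bound_of_continuousOn
      ((hcv.mul (hcdH (d, cbar d))).mono hgs)
    refine integrable_of_bounded_tsupport hgd.continuous hcg
      (measurable_fderiv_apply_const ℝ f d).aestronglyMeasurable (C := C3 + C2 * C1) ?_
    intro y hy
    rw [hfd d y (hgs hy)]
    refine (norm_add_le _ _).trans (add_le_add (hC3 y hy) ?_)
    rw [norm_mul]
    exact mul_le_mul (hC2 y hy) (hC1 y hy) (norm_nonneg _) ((norm_nonneg _).trans (hC2 y hy))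
  have htd : ∀ d : Cn n, tsupport (fun y => fderiv ℝ g y d) ⊆ tsupport g := fun d => by
    refine closure_minimal (fun y hy => ?_) (isClosed_tsupport g)
    by_contra hcon
    apply hy
    have : fderiv ℝ g y = 0 := by
      by_contra h0
      exact hcon (support_fderiv_subset ℝ h0)
    simp [this]
  have hcd : ∀ d : Cn n, Continuous (fun y => fderiv ℝ g y d) := fun d =>
    (hgd.continuous_fderiv (by simp)).clm_apply continuous_const
  have hcs : ∀ d : Cn n, HasCompactSupport (fun y => fderiv ℝ g y d) := fun d =>
    hcg.isCompact.of_isClosed_subset (isClosed_tsupport _) (htd d)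
  have hint2 : ∀ d, Integrable (fun y => f y * fderiv ℝ g y d) := fun d =>
    integrable_mul_tsupport (hcd d) (hcs d) (hcf.mono ((htd d).trans hgs))
  have hint3 : Integrable (fun y => f y * g y) :=
    integrable_mul_tsupport hgd.continuous hcg (hcf.mono hgs)
  have hibp : ∀ d, ∫ y, f y * fderiv ℝ g y d = -∫ y, fderiv ℝ f y d * g y := fun d =>
    integral_mul_fderiv_eq_neg_fderiv_mul_of_integrable (hint1 d) (hint2 d) hint3
      (fun y hy => (hfy y (hgs hy)).differentiableAt)
      (fun y _ => (hgd.differentiable (by simp)).differentiableAt)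
  have hW : ∀ y, v y * H (y, cbar y) * wirtingerBar i g y =
      (1 / 2 : ℂ) * (f y * fderiv ℝ g y (e i)) + (I / 2) * (f y * fderiv ℝ g y (I • e i)) := by
    intro y; simp only [wirtingerBar, hf]; ring
  -- The `∂̄_i`-derivative of `v(y) H(y, ȳ)` is `v ∂_{z_i} H`: holomorphy of `v` and of `H` in its
  -- first variable cancels all other terms. Off the support both sides vanish.
  have hD : ∀ y, v y * fderiv ℂ H (y, cbar y) (0, e i) * (χ y : ℂ) =
      (1 / 2 : ℂ) * (fderiv ℝ f y (e i) * g y) + (I / 2) * (fderiv ℝ f y (I • e i) * g y) := by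
    intro y
    change _ * g y = _
    by_cases hy : y ∈ tsupport g
    · have hyb := hgs hy
      rw [hfd _ y hyb, hfd _ y hyb, cbar_e, cbar_I_smul_e]
      have e1 : ((e i, e i) : Cn n × Cn n) = (e i, 0) + (0, e i) := by simp
      have e2 : ((I • e i, -(I • e i)) : Cn n × Cn n) = I • (e i, 0) - I • (0, e i) := by simp
      rw [e1, e2, map_add, map_sub, map_smul, map_smul, map_smul]
      simp only [smul_eq_mul]
      linear_combination ((1 / 2 : ℂ) * (-v y * (fderiv ℂ H (y, cbar y)) (e i, 0) +
        v y * (fderiv ℂ H (y, cbar y)) (0, e i) -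
        H (y, cbar y) * fderiv ℂ v y (e i)) * g y) * I_mul_I
    · have : g y = 0 := image_eq_zero_of_notMem_tsupport hy
      simp [this]
  simp only [hW, hD]
  refine ⟨((hint1 _).const_mul _).add ((hint1 _).const_mul _),
    ((hint2 _).const_mul _).add ((hint2 _).const_mul _), ?_⟩
  rw [integral_add ((hint1 _).const_mul _) ((hint1 _).const_mul _),
    integral_add ((hint2 _).const_mul _) ((hint2 _).const_mul _), integral_const_mul,
    integral_const_mul, integral_const_mul, integral_const_mul, hibp, hibp]
  ring

end IntegrationByParts

/-! ### Gaussian integrals of Hermitian forms. -/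

section GaussianIntegrals

variable {n : ℕ}

/-! ### The Gaussian integral of a positive definite Hermitian form -/

/-- By the spectral theorem `H = U D² U*` with `D` the root of the eigenvalue matrix; take `C = D
U*`. -/
lemma exists_conjTranspose_mul_self {H : Matrix (Fin n) (Fin n) ℂ} (hH : H.PosDef) :
    ∃ C : Matrix (Fin n) (Fin n) ℂ, H = C.conjTranspose * C := by
  set U : Matrix (Fin n) (Fin n) ℂ :=
    (hH.isHermitian.eigenvectorUnitary : Matrix (Fin n) (Fin n) ℂ) with hU
  set D : Matrix (Fin n) (Fin n) ℂ :=
    Matrix.diagonal fun i => ((Real.sqrt (hH.isHermitian.eigenvalues i) : ℝ) : ℂ) with hD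
  refine ⟨D * U.conjTranspose, ?_⟩
  have h1 := hH.isHermitian.spectral_theorem
  rw [Unitary.conjStarAlgAut_apply] at h1
  have hDD : D.conjTranspose * D =
      Matrix.diagonal (RCLike.ofReal ∘ hH.isHermitian.eigenvalues) := by
    rw [hD, Matrix.diagonal_conjTranspose, Matrix.diagonal_mul_diagonal]
    congr 1
    ext i
    have := hH.eigenvalues_pos i
    simp only [Pi.star_apply, RCLike.star_def, Complex.conj_ofReal, Function.comp]
    rw [← Complex.ofReal_mul, Real.mul_self_sqrt this.le]
    rfl
  rw [Matrix.conjTranspose_mul, Matrix.conjTranspose_conjTranspose, Matrix.mul_assoc,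
    ← Matrix.mul_assoc D.conjTranspose, hDD, ← Matrix.mul_assoc]
  exact h1

lemma sum_form_eq {C : Matrix (Fin n) (Fin n) ℂ} (w : Cn n) :
    ∑ j, w j * ∑ i, (C.conjTranspose * C) j i * conj (w i) =
      ((‖Matrix.toEuclideanLin C (cbar w)‖ ^ 2 : ℝ) : ℂ) := by
  have h1 : ((‖Matrix.toEuclideanLin C (cbar w)‖ ^ 2 : ℝ) : ℂ) =
      ∑ k, conj (Matrix.toEuclideanLin C (cbar w) k) * Matrix.toEuclideanLin C (cbar w) k := by
    rw [EuclideanSpace.norm_sq_eq]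
    push_cast
    exact Finset.sum_congr rfl fun k _ => (Complex.conj_mul' _).symm
  rw [h1]
  set u : Fin n → ℂ := fun i => conj (w i) with hu
  have h2 : ∑ j, w j * ∑ i, (C.conjTranspose * C) j i * conj (w i) =
      dotProduct (star u) ((C.conjTranspose * C).mulVec u) := by
    simp [dotProduct, Matrix.mulVec, hu]
  rw [h2, ← Matrix.mulVec_mulVec, Matrix.dotProduct_mulVec, ← Matrix.star_mulVec]
  rfl

lemma integral_comp_cbar (f : Cn n → ℂ) : ∫ w, f (cbar w) = ∫ w, f w := by
  let L : Cn n ≃ₗᵢ[ℝ] Cn n :=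
    { toLinearEquiv := LinearEquiv.ofInvolutive (cbarL n).toLinearMap cbar_cbar
      norm_map' := norm_cbar }
  exact L.measurePreserving.integral_comp L.toHomeomorph.measurableEmbedding f

/-- With `H = C* C` the form is `‖C w̄‖²`. Conjugation preserves Lebesgue measure, and the
complex-linear map `C` has real Jacobian `|det C|² = det H`, so the standard Gaussian on `ℝ^{2n}`
remains. -/
theorem integral_gaussian_form {H : Matrix (Fin n) (Fin n) ℂ} (hH : H.PosDef) :
    ∫ w : Cn n, Complex.exp (-∑ j, w j * ∑ i, H j i * conj (w i)) = (Real.pi : ℂ) ^ n / H.det := by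
  obtain ⟨C, hC⟩ := exists_conjTranspose_mul_self hH
  have hdet : H.det = ((Complex.normSq C.det : ℝ) : ℂ) := by
    rw [hC, Matrix.det_mul, Matrix.det_conjTranspose, RCLike.star_def,
      Complex.normSq_eq_conj_mul_self]
  have hC0 : Complex.normSq C.det ≠ 0 := by
    intro h
    have := hH.det_pos
    rw [hdet, h] at this
    simp at this
  set T : Cn n →ₗ[ℝ] Cn n := (Matrix.toEuclideanLin C).restrictScalars ℝ with hT
  have hTdet : LinearMap.det T = Complex.normSq C.det := by
    rw [hT, LinearMap.det_restrictScalars, Algebra.norm_complex_apply]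
    change Complex.normSq (LinearMap.det (Matrix.toLpLin 2 2 C)) = _
    rw [Matrix.toLpLin_eq_toLin, LinearMap.det_toLin]
  have h1 : ∀ w : Cn n, Complex.exp (-∑ j, w j * ∑ i, H j i * conj (w i)) =
      Complex.exp (-((‖T (cbar w)‖ ^ 2 : ℝ) : ℂ)) := by
    intro w
    rw [hC, sum_form_eq]
    rfl
  simp only [h1]
  rw [integral_comp_cbar (fun w => Complex.exp (-((‖T w‖ ^ 2 : ℝ) : ℂ)))]
  have h2 := Measure.map_linearMap_addHaar_eq_smul_addHaar (volume : Measure (Cn n)) (f := T)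
    (by rw [hTdet]; exact hC0)
  have hTc : Continuous T := T.continuous_of_finiteDimensional
  have h3 : ∫ w, Complex.exp (-((‖w‖ ^ 2 : ℝ) : ℂ)) ∂(Measure.map T volume) =
      ∫ w, Complex.exp (-((‖T w‖ ^ 2 : ℝ) : ℂ)) :=
    integral_map hTc.measurable.aemeasurable
      (Continuous.aestronglyMeasurable (by fun_prop))
  rw [← h3, h2, integral_smul_measure, hTdet, hdet]
  have h4 : ∫ w : Cn n, Complex.exp (-((‖w‖ ^ 2 : ℝ) : ℂ)) = (Real.pi : ℂ) ^ n := by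
    have h5 := GaussianFourier.integral_rexp_neg_mul_sq_norm (V := Cn n) one_pos
    have h6 : ∀ w : Cn n, Complex.exp (-((‖w‖ ^ 2 : ℝ) : ℂ)) =
        ((Real.exp (-1 * ‖w‖ ^ 2) : ℝ) : ℂ) := by
      intro w; push_cast; simp
    simp only [h6]
    rw [integral_complex_ofReal, h5]
    have h7 : Module.finrank ℝ (Cn n) = 2 * n := by
      rw [← Module.finrank_mul_finrank ℝ ℂ (Cn n)]; simp
    rw [h7, div_one]
    have : ((2 * n : ℕ) : ℝ) / 2 = n := by push_cast; ring
    rw [this, Real.rpow_natCast]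
    push_cast; rfl
  rw [h4]
  have hpos : 0 < Complex.normSq C.det := lt_of_le_of_ne (Complex.normSq_nonneg _) hC0.symm
  rw [abs_of_pos (inv_pos.2 hpos), ENNReal.toReal_ofReal (inv_pos.2 hpos).le, Complex.real_smul]
  push_cast
  rw [div_eq_inv_mul]

end GaussianIntegrals

/-! ### Laplace's method and the vector-field relation. -/

section Laplace

variable {n : ℕ}

lemma continuous_mul_of_tsupport {E : Type*} [TopologicalSpace E] {U : Set E} (hU : IsOpen U)
    {G f : E → ℂ} (hG : Continuous G) (hGs : tsupport G ⊆ U) (hf : ContinuousOn f U) :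
    Continuous fun y => f y * G y := by
  refine continuous_iff_continuousAt.2 fun y => ?_
  by_cases hy : y ∈ tsupport G
  · exact (hf.continuousAt (hU.mem_nhds (hGs hy))).mul hG.continuousAt
  · have h1 : (fun y => f y * G y) =ᶠ[𝓝 y] fun _ => 0 := by
      filter_upwards [notMem_tsupport_iff_eventuallyEq.1 hy] with z hz
      simp [hz]
    exact (continuousAt_const (y := (0 : ℂ))).congr h1.symm

/-- Laplace's method for a phase vanishing to second order. -/
theorem tendsto_laplace {U : Set (Cn n)} (hU : IsOpen U) {x : Cn n} {G P : Cn n → ℂ}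
    (hG : Continuous G) (hGc : HasCompactSupport G) (hGs : tsupport G ⊆ U)
    (hPc : ContinuousOn P U) {δ : ℝ} (hδ : 0 < δ)
    (hlow : ∀ y ∈ U, δ * ‖y - x‖ ^ 2 ≤ (P y).re) {η : Cn n → Cn n} {η' : Cn n →L[ℝ] Cn n}
    (hη : HasFDerivAt η η' x) (hηx : η x = 0) (hx : x ∈ U)
    (hP : ∀ y ∈ U, P y = ∑ j, (y j - x j) * η y j) :
    Tendsto (fun c : ℝ => (c : ℂ) ^ (2 * n) * ∫ y, Complex.exp (-((c : ℂ) ^ 2 * P y)) * G y) atTop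
      (𝓝 ((∫ w, Complex.exp (-∑ j, w j * η' w j)) * G x)) := by
  have hfin : Module.finrank ℝ (Cn n) = 2 * n := by
    rw [← Module.finrank_mul_finrank ℝ ℂ (Cn n)]; simp
  have hexpc : ∀ c : ℝ, ContinuousOn (fun y => Complex.exp (-((c : ℂ) ^ 2 * P y))) U := fun c =>
    (continuousOn_const.mul hPc).neg.cexp
  have hcont : ∀ c : ℝ, Continuous fun y => Complex.exp (-((c : ℂ) ^ 2 * P y)) * G y := fun c =>
    continuous_mul_of_tsupport hU hG hGs (hexpc c)
  obtain ⟨M, hM⟩ := hGc.exists_bound_of_continuous hG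
  -- Substitution `y = x + w/c` in real dimension `2n`. The parameter `c` is the square root of the
  -- large parameter, which avoids fractional powers.
  have hscale : ∀ c : ℝ, 0 < c →
      (c : ℂ) ^ (2 * n) * ∫ y, Complex.exp (-((c : ℂ) ^ 2 * P y)) * G y =
      ∫ w, Complex.exp (-((c : ℂ) ^ 2 * P (x + c⁻¹ • w))) * G (x + c⁻¹ • w) := by
    intro c hc
    have h1 := Measure.integral_comp_smul (volume : Measure (Cn n))
      (fun y => Complex.exp (-((c : ℂ) ^ 2 * P (x + y))) * G (x + y)) c⁻¹
    rw [h1, integral_add_left_eq_self (fun y => Complex.exp (-((c : ℂ) ^ 2 * P y)) * G y) x, hfin,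
      abs_of_pos (by positivity), Complex.real_smul]
    push_cast
    simp
  rw [← integral_mul_const]
  refine Tendsto.congr' ((eventually_gt_atTop 0).mono fun c hc => (hscale c hc).symm) ?_
  refine tendsto_integral_filter_of_dominated_convergence
    (fun w => Real.exp (-δ * ‖w‖ ^ 2) * M) ?_ ?_ ?_ ?_
  · exact Eventually.of_forall fun c =>
      ((hcont c).comp (f := fun w => x + c⁻¹ • w) (by fun_prop)).aestronglyMeasurable
  · filter_upwards [eventually_gt_atTop 0] with c hc
    refine Eventually.of_forall fun w => ?_
    by_cases hw : x + c⁻¹ • w ∈ U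
    · rw [norm_mul, Complex.norm_exp]
      refine mul_le_mul (Real.exp_le_exp.2 ?_) (hM _) (norm_nonneg _) (Real.exp_pos _).le
      have h2 := hlow _ hw
      rw [add_sub_cancel_left, norm_smul, Real.norm_of_nonneg (inv_pos.2 hc).le] at h2
      have h3 : (-((c : ℂ) ^ 2 * P (x + c⁻¹ • w))).re = -(c ^ 2 * (P (x + c⁻¹ • w)).re) := by
        rw [← Complex.ofReal_pow, Complex.neg_re, Complex.re_ofReal_mul]
      rw [h3]
      have h4 : c ^ 2 * (δ * (c⁻¹ * ‖w‖) ^ 2) = δ * ‖w‖ ^ 2 := by field_simp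
      have h5 := mul_le_mul_of_nonneg_left h2 (sq_nonneg c)
      linarith
    · have : G (x + c⁻¹ • w) = 0 := by
        by_contra h0
        exact hw (hGs (subset_tsupport _ h0))
      rw [this, mul_zero, norm_zero]
      exact mul_nonneg (Real.exp_pos _).le ((norm_nonneg _).trans (hM 0))
  · refine Integrable.mul_const ?_ M
    have h6 := GaussianFourier.integral_rexp_neg_mul_sq_norm (V := Cn n) hδ
    -- A non-integrable function has integral `0` by convention, whereas the Gaussian integral is
    -- positive.
    by_contra hni
    rw [integral_undef hni] at h6
    have : 0 < (Real.pi / δ) ^ ((Module.finrank ℝ (Cn n) : ℝ) / 2) := by positivity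
    exact this.ne h6
  · refine Eventually.of_forall fun w => ?_
    have hlin : Tendsto (fun c : ℝ => x + c⁻¹ • w) atTop (𝓝 x) := by
      have : Tendsto (fun c : ℝ => x + c⁻¹ • w) atTop (𝓝 (x + (0 : ℝ) • w)) :=
        tendsto_const_nhds.add (tendsto_inv_atTop_zero.smul_const w)
      simpa using this
    have hevU : ∀ᶠ c : ℝ in atTop, x + c⁻¹ • w ∈ U := hlin.eventually (hU.mem_nhds hx)
    refine Tendsto.mul ?_ ((hG.tendsto x).comp hlin)
    refine (Complex.continuous_exp.tendsto _).comp (Tendsto.neg ?_)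
    have hlim := hη.lim_real w
    simp only [hηx, sub_zero] at hlim
    -- One power of `c` in `c² P` cancels against `y - x = w/c`; the other forms the difference
    -- quotient of `η` at its zero `x`.
    have h7 : Tendsto (fun c : ℝ => ∑ j, w j * (c • η (x + c⁻¹ • w)) j) atTop
        (𝓝 (∑ j, w j * η' w j)) := by
      refine tendsto_finsetSum _ fun j _ => tendsto_const_nhds.mul ?_
      exact ((EuclideanSpace.proj j : Cn n →L[ℂ] ℂ).continuous.tendsto _).comp hlim
    refine h7.congr' ?_
    filter_upwards [hevU, eventually_gt_atTop 0] with c hcU hc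
    rw [hP _ hcU, Finset.mul_sum]
    refine Finset.sum_congr rfl fun j _ => ?_
    simp only [PiLp.add_apply, PiLp.smul_apply, Complex.real_smul, add_sub_cancel_left]
    have : (c : ℂ) ≠ 0 := by exact_mod_cast hc.ne'
    push_cast
    field_simp

/-- The vector-field relation: `div_θ g + t (x - y)·g` is a total `∂̄`-derivative against
`e^{-tP} det θ_z`. -/
theorem integral_relation {s : ℝ} {χ : Cn n → ℝ} (hχ : ContDiff ℝ ∞ χ)
    (hsupp : tsupport χ ⊆ ball 0 s) {v : Cn n → ℂ} (hv : DifferentiableOn ℂ v (ball 0 s))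
    {Θ : Cn n × Cn n → Cn n} (hΘ : AnalyticOnNhd ℂ Θ (ball 0 s ×ˢ ball 0 s))
    (hdet : ∀ q ∈ ball (0 : Cn n) s ×ˢ ball (0 : Cn n) s, (jac Θ q).det ≠ 0)
    {P : Cn n × Cn n → ℂ} (hP : AnalyticOnNhd ℂ P (ball 0 s ×ˢ ball 0 s)) {x : Cn n}
    (hPz : ∀ q ∈ ball (0 : Cn n) s ×ˢ ball (0 : Cn n) s, ∀ i,
      fderiv ℂ P q (0, e i) = ∑ j, (q.1 j - x j) * jac Θ q j i)
    {g : Fin n → Cn n × Cn n → ℂ} (hg : ∀ j, AnalyticOnNhd ℂ (g j) (ball 0 s ×ˢ ball 0 s))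
    (t : ℂ) :
    ∫ y, v y * ((∑ i, ∑ j, (jac Θ (y, cbar y)).adjugate i j * fderiv ℂ (g j) (y, cbar y) (0, e i)
        - t * ((jac Θ (y, cbar y)).det * ∑ j, (y j - x j) * g j (y, cbar y)))
        * Complex.exp (-(t * P (y, cbar y)))) * (χ y : ℂ) =
      -∫ y, v y * (Complex.exp (-(t * P (y, cbar y))) *
        ∑ i, (∑ j, (jac Θ (y, cbar y)).adjugate i j * g j (y, cbar y)) *
          wirtingerBar i (fun y => (χ y : ℂ)) y) := by
  set W := ball (0 : Cn n) s ×ˢ ball (0 : Cn n) s with hW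
  set A : Fin n → Fin n → Cn n × Cn n → ℂ := fun i j q => (jac Θ q).adjugate i j with hA
  have hAan : ∀ i j, AnalyticOnNhd ℂ (A i j) W := fun i j q hq =>
    analyticAt_adjugate (analyticAt_jac (hΘ q hq)) i j
  -- The field `g` in `θ`-space, written in the `z`-coordinates as `det(J) J⁻¹ g` and weighted by
  -- the exponential.
  set H : Fin n → Cn n × Cn n → ℂ := fun i q =>
    (∑ j, A i j q * g j q) * Complex.exp (-(t * P q)) with hH
  have hsumAn : ∀ i, AnalyticOnNhd ℂ (fun q => ∑ j, A i j q * g j q) W := fun i q hq =>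
    Finset.analyticAt_fun_sum _ fun j _ => (hAan i j q hq).mul (hg j q hq)
  have hexpAn : AnalyticOnNhd ℂ (fun q => Complex.exp (-(t * P q))) W := fun q hq =>
    ((analyticAt_const.mul (hP q hq)).neg).cexp
  have hHan : ∀ i, AnalyticOnNhd ℂ (H i) W := fun i q hq => (hsumAn i q hq).mul (hexpAn q hq)
  have hdiv : ∀ q ∈ W, ∑ i, fderiv ℂ (H i) q (0, e i) =
      (∑ i, ∑ j, A i j q * fderiv ℂ (g j) q (0, e i)
        - t * ((jac Θ q).det * ∑ j, (q.1 j - x j) * g j q)) * Complex.exp (-(t * P q)) := by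
    intro q hq
    have h1 : ∀ i, HasFDerivAt (fun q => ∑ j, A i j q * g j q)
        (∑ j, (A i j q • fderiv ℂ (g j) q + g j q • fderiv ℂ (A i j) q)) q := fun i =>
      HasFDerivAt.fun_sum fun j _ => (hAan i j q hq).differentiableAt.hasFDerivAt.mul
        (hg j q hq).differentiableAt.hasFDerivAt
    have h2 : HasFDerivAt (fun q => Complex.exp (-(t * P q)))
        (Complex.exp (-(t * P q)) • -(t • fderiv ℂ P q)) q :=
      ((hP q hq).differentiableAt.hasFDerivAt.const_mul t).neg.cexp
    have h3 : ∀ i, fderiv ℂ (H i) q (0, e i) =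
        (∑ j, A i j q * g j q) * (Complex.exp (-(t * P q)) * -(t * fderiv ℂ P q (0, e i))) +
        Complex.exp (-(t * P q)) * ∑ j, (A i j q * fderiv ℂ (g j) q (0, e i) +
          g j q * fderiv ℂ (A i j) q (0, e i)) := by
      intro i
      have h := ((h1 i).mul h2).fderiv
      change fderiv ℂ (H i) q = _ at h
      rw [h]
      simp [sum_apply]
    simp only [h3]
    rw [Finset.sum_add_distrib, ← Finset.mul_sum]
    have h4 : ∑ i, ∑ j, (A i j q * fderiv ℂ (g j) q (0, e i) +
          g j q * fderiv ℂ (A i j) q (0, e i)) =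
        ∑ i, ∑ j, A i j q * fderiv ℂ (g j) q (0, e i) := by
      simp only [Finset.sum_add_distrib]
      rw [add_eq_left, Finset.sum_comm]
      refine Finset.sum_eq_zero fun j _ => ?_
      rw [← Finset.mul_sum, piola (hΘ q hq) (hdet q hq) j, mul_zero]
    have h5 : ∑ i, (∑ j, A i j q * g j q) *
        (Complex.exp (-(t * P q)) * -(t * fderiv ℂ P q (0, e i))) =
        -(t * ((jac Θ q).det * ∑ j, (q.1 j - x j) * g j q)) * Complex.exp (-(t * P q)) := by
      -- The gradient of the phase is `(y - x)ᵀ J`, so `J adj(J) = det(J) 1` removes the Jacobian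
      -- matrix.
      have h6 : ∑ i, (∑ j, A i j q * g j q) * fderiv ℂ P q (0, e i) =
          (jac Θ q).det * ∑ j, (q.1 j - x j) * g j q := by
        have h7 : ∀ m j, ∑ i, jac Θ q m i * A i j q = if m = j then (jac Θ q).det else 0 := by
          intro m j
          have := congrFun (congrFun (Matrix.mul_adjugate (jac Θ q)) m) j
          rw [Matrix.mul_apply] at this
          rw [this]
          simp [Matrix.one_apply]
        calc ∑ i, (∑ j, A i j q * g j q) * fderiv ℂ P q (0, e i)
            = ∑ i, ∑ j, ∑ m, (g j q * (q.1 m - x m)) * (jac Θ q m i * A i j q) := by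
              refine Finset.sum_congr rfl fun i _ => ?_
              rw [hPz q hq i, Finset.sum_mul]
              refine Finset.sum_congr rfl fun j _ => ?_
              rw [Finset.mul_sum]
              exact Finset.sum_congr rfl fun m _ => by ring
          _ = ∑ j, ∑ m, (g j q * (q.1 m - x m)) * ∑ i, jac Θ q m i * A i j q := by
              rw [Finset.sum_comm]
              refine Finset.sum_congr rfl fun j _ => ?_
              rw [Finset.sum_comm]
              refine Finset.sum_congr rfl fun m _ => ?_
              rw [Finset.mul_sum]
          _ = _ := by
              simp only [h7, mul_ite, mul_zero, Finset.sum_ite_eq', Finset.mem_univ, if_true,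
                Finset.mul_sum]
              exact Finset.sum_congr rfl fun j _ => by ring
      rw [← h6, Finset.mul_sum, ← Finset.sum_neg_distrib, Finset.sum_mul]
      exact Finset.sum_congr rfl fun i _ => by ring
    rw [h4, h5]
    ring
  have hI := fun i => integral_dbar_by_parts hχ hsupp hv (hHan i) i
  have hL : ∀ y, v y * ((∑ i, ∑ j, A i j (y, cbar y) * fderiv ℂ (g j) (y, cbar y) (0, e i)
        - t * ((jac Θ (y, cbar y)).det * ∑ j, (y j - x j) * g j (y, cbar y)))
        * Complex.exp (-(t * P (y, cbar y)))) * (χ y : ℂ) =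
      ∑ i, v y * fderiv ℂ (H i) (y, cbar y) (0, e i) * (χ y : ℂ) := by
    intro y
    by_cases hy : y ∈ tsupport χ
    · rw [← hdiv _ (graph_mem (hsupp hy)), Finset.mul_sum, Finset.sum_mul]
    · have : χ y = 0 := image_eq_zero_of_notMem_tsupport hy
      simp [this]
  have hR : ∀ y, v y * (Complex.exp (-(t * P (y, cbar y))) *
        ∑ i, (∑ j, A i j (y, cbar y) * g j (y, cbar y)) *
          wirtingerBar i (fun y => (χ y : ℂ)) y) =
      ∑ i, v y * H i (y, cbar y) * wirtingerBar i (fun y => (χ y : ℂ)) y := by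
    intro y
    rw [Finset.mul_sum, Finset.mul_sum]
    exact Finset.sum_congr rfl fun i _ => by simp only [hH]; ring
  simp only [hA] at hL hR
  simp only [hL, hR]
  rw [integral_finsetSum _ fun i _ => (hI i).1, integral_finsetSum _ fun i _ => (hI i).2.1,
    ← Finset.sum_neg_distrib]
  exact Finset.sum_congr rfl fun i _ => (hI i).2.2

end Laplace

/-! ### The amplitude one reproduces holomorphic functions. -/

section LeadingTerm

variable {n : ℕ}

lemma wirtingerBar_eq_zero {χ : Cn n → ℝ} {y : Cn n}
    (h : ∃ a : ℝ, χ =ᶠ[𝓝 y] fun _ => a) (i : Fin n) :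
    wirtingerBar i (fun y => (χ y : ℂ)) y = 0 := by
  obtain ⟨a, ha⟩ := h
  have h1 : (fun y => (χ y : ℂ)) =ᶠ[𝓝 y] fun _ => (a : ℂ) := by
    filter_upwards [ha] with z hz
    rw [hz]
  have h2 : fderiv ℝ (fun y => (χ y : ℂ)) y = 0 := by
    rw [h1.fderiv_eq]; simp
  simp [wirtingerBar, h2]

lemma norm_integral_boundary_le {v P b : Cn n → ℂ} {S : Set (Cn n)} (hS : MeasurableSet S)
    {t C : ℝ} (hb0 : ∀ y, y ∉ S → b y = 0) (hbC : ∀ y ∈ S, ‖b y‖ ≤ C)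
    (hint : IntegrableOn (fun y => ‖v y‖ * Real.exp (-(t * (P y).re))) S) :
    ‖∫ y, v y * (Complex.exp (-((t : ℂ) * P y)) * b y)‖ ≤
      C * ∫ y in S, ‖v y‖ * Real.exp (-(t * (P y).re)) := by
  rw [← integral_const_mul, ← integral_indicator hS]
  refine norm_integral_le_of_norm_le ((integrable_indicator_iff hS).2 (hint.const_mul C))
    (Eventually.of_forall fun y => ?_)
  by_cases hy : y ∈ S
  · rw [Set.indicator_of_mem hy, norm_mul, norm_mul, Complex.norm_exp]
    have h3 : (-((t : ℂ) * P y)).re = -(t * (P y).re) := by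
      rw [Complex.neg_re, Complex.re_ofReal_mul]
    rw [h3]
    have := mul_le_mul_of_nonneg_left (hbC y hy)
      (mul_nonneg (norm_nonneg (v y)) (Real.exp_pos (-(t * (P y).re))).le)
    linarith
  · simp [Set.indicator_of_notMem hy, hb0 y hy]

/-- Growth constant for `t ↦ tⁿ e^{-(t-k)c}`. -/
def growthConst (n : ℕ) (c : ℝ) : ℝ := n.factorial * (2 / c) ^ n * Real.exp (c / 2)

lemma growthConst_nonneg (n : ℕ) {c : ℝ} (hc : 0 < c) : 0 ≤ growthConst n c := by
  unfold growthConst; positivity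

/-- As `k ≥ 1`, `t ≤ k(1 + (t - k))`; the power of `1 + (t - k)` is absorbed by half of the
exponential. What remains is integrable in `t` over `[k, ∞)` at the cost of `kⁿ` only. -/
lemma pow_mul_exp_le (n : ℕ) {c k t : ℝ} (hc : 0 < c) (hk : 1 ≤ k) (ht : k ≤ t) :
    t ^ n * Real.exp (-((t - k) * c)) ≤
      growthConst n c * k ^ n * Real.exp (-((t - k) * (c / 2))) := by
  have hτ : 0 ≤ t - k := sub_nonneg.2 ht
  have ht0 : 0 ≤ t := by linarith
  have h1 : t ≤ k * (1 + (t - k)) := by nlinarith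
  have h2 := Real.pow_div_factorial_le_exp (x := (1 + (t - k)) * (c / 2)) (by positivity) n
  have hf : (0 : ℝ) < n.factorial := by exact_mod_cast n.factorial_pos
  have h3 : (1 + (t - k)) ^ n ≤ growthConst n c * Real.exp ((t - k) * (c / 2)) := by
    rw [div_le_iff₀ hf, mul_pow] at h2
    have h4 : (1 + (t - k)) ^ n = ((1 + (t - k)) ^ n * (c / 2) ^ n) * (2 / c) ^ n := by
      rw [mul_assoc, ← mul_pow]
      have : c / 2 * (2 / c) = 1 := by field_simp
      rw [this]; simp
    rw [h4]
    calc _ ≤ (Real.exp ((1 + (t - k)) * (c / 2)) * n.factorial) * (2 / c) ^ n := by gcongr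
      _ = _ := by
        rw [growthConst, add_mul, Real.exp_add, one_mul]; ring
  calc t ^ n * Real.exp (-((t - k) * c))
      ≤ (k * (1 + (t - k))) ^ n * Real.exp (-((t - k) * c)) := by gcongr
    _ = k ^ n * (1 + (t - k)) ^ n * Real.exp (-((t - k) * c)) := by rw [mul_pow]
    _ ≤ k ^ n * (growthConst n c * Real.exp ((t - k) * (c / 2))) * Real.exp (-((t - k) * c)) := by
        gcongr
    _ = growthConst n c * k ^ n * Real.exp (-((t - k) * (c / 2))) := by
        rw [show -((t - k) * (c / 2)) = (t - k) * (c / 2) + -((t - k) * c) by ring, Real.exp_add]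
        ring

/-- The derivatives of a phase `P(y, z) = (y - x)·(Θ(y, z) - Θ(y, x̄))` in the `z`-directions. -/
lemma phase_relations {s : ℝ} {Θ : Cn n × Cn n → Cn n}
    (hΘ : AnalyticOnNhd ℂ Θ (ball 0 s ×ˢ ball 0 s)) {P : Cn n × Cn n → ℂ} {x : Cn n}
    (hx : x ∈ ball (0 : Cn n) s)
    (hPΘ : ∀ q ∈ ball (0 : Cn n) s ×ˢ ball (0 : Cn n) s,
      P q = ∑ j, (q.1 j - x j) * (Θ q j - Θ (q.1, cbar x) j)) :
    (∀ j, AnalyticOnNhd ℂ (fun q => Θ q j - Θ (q.1, cbar x) j) (ball 0 s ×ˢ ball 0 s)) ∧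
    (∀ j i, ∀ q ∈ ball (0 : Cn n) s ×ˢ ball (0 : Cn n) s,
      fderiv ℂ (fun q => Θ q j - Θ (q.1, cbar x) j) q (0, e i) = jac Θ q j i) ∧
    ∀ q ∈ ball (0 : Cn n) s ×ˢ ball (0 : Cn n) s, ∀ i,
      fderiv ℂ P q (0, e i) = ∑ j, (q.1 j - x j) * jac Θ q j i := by
  set W := ball (0 : Cn n) s ×ˢ ball (0 : Cn n) s with hW
  set g : Fin n → Cn n × Cn n → ℂ := fun j q => Θ q j - Θ (q.1, cbar x) j with hg
  have hmemx : ∀ q ∈ W, (q.1, cbar x) ∈ W := fun q hq => ⟨hq.1, cbar_mem_ball.2 hx⟩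
  have hΘj : ∀ j, AnalyticOnNhd ℂ (fun q => Θ q j) W := fun j q hq =>
    ((EuclideanSpace.proj j : Cn n →L[ℂ] ℂ).analyticAt _).comp (hΘ q hq)
  have hΘx : ∀ j, AnalyticOnNhd ℂ (fun q => Θ (q.1, cbar x) j) W := fun j q hq =>
    (hΘj j _ (hmemx q hq)).fun_comp (f := fun q : Cn n × Cn n => (q.1, cbar x))
      (analyticAt_fst.prod analyticAt_const)
  have hgan : ∀ j, AnalyticOnNhd ℂ (g j) W := fun j q hq => (hΘj j q hq).sub (hΘx j q hq)
  have hWo : IsOpen W := isOpen_ball.prod isOpen_ball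
  have hΘjd : ∀ j i, ∀ q ∈ W, fderiv ℂ (fun q => Θ q j) q (0, e i) = jac Θ q j i := by
    intro j i q hq
    have h1 : HasFDerivAt (fun q => Θ q j) ((EuclideanSpace.proj j : Cn n →L[ℂ] ℂ).comp
        (fderiv ℂ Θ q)) q :=
      (EuclideanSpace.proj j : Cn n →L[ℂ] ℂ).hasFDerivAt.comp q
        (hΘ q hq).differentiableAt.hasFDerivAt
    rw [h1.fderiv]; rfl
  have hΘxd : ∀ j i, ∀ q ∈ W,
      fderiv ℂ (fun q : Cn n × Cn n => Θ (q.1, cbar x) j) q (0, e i) = 0 := by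
    intro j i q hq
    have h1 : HasFDerivAt (fun q : Cn n × Cn n => (q.1, cbar x))
        ((ContinuousLinearMap.fst ℂ (Cn n) (Cn n)).prod 0) q :=
      hasFDerivAt_fst.prodMk (hasFDerivAt_const _ _)
    have h2 := ((hΘj j _ (hmemx q hq)).differentiableAt.hasFDerivAt.comp q h1).fderiv
    have h3 : fderiv ℂ (fun q : Cn n × Cn n => Θ (q.1, cbar x) j) q = _ := h2
    rw [h3]
    exact map_zero (fderiv ℂ (fun q => Θ q j) (q.1, cbar x))
  have hgd : ∀ j i, ∀ q ∈ W, fderiv ℂ (g j) q (0, e i) = jac Θ q j i := by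
    intro j i q hq
    have := fderiv_fun_sub (hΘj j q hq).differentiableAt (hΘx j q hq).differentiableAt
    simp only [hg]
    rw [this, sub_apply, hΘjd j i q hq, hΘxd j i q hq, sub_zero]
  have hPz : ∀ q ∈ W, ∀ i, fderiv ℂ P q (0, e i) = ∑ j, (q.1 j - x j) * jac Θ q j i := by
    intro q hq i
    have h1 : P =ᶠ[𝓝 q] fun q => ∑ j, (q.1 j - x j) * g j q := by
      filter_upwards [hWo.mem_nhds hq] with q' hq' using hPΘ q' hq'
    rw [h1.fderiv_eq]
    have h2 : ∀ j, HasFDerivAt (fun q : Cn n × Cn n => q.1 j - x j)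
        ((EuclideanSpace.proj j : Cn n →L[ℂ] ℂ).comp (ContinuousLinearMap.fst ℂ _ _)) q :=
      fun j => ((EuclideanSpace.proj j : Cn n →L[ℂ] ℂ).comp
        (ContinuousLinearMap.fst ℂ (Cn n) (Cn n))).hasFDerivAt.sub_const (x j)
    have h3 : HasFDerivAt (fun q : Cn n × Cn n => ∑ j, (q.1 j - x j) * g j q)
        (∑ j, ((q.1 j - x j) • fderiv ℂ (g j) q + g j q •
          (EuclideanSpace.proj j : Cn n →L[ℂ] ℂ).comp (ContinuousLinearMap.fst ℂ _ _))) q :=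
      HasFDerivAt.fun_sum fun j _ => (h2 j).mul (hgan j q hq).differentiableAt.hasFDerivAt
    rw [h3.fderiv, sum_apply]
    refine Finset.sum_congr rfl fun j _ => ?_
    simp [hgd j i q hq]
  exact ⟨hgan, hgd, hPz⟩

/-- The leading term: the kernel with amplitude one reproduces holomorphic functions up to a
boundary term. -/
theorem norm_leading_term_sub_le {s : ℝ} {χ : Cn n → ℝ} (hχ : ContDiff ℝ ∞ χ)
    (hsupp : tsupport χ ⊆ ball 0 s) {v : Cn n → ℂ} (hv : DifferentiableOn ℂ v (ball 0 s))
    {Θ : Cn n × Cn n → Cn n} (hΘ : AnalyticOnNhd ℂ Θ (ball 0 s ×ˢ ball 0 s))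
    (hdet : ∀ q ∈ ball (0 : Cn n) s ×ˢ ball (0 : Cn n) s, (jac Θ q).det ≠ 0)
    {P : Cn n × Cn n → ℂ} (hP : AnalyticOnNhd ℂ P (ball 0 s ×ˢ ball 0 s)) {x : Cn n}
    (hx : x ∈ ball (0 : Cn n) s) (hχx : χ x = 1)
    (hPΘ : ∀ q ∈ ball (0 : Cn n) s ×ˢ ball (0 : Cn n) s,
      P q = ∑ j, (q.1 j - x j) * (Θ q j - Θ (q.1, cbar x) j))
    (hpos : (jac Θ (x, cbar x)).PosDef) {δ : ℝ} (hδ : 0 < δ)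
    (hlow : ∀ y ∈ ball (0 : Cn n) s, δ * ‖y - x‖ ^ 2 ≤ (P (y, cbar y)).re)
    {S : Set (Cn n)} (hS : IsCompact S) (hSs : S ⊆ ball 0 s)
    (hχS : ∀ y, y ∉ S → ∃ a : ℝ, χ =ᶠ[𝓝 y] fun _ => a) {c : ℝ} (hc : 0 < c)
    (hcS : ∀ y ∈ S, c ≤ (P (y, cbar y)).re) {C : ℝ} (hC0 : 0 ≤ C)
    (hC : ∀ y ∈ S, ‖∑ i, (∑ j, (jac Θ (y, cbar y)).adjugate i j *
      (Θ (y, cbar y) j - Θ (y, cbar x) j)) * wirtingerBar i (fun y => (χ y : ℂ)) y‖ ≤ C)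
    {k : ℝ} (hk : 1 ≤ k) :
    ‖(k : ℂ) ^ n * (∫ y, v y * ((jac Θ (y, cbar y)).det *
        Complex.exp (-((k : ℂ) * P (y, cbar y)))) * (χ y : ℂ)) - (Real.pi : ℂ) ^ n * v x‖ ≤
      C * growthConst n c * (2 / c) * k ^ n *
        ∫ y in S, ‖v y‖ * Real.exp (-(k * (P (y, cbar y)).re)) := by
  set W := ball (0 : Cn n) s ×ˢ ball (0 : Cn n) s with hW
  set Pr : Cn n → ℂ := fun y => P (y, cbar y) with hPr
  have hgraph : ∀ y, ContinuousAt (fun y : Cn n => (y, cbar y)) y := fun y =>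
    (graphL n).continuous.continuousAt
  have hPrc : ContinuousOn Pr (ball 0 s) := fun y hy =>
    ((hP _ (graph_mem hy)).continuousAt.comp (f := fun y => (y, cbar y))
      (hgraph y)).continuousWithinAt
  set dJ : Cn n → ℂ := fun y => (jac Θ (y, cbar y)).det with hdJ
  have hdJc : ContinuousOn dJ (ball 0 s) := fun y hy =>
    ((analyticAt_det (analyticAt_jac (hΘ _ (graph_mem hy)))).continuousAt.comp
      (f := fun y => (y, cbar y)) (hgraph y)).continuousWithinAt
  set χc : Cn n → ℂ := fun y => (χ y : ℂ) with hχc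
  have hχcc : Continuous χc := Complex.continuous_ofReal.comp hχ.continuous
  have hχcs : tsupport χc ⊆ ball 0 s := by
    refine subset_trans (closure_mono fun y hy => ?_) hsupp
    rw [Function.mem_support] at hy ⊢
    simpa [hχc] using hy
  have hχccpt : HasCompactSupport χc := Metric.isCompact_of_isClosed_isBounded
    (isClosed_tsupport _) (isBounded_ball.subset hχcs)
  have hPre : ∀ y ∈ ball (0 : Cn n) s, 0 ≤ (Pr y).re := fun y hy =>
    le_trans (by positivity) (hlow y hy)
  set J : ℝ → ℂ := fun t => ∫ y, v y * (dJ y * Complex.exp (-((t : ℂ) * Pr y))) * χc y with hJ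
  set JP : ℝ → ℂ := fun t =>
    ∫ y, v y * (dJ y * (-Pr y * Complex.exp (-((t : ℂ) * Pr y)))) * χc y with hJP
  have hexpc : ∀ t : ℝ, ContinuousOn (fun y => Complex.exp (-((t : ℂ) * Pr y))) (ball 0 s) :=
    fun t => (continuousOn_const.mul hPrc).neg.cexp
  have hi1 : ∀ t : ℝ, Integrable
      (fun y => v y * (dJ y * Complex.exp (-((t : ℂ) * Pr y))) * χc y) := fun t =>
    integrable_mul_tsupport hχcc hχccpt
      ((hv.continuousOn.mul (hdJc.mul (hexpc t))).mono hχcs)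
  have hi2 : ∀ t : ℝ, Integrable
      (fun y => v y * (dJ y * (-Pr y * Complex.exp (-((t : ℂ) * Pr y)))) * χc y) := fun t =>
    integrable_mul_tsupport hχcc hχccpt
      ((hv.continuousOn.mul (hdJc.mul (hPrc.neg.mul (hexpc t)))).mono hχcs)
  have hi3 : Integrable (fun y => v y * (dJ y * -Pr y) * χc y) :=
    integrable_mul_tsupport hχcc hχccpt
      ((hv.continuousOn.mul (hdJc.mul hPrc.neg)).mono hχcs)
  have hJd : ∀ t : ℝ, 0 < t → HasDerivAt J (JP t) t := by
    intro t ht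
    refine (hasDerivAt_integral_of_dominated_loc_of_deriv_le
      (F := fun (t : ℝ) y => v y * (dJ y * Complex.exp (-((t : ℂ) * Pr y))) * χc y)
      (F' := fun (t : ℝ) y => v y * (dJ y * (-Pr y * Complex.exp (-((t : ℂ) * Pr y)))) * χc y)
      (bound := fun y => ‖v y * (dJ y * -Pr y) * χc y‖)
      (s := Set.Ioi 0) (isOpen_Ioi.mem_nhds ht) ?_ (hi1 t) ?_ ?_ hi3.norm ?_).2
    · exact Eventually.of_forall fun t => (hi1 t).aestronglyMeasurable
    · exact (hi2 t).aestronglyMeasurable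
    · refine Eventually.of_forall fun y t' ht' => ?_
      by_cases hy : y ∈ tsupport χc
      · have h1 : ‖Complex.exp (-((t' : ℂ) * Pr y))‖ ≤ 1 := by
          rw [Complex.norm_exp, Complex.neg_re, Complex.re_ofReal_mul, Real.exp_le_one_iff]
          have := mul_nonneg (le_of_lt ht') (hPre y (hχcs hy))
          linarith
        have h2 : v y * (dJ y * (-Pr y * Complex.exp (-((t' : ℂ) * Pr y)))) * χc y =
            (v y * (dJ y * -Pr y) * χc y) * Complex.exp (-((t' : ℂ) * Pr y)) := by ring
        rw [h2, norm_mul]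
        exact mul_le_of_le_one_right (norm_nonneg _) h1
      · have : χc y = 0 := image_eq_zero_of_notMem_tsupport hy
        simp [this]
    · refine Eventually.of_forall fun y t' _ => ?_
      have h1 : HasDerivAt (fun t : ℝ => -((t : ℂ) * Pr y)) (-Pr y) t' := by
        have := ((Complex.ofRealCLM.hasDerivAt (x := t')).mul_const (Pr y)).fun_neg
        simpa using this
      have h2 := ((h1.cexp.const_mul (dJ y)).const_mul (v y)).mul_const (χc y)
      refine h2.congr_deriv ?_
      ring
  -- The Euler field in the `θ`-coordinates centred at `Θ(y, x̄)`: its `θ`-divergence is `n` and its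
  -- pairing with `y - x` is the phase `P`. The relation becomes `n J + t J' =` boundary term, that
  -- is, `t (tⁿ J)' = tⁿ ·` boundary term.
  set g : Fin n → Cn n × Cn n → ℂ := fun j q => Θ q j - Θ (q.1, cbar x) j with hg
  obtain ⟨hgan', hgd', hPz⟩ := phase_relations hΘ hx hPΘ
  have hgan : ∀ j, AnalyticOnNhd ℂ (g j) W := hgan'
  have hgd : ∀ j i, ∀ q ∈ W, fderiv ℂ (g j) q (0, e i) = jac Θ q j i := hgd'
  have hrel : ∀ t : ℝ, (n : ℂ) * J t + (t : ℂ) * JP t =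
      -∫ y, v y * (Complex.exp (-((t : ℂ) * Pr y)) *
        ∑ i, (∑ j, (jac Θ (y, cbar y)).adjugate i j * g j (y, cbar y)) *
          wirtingerBar i χc y) := by
    intro t
    rw [← integral_relation hχ hsupp hv hΘ hdet hP hPz hgan (t : ℂ)]
    rw [← integral_const_mul, ← integral_const_mul, ← integral_add ((hi1 t).const_mul _)
      ((hi2 t).const_mul _)]
    refine integral_congr_ae (Eventually.of_forall fun y => ?_)
    by_cases hy : y ∈ tsupport χ
    · have hq := graph_mem (hsupp hy)
      have h1 : ∑ i, ∑ j, (jac Θ (y, cbar y)).adjugate i j * fderiv ℂ (g j) (y, cbar y) (0, e i) =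
          n * dJ y := by
        have h2 : ∀ i, ∑ j, (jac Θ (y, cbar y)).adjugate i j *
            fderiv ℂ (g j) (y, cbar y) (0, e i) = dJ y := by
          intro i
          have := congrFun (congrFun (Matrix.adjugate_mul (jac Θ (y, cbar y))) i) i
          rw [Matrix.mul_apply] at this
          simp only [hgd _ _ _ hq]
          rw [this]
          simp [hdJ]
        simp [h2]
      have h2 : ∑ j, (y j - x j) * g j (y, cbar y) = Pr y := (hPΘ _ hq).symm
      simp only [h1, h2]
      change _ = v y * ((n * dJ y - t * (dJ y * Pr y)) * cexp (-(t * Pr y))) * χc y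
      ring
    · have h0 : χ y = 0 := image_eq_zero_of_notMem_tsupport hy
      simp [hχc, h0]
  set F : ℝ → ℂ := fun t => (t : ℂ) ^ n * J t with hF
  have hFd : ∀ t : ℝ, 0 < t →
      HasDerivAt F (n * (t : ℂ) ^ (n - 1) * J t + (t : ℂ) ^ n * JP t) t := by
    intro t ht
    have h1 : HasDerivAt (fun t : ℝ => (t : ℂ) ^ n) (n * (t : ℂ) ^ (n - 1)) t :=
      (hasDerivAt_pow n (t : ℂ)).comp_ofReal
    exact h1.mul (hJd t ht)
  set Q : ℝ → ℝ := fun t => ∫ y in S, ‖v y‖ * Real.exp (-(t * (Pr y).re)) with hQ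
  have hQi : ∀ t, IntegrableOn (fun y => ‖v y‖ * Real.exp (-(t * (Pr y).re))) S := by
    intro t
    refine ContinuousOn.integrableOn_compact hS ?_
    refine (hv.continuousOn.mono hSs).norm.mul ?_
    exact Real.continuous_exp.comp_continuousOn
      (continuousOn_const.mul (Complex.continuous_re.comp_continuousOn (hPrc.mono hSs))).neg
  have hbd : ∀ t : ℝ, ‖(n : ℂ) * J t + (t : ℂ) * JP t‖ ≤ C * Q t := by
    intro t
    rw [hrel t, norm_neg]
    refine norm_integral_boundary_le hS.measurableSet ?_ hC (hQi t)
    intro y hy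
    refine Finset.sum_eq_zero fun i _ => ?_
    rw [wirtingerBar_eq_zero (hχS y hy), mul_zero]
  -- Only the excess `t - k` is spent on the bound `Re P ≥ c`; the weight `e^{-k Re P}` is kept for
  -- the comparison with the norm of `u`.
  have hQle : ∀ t, k ≤ t → Q t ≤ Real.exp (-((t - k) * c)) * Q k := by
    intro t ht
    rw [hQ]
    simp only
    rw [← integral_const_mul]
    refine setIntegral_mono_on (hQi t) ((hQi k).const_mul _) hS.measurableSet fun y hy => ?_
    have h1 : Real.exp (-(t * (Pr y).re)) ≤
        Real.exp (-((t - k) * c)) * Real.exp (-(k * (Pr y).re)) := by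
      rw [← Real.exp_add, Real.exp_le_exp]
      have := mul_le_mul_of_nonneg_left (hcS y hy) (sub_nonneg.2 ht)
      linarith
    calc _ ≤ ‖v y‖ * (Real.exp (-((t - k) * c)) * Real.exp (-(k * (Pr y).re))) := by gcongr
      _ = _ := by ring
  have hQ0 : 0 ≤ Q k := integral_nonneg fun y => by positivity
  have hF' : ∀ t, k ≤ t → ‖n * (t : ℂ) ^ (n - 1) * J t + (t : ℂ) ^ n * JP t‖ ≤
      C * growthConst n c * k ^ n * Q k * Real.exp (-((t - k) * (c / 2))) := by
    intro t ht
    have ht1 : 1 ≤ t := hk.trans ht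
    have ht0 : (t : ℂ) ≠ 0 := by exact_mod_cast (by linarith : t ≠ 0)
    -- Since `t ≥ 1`, the derivative may be multiplied by `t` instead of dividing the relation. For
    -- `n = 0` the truncated exponent `n - 1` is harmless because of the factor `n`.
    have h1 : (t : ℂ) * (n * (t : ℂ) ^ (n - 1) * J t + (t : ℂ) ^ n * JP t) =
        (t : ℂ) ^ n * ((n : ℂ) * J t + (t : ℂ) * JP t) := by
      rcases n with _ | m
      · simp
      · simp only [Nat.add_sub_cancel, pow_succ]
        ring
    have h2 : ‖n * (t : ℂ) ^ (n - 1) * J t + (t : ℂ) ^ n * JP t‖ ≤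
        ‖(t : ℂ) * (n * (t : ℂ) ^ (n - 1) * J t + (t : ℂ) ^ n * JP t)‖ := by
      rw [norm_mul (t : ℂ), Complex.norm_real, Real.norm_of_nonneg (by linarith)]
      exact le_mul_of_one_le_left (norm_nonneg _) ht1
    refine h2.trans ?_
    rw [h1, norm_mul, norm_pow, Complex.norm_real, Real.norm_of_nonneg (by linarith)]
    calc t ^ n * ‖(n : ℂ) * J t + (t : ℂ) * JP t‖
        ≤ t ^ n * (C * (Real.exp (-((t - k) * c)) * Q k)) := by
          gcongr
          exact (hbd t).trans (by gcongr; exact hQle t ht)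
      _ = C * Q k * (t ^ n * Real.exp (-((t - k) * c))) := by ring
      _ ≤ C * Q k * (growthConst n c * k ^ n * Real.exp (-((t - k) * (c / 2)))) := by
          exact mul_le_mul_of_nonneg_left (pow_mul_exp_le n hc hk ht) (by positivity)
      _ = _ := by ring
  set K : ℝ := C * growthConst n c * k ^ n * Q k with hK
  have hK0 : 0 ≤ K := by
    have := growthConst_nonneg n hc
    positivity
  -- Mean value inequality against the primitive of `K e^{-(t-k)c/2}` vanishing at `t = k`.
  have hdiff : ∀ T, k ≤ T → ‖F T - F k‖ ≤ K * (2 / c) := by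
    intro T hT
    have h1 := image_norm_le_of_norm_deriv_right_le_deriv_boundary
      (f := fun t => F t - F k) (a := k) (b := T)
      (f' := fun t => n * (t : ℂ) ^ (n - 1) * J t + (t : ℂ) ^ n * JP t)
      (B := fun t => K * (2 / c) * (1 - Real.exp (-((t - k) * (c / 2)))))
      (B' := fun t => K * Real.exp (-((t - k) * (c / 2)))) ?_ ?_ ?_ ?_ ?_ (Set.right_mem_Icc.2 hT)
    · refine h1.trans ?_
      have : 0 ≤ K * (2 / c) := by positivity
      have := Real.exp_pos (-((T - k) * (c / 2)))
      nlinarith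
    · intro t ht
      exact ((hFd t (by linarith [ht.1])).continuousAt.sub continuousAt_const).continuousWithinAt
    · intro t ht
      exact ((hFd t (by linarith [ht.1])).sub_const _).hasDerivWithinAt
    · simp
    · intro t
      have h2 : HasDerivAt (fun t : ℝ => -((t - k) * (c / 2))) (-(c / 2)) t := by
        have := (((hasDerivAt_id t).sub_const k).mul_const (c / 2)).fun_neg
        simpa using this
      have h3 := (h2.exp.const_sub 1).const_mul (K * (2 / c))
      refine h3.congr_deriv ?_
      field_simp
    · intro t ht
      exact hF' t ht.1
  -- The Gaussian constant `πⁿ / det J(x, x̄)` cancels the Jacobian in the integrand at `y = x`,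
  -- where `χ = 1`.
  have hlim : Tendsto (fun c : ℝ => F (c ^ 2)) atTop (𝓝 ((Real.pi : ℂ) ^ n * v x)) := by
    set G : Cn n → ℂ := fun y => v y * dJ y * χc y with hG
    have hGs : tsupport G ⊆ tsupport χc := by
      refine closure_mono fun y hy => ?_
      rw [Function.mem_support] at hy ⊢
      exact right_ne_zero_of_mul hy
    set η' : Cn n →L[ℝ] Cn n := (fderiv ℂ Θ (x, cbar x)).restrictScalars ℝ ∘L
      ((graphL n) - (ContinuousLinearMap.id ℝ (Cn n)).prod 0) with hη'
    have hη : HasFDerivAt (fun y => Θ (y, cbar y) - Θ (y, cbar x)) η' x := by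
      have h1 := ((hΘ _ (graph_mem hx)).differentiableAt.hasFDerivAt).restrictScalars ℝ
      have h2 : HasFDerivAt (fun y => Θ (y, cbar y))
          (((fderiv ℂ Θ (x, cbar x)).restrictScalars ℝ).comp (graphL n)) x :=
        h1.comp x (graphL n).hasFDerivAt
      have h4 : HasFDerivAt (fun y : Cn n => (y, cbar x))
          ((ContinuousLinearMap.id ℝ (Cn n)).prod (0 : Cn n →L[ℝ] Cn n)) x :=
        (hasFDerivAt_id x).prodMk (hasFDerivAt_const _ _)
      have h3 : HasFDerivAt (fun y => Θ (y, cbar x))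
          (((fderiv ℂ Θ (x, cbar x)).restrictScalars ℝ).comp
            ((ContinuousLinearMap.id ℝ (Cn n)).prod 0)) x :=
        h1.comp x h4
      rw [hη', ContinuousLinearMap.comp_sub]
      exact h2.sub h3
    have h1 := tendsto_laplace isOpen_ball (x := x) (G := G) (P := Pr) (η := fun y =>
      Θ (y, cbar y) - Θ (y, cbar x)) (η' := η')
      (continuous_mul_of_tsupport isOpen_ball hχcc hχcs (hv.continuousOn.mul hdJc))
      (hχccpt.isCompact.of_isClosed_subset (isClosed_tsupport _) hGs) (hGs.trans hχcs) hPrc hδ hlow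
      hη (sub_self _) hx (fun y hy => hPΘ _ (graph_mem hy))
    have h2 : ∀ w, ∑ j, w j * η' w j =
        ∑ j, w j * ∑ i, jac Θ (x, cbar x) j i * conj (w i) := by
      intro w
      refine Finset.sum_congr rfl fun j _ => ?_
      congr 1
      have h3 : η' w = fderiv ℂ Θ (x, cbar x) (0, cbar w) := by
        rw [hη']
        simp only [ContinuousLinearMap.comp_apply, sub_apply, graphL_apply,
          ContinuousLinearMap.prod_apply, ContinuousLinearMap.id_apply, zero_apply,
          ContinuousLinearMap.coe_restrictScalars', Prod.mk_sub_mk, sub_self, sub_zero]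
      have h4 : ((0, cbar w) : Cn n × Cn n) = ∑ i, conj (w i) • ((0, e i) : Cn n × Cn n) := by
        have h5 := sum_smul_e (cbar w)
        refine Prod.ext ?_ ?_
        · simp [Prod.fst_sum]
        · simp only [Prod.snd_sum, Prod.smul_snd]
          exact h5.symm
      rw [h3, h4, map_sum]
      simp only [map_smul, WithLp.ofLp_sum, Finset.sum_apply, PiLp.smul_apply, smul_eq_mul]
      exact Finset.sum_congr rfl fun i _ => mul_comm _ _
    simp only [h2] at h1
    rw [integral_gaussian_form hpos] at h1
    have hdx : dJ x ≠ 0 := hdet _ (graph_mem hx)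
    have h6 : (Real.pi : ℂ) ^ n / (jac Θ (x, cbar x)).det * G x = (Real.pi : ℂ) ^ n * v x := by
      simp only [hG, hχc, hχx]
      change (Real.pi : ℂ) ^ n / dJ x * _ = _
      field_simp
      simp
    rw [h6] at h1
    refine h1.congr fun c => ?_
    simp only [hF, hJ, hG]
    push_cast
    rw [← pow_mul]
    congr 1
    refine integral_congr_ae (Eventually.of_forall fun y => ?_)
    simp only
    ring
  have hfin : Tendsto (fun c : ℝ => ‖F (c ^ 2) - F k‖) atTop
      (𝓝 ‖(Real.pi : ℂ) ^ n * v x - F k‖) := (hlim.sub_const _).norm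
  have hle : ‖(Real.pi : ℂ) ^ n * v x - F k‖ ≤ K * (2 / c) := by
    refine le_of_tendsto hfin ?_
    have : Tendsto (fun c : ℝ => c ^ 2) atTop atTop := tendsto_pow_atTop two_ne_zero
    filter_upwards [this.eventually_ge_atTop k] with c hc using hdiff _ hc
  rw [norm_sub_rev] at hle
  calc _ ≤ K * (2 / c) := hle
    _ = _ := by rw [hK]; ring

end LeadingTerm

/-! ### Weighted `L²` estimates. -/

section WeightedEstimates

variable {n : ℕ}

/-- Cauchy–Schwarz for square integrable real functions. -/
lemma integral_mul_le_sqrt_mul_sqrt {α : Type*} [MeasurableSpace α] {μ : Measure α} {f g : α → ℝ}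
    (hf0 : ∀ y, 0 ≤ f y) (hg0 : ∀ y, 0 ≤ g y) (hfm : AEStronglyMeasurable f μ)
    (hgm : AEStronglyMeasurable g μ) (hf : Integrable (fun y => f y ^ 2) μ)
    (hg : Integrable (fun y => g y ^ 2) μ) :
    Integrable (fun y => f y * g y) μ ∧
      ∫ y, f y * g y ∂μ ≤ Real.sqrt (∫ y, f y ^ 2 ∂μ) * Real.sqrt (∫ y, g y ^ 2 ∂μ) := by
  have hf2 : MemLp f 2 μ := (memLp_two_iff_integrable_sq hfm).2 hf
  have hg2 : MemLp g 2 μ := (memLp_two_iff_integrable_sq hgm).2 hg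
  refine ⟨hf2.integrable_mul hg2, ?_⟩
  have h := integral_mul_le_Lp_mul_Lq_of_nonneg (μ := μ) (f := f) (g := g)
    Real.HolderConjugate.two_two (Eventually.of_forall hf0) (Eventually.of_forall hg0)
    (by simpa using hf2) (by simpa using hg2)
  simpa [Real.sqrt_eq_rpow] using h

/-- Weighted Cauchy–Schwarz estimate on subsets of the ball. -/
theorem integral_weighted_le {φ : Cn n → ℝ} {r : ℝ} {k : ℕ} {u : Cn n → ℂ} (hu : MemH φ r k u)
    (hφ : ContinuousOn φ (ball 0 r)) {c₀ : ℝ} (hc₀ : 0 < c₀)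
    (hvol : ∀ y ∈ ball (0 : Cn n) r, c₀ ≤ volDensity φ y) {ρ : Cn n → ℝ}
    (hρ : ContinuousOn ρ (ball 0 r)) {A : Set (Cn n)} (hA : MeasurableSet A) (hAr : A ⊆ ball 0 r)
    {D : ℝ} (hD0 : 0 ≤ D) (hDi : IntegrableOn (fun y => Real.exp (-(k * ρ y))) A)
    (hD : ∫ y in A, Real.exp (-(k * ρ y)) ≤ D ^ 2) :
    IntegrableOn (fun y => ‖u y‖ * Real.exp (-(k * φ y / 2)) * Real.exp (-(k * ρ y / 2))) A ∧
    ∫ y in A, ‖u y‖ * Real.exp (-(k * φ y / 2)) * Real.exp (-(k * ρ y / 2)) ≤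
      (Real.sqrt c₀)⁻¹ * weightedNorm φ r k u * D := by
  have hsq : ∀ a : ℝ, Real.exp (-(a / 2)) ^ 2 = Real.exp (-a) := by
    intro a
    rw [← Real.exp_nat_mul]
    congr 1
    push_cast
    ring
  have hfm : ContinuousOn (fun y => ‖u y‖ * Real.exp (-(k * φ y / 2))) (ball 0 r) :=
    hu.1.continuousOn.norm.mul (Real.continuous_exp.comp_continuousOn
      ((continuousOn_const.mul hφ).div_const 2).neg)
  have hgm : ContinuousOn (fun y => Real.exp (-(k * ρ y / 2))) (ball 0 r) :=
    Real.continuous_exp.comp_continuousOn ((continuousOn_const.mul hρ).div_const 2).neg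
  have hf2 : ∀ y, (‖u y‖ * Real.exp (-(k * φ y / 2))) ^ 2 = ‖u y‖ ^ 2 * Real.exp (-(k * φ y)) := by
    intro y; rw [mul_pow, hsq]
  -- The lower bound on the density of `ω_n` lets the weighted norm control the Lebesgue `L²` norm
  -- of `u e^{-kφ/2}`.
  have hpt : ∀ y ∈ ball (0 : Cn n) r, ‖u y‖ ^ 2 * Real.exp (-(k * φ y)) ≤
      c₀⁻¹ * normSqIntegrand φ k u y := by
    intro y hy
    rw [inv_mul_eq_div, le_div_iff₀ hc₀, normSqIntegrand, ← mul_assoc]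
    exact mul_le_mul_of_nonneg_left (hvol y hy) (by positivity)
  have hf2i : IntegrableOn (fun y => (‖u y‖ * Real.exp (-(k * φ y / 2))) ^ 2) (ball 0 r) := by
    refine Integrable.mono' (hu.2.const_mul c₀⁻¹)
      ((hfm.pow 2).aestronglyMeasurable measurableSet_ball) ?_
    refine (ae_restrict_iff' measurableSet_ball).2 (Eventually.of_forall fun y hy => ?_)
    rw [Real.norm_of_nonneg (sq_nonneg _), hf2]
    exact hpt y hy
  have h1 := integral_mul_le_sqrt_mul_sqrt (μ := volume.restrict A)
    (f := fun y => ‖u y‖ * Real.exp (-(k * φ y / 2))) (g := fun y => Real.exp (-(k * ρ y / 2)))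
    (fun y => by positivity) (fun y => (Real.exp_pos _).le)
    ((hfm.mono hAr).aestronglyMeasurable hA) ((hgm.mono hAr).aestronglyMeasurable hA)
    (hf2i.mono_set hAr) (by simp only [hsq]; exact hDi)
  refine ⟨h1.1, h1.2.trans ?_⟩
  refine mul_le_mul ?_ ?_ (Real.sqrt_nonneg _)
    (mul_nonneg (inv_nonneg.2 (Real.sqrt_nonneg _)) (Real.sqrt_nonneg _))
  · rw [weightedNorm, ← Real.sqrt_inv, ← Real.sqrt_mul (inv_nonneg.2 hc₀.le)]
    refine Real.sqrt_le_sqrt ?_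
    rw [← integral_const_mul]
    calc ∫ y in A, (‖u y‖ * Real.exp (-(k * φ y / 2))) ^ 2
        ≤ ∫ y in ball 0 r, (‖u y‖ * Real.exp (-(k * φ y / 2))) ^ 2 :=
          setIntegral_mono_set hf2i (Eventually.of_forall fun y => sq_nonneg _)
            hAr.eventuallyLE
      _ ≤ ∫ y in ball 0 r, c₀⁻¹ * normSqIntegrand φ k u y := by
          refine setIntegral_mono_on hf2i (hu.2.const_mul c₀⁻¹) measurableSet_ball fun y hy => ?_
          rw [hf2]
          exact hpt y hy
  · rw [← Real.sqrt_sq hD0]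
    refine Real.sqrt_le_sqrt ?_
    simpa only [hsq] using hD

lemma integrable_exp_neg_mul_sq (δ : ℝ) (hδ : 0 < δ) (x : Cn n) :
    Integrable (fun y : Cn n => Real.exp (-(δ * ‖y - x‖ ^ 2))) ∧
      ∫ y : Cn n, Real.exp (-(δ * ‖y - x‖ ^ 2)) = (Real.pi / δ) ^ n := by
  have h6 := GaussianFourier.integral_rexp_neg_mul_sq_norm (V := Cn n) hδ
  have h7 : Module.finrank ℝ (Cn n) = 2 * n := by
    rw [← Module.finrank_mul_finrank ℝ ℂ (Cn n)]; simp
  have h8 : (((2 * n : ℕ) : ℝ)) / 2 = n := by push_cast; ring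
  rw [h7, h8, Real.rpow_natCast] at h6
  have hpos : 0 < (Real.pi / δ) ^ n := by positivity
  have hint : Integrable (fun y : Cn n => Real.exp (-δ * ‖y‖ ^ 2)) := by
    by_contra hni
    rw [integral_undef hni] at h6
    exact hpos.ne h6
  have h9 : (fun y : Cn n => Real.exp (-(δ * ‖y - x‖ ^ 2))) =
      fun y => (fun y : Cn n => Real.exp (-δ * ‖y‖ ^ 2)) (y - x) := by
    ext y; simp only [neg_mul]
  rw [h9]
  exact ⟨hint.comp_sub_right x, (integral_sub_right_eq_self _ x).trans h6⟩

/-- A weight bounded below quadratically has total mass `O(k^{-n/2})²`. -/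
lemma integral_exp_le_gaussian {ρ : Cn n → ℝ} {A : Set (Cn n)} (hA : MeasurableSet A)
    (hρ : ContinuousOn ρ A) {δ : ℝ} (hδ : 0 < δ) {x : Cn n}
    (hlow : ∀ y ∈ A, δ * ‖y - x‖ ^ 2 ≤ ρ y) {k : ℕ} (hk : 1 ≤ k) :
    IntegrableOn (fun y => Real.exp (-(k * ρ y))) A ∧
      ∫ y in A, Real.exp (-(k * ρ y)) ≤
        (Real.sqrt ((Real.pi / δ) ^ n) * (k : ℝ) ^ (-(n : ℝ) / 2)) ^ 2 := by
  have hk0 : (0 : ℝ) < k := by exact_mod_cast hk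
  obtain ⟨h1, h2⟩ := integrable_exp_neg_mul_sq (n := n) (k * δ) (by positivity) x
  have hle : ∀ y ∈ A, Real.exp (-(k * ρ y)) ≤ Real.exp (-(k * δ * ‖y - x‖ ^ 2)) := by
    intro y hy
    rw [Real.exp_le_exp, mul_assoc]
    exact neg_le_neg (mul_le_mul_of_nonneg_left (hlow y hy) hk0.le)
  have hi : IntegrableOn (fun y => Real.exp (-(k * ρ y))) A := by
    refine Integrable.mono' h1.integrableOn ((Real.continuous_exp.comp_continuousOn
      (continuousOn_const.mul hρ).neg).aestronglyMeasurable hA) ?_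
    refine (ae_restrict_iff' hA).2 (Eventually.of_forall fun y hy => ?_)
    rw [Real.norm_of_nonneg (Real.exp_pos _).le]
    exact hle y hy
  refine ⟨hi, ?_⟩
  have hsq : ((k : ℝ) ^ (-(n : ℝ) / 2)) ^ 2 = ((k : ℝ) ^ n)⁻¹ := by
    rw [← Real.rpow_natCast, ← Real.rpow_mul hk0.le, ← Real.rpow_natCast, ← Real.rpow_neg hk0.le]
    congr 1
    push_cast
    ring
  calc ∫ y in A, Real.exp (-(k * ρ y))
      ≤ ∫ y in A, Real.exp (-(k * δ * ‖y - x‖ ^ 2)) :=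
        setIntegral_mono_on hi h1.integrableOn hA hle
    _ ≤ ∫ y, Real.exp (-(k * δ * ‖y - x‖ ^ 2)) :=
        setIntegral_le_integral h1 (Eventually.of_forall fun y => (Real.exp_pos _).le)
    _ = (Real.pi / (k * δ)) ^ n := h2
    _ = _ := by
        rw [mul_pow, Real.sq_sqrt (by positivity), hsq, div_pow, div_pow, mul_pow]
        field_simp

lemma integral_exp_le_of_lower {ρ : Cn n → ℝ} {A : Set (Cn n)} (hA : MeasurableSet A) {r : ℝ}
    (hAr : A ⊆ ball 0 r) (hρ : ContinuousOn ρ A) {c : ℝ} (hlow : ∀ y ∈ A, c ≤ ρ y) (k : ℕ) :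
    IntegrableOn (fun y => Real.exp (-(k * ρ y))) A ∧
      ∫ y in A, Real.exp (-(k * ρ y)) ≤
        (Real.sqrt (volume.real (ball (0 : Cn n) r)) * Real.exp (-(k * c / 2))) ^ 2 := by
  have hfin : volume A ≠ ⊤ := ((measure_mono hAr).trans_lt measure_ball_lt_top).ne
  have hle : ∀ y ∈ A, Real.exp (-(k * ρ y)) ≤ Real.exp (-(k * c)) := by
    intro y hy
    rw [Real.exp_le_exp]
    exact neg_le_neg (mul_le_mul_of_nonneg_left (hlow y hy) (Nat.cast_nonneg k))
  have hconst : IntegrableOn (fun _ : Cn n => Real.exp (-(k * c))) A :=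
    integrableOn_const hfin
  have hi : IntegrableOn (fun y => Real.exp (-(k * ρ y))) A := by
    refine Integrable.mono' hconst ((Real.continuous_exp.comp_continuousOn
      (continuousOn_const.mul hρ).neg).aestronglyMeasurable hA) ?_
    refine (ae_restrict_iff' hA).2 (Eventually.of_forall fun y hy => ?_)
    rw [Real.norm_of_nonneg (Real.exp_pos _).le]
    exact hle y hy
  refine ⟨hi, (setIntegral_mono_on hi hconst hA hle).trans ?_⟩
  rw [setIntegral_const, mul_pow, Real.sq_sqrt measureReal_nonneg, smul_eq_mul]
  have hsq : Real.exp (-(k * c / 2)) ^ 2 = Real.exp (-(k * c)) := by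
    rw [← Real.exp_nat_mul]
    congr 1
    push_cast
    ring
  rw [hsq]
  exact mul_le_mul_of_nonneg_right (measureReal_mono hAr measure_ball_lt_top.ne)
    (Real.exp_pos _).le

/-- Exponential decay beats any power. -/
lemma exists_pow_mul_exp_le (a b : ℝ) {c : ℝ} (hc : 0 < c) :
    ∃ C, 0 ≤ C ∧ ∀ k : ℕ, 1 ≤ k → (k : ℝ) ^ a * Real.exp (-(k * c)) ≤ C * (k : ℝ) ^ b := by
  have h := (tendsto_rpow_mul_exp_neg_mul_atTop_nhds_zero (a - b) c hc).comp
    tendsto_natCast_atTop_atTop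
  obtain ⟨C, hC⟩ := h.bddAbove_range
  refine ⟨max C 0, le_max_right _ _, fun k hk => ?_⟩
  have hk0 : (0 : ℝ) < k := by exact_mod_cast hk
  have h1 : (k : ℝ) ^ (a - b) * Real.exp (-c * k) ≤ C := hC ⟨k, rfl⟩
  have h2 : (k : ℝ) ^ a = (k : ℝ) ^ (a - b) * (k : ℝ) ^ b := by
    rw [← Real.rpow_add hk0]; congr 1; ring
  rw [h2, show -((k : ℝ) * c) = -c * k by ring]
  calc _ = ((k : ℝ) ^ (a - b) * Real.exp (-c * k)) * (k : ℝ) ^ b := by ring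
    _ ≤ max C 0 * (k : ℝ) ^ b := by
      gcongr
      exact h1.trans (le_max_left _ _)

end WeightedEstimates

/-! ### The phase `ψ`, the map `θ` and the complex Hessian. -/

section PhaseProperties

variable {n : ℕ}

/-- `θ` as a map of the triple `(x, y, z)`. -/
def thetaMap (ψ : Cn n → Cn n → ℂ) (q : Cn3 n) : Cn n := theta ψ q.1 q.2.1 q.2.2

/-- The matrix `θ_z(x, y, z)`. -/
def thetaJac (ψ : Cn n → Cn n → ℂ) (q : Cn3 n) : Matrix (Fin n) (Fin n) ℂ :=
  Matrix.of fun i j => cd j (fun z => theta ψ q.1 q.2.1 z i) q.2.2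

/-- The matrix `ψ_{yz}(y, z)`. -/
def mixedHess (ψ : Cn n → Cn n → ℂ) (y z : Cn n) : Matrix (Fin n) (Fin n) ℂ :=
  Matrix.of fun i j => cd j (fun z => cd i (fun w => ψ w z) y) z

/-- The polarized diastasis `ψ(y, z) + ψ(x, x̄) - ψ(x, z) - ψ(y, x̄)`. -/
def diastasis (ψ : Cn n → Cn n → ℂ) (x : Cn n) (q : Cn n × Cn n) : ℂ :=
  ψ q.1 q.2 + ψ x (cbar x) - ψ x q.2 - ψ q.1 (cbar x)

/-- The analytic data attached to a strictly plurisubharmonic weight, on balls of radius `r`. -/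
structure IsPhase (φ : Cn n → ℝ) (ψ : Cn n → Cn n → ℂ) (ζ : Cn n → Cn n → Cn n → Cn n)
    (r δ c₀ : ℝ) : Prop where
  polarization : IsPolarization φ r ψ
  conj_symm : ∀ x ∈ ball (0 : Cn n) r, ∀ z ∈ ball (0 : Cn n) r,
    conj (ψ x z) = ψ (cbar z) (cbar x)
  coordInverse : IsCoordInverse ψ r ζ
  theta_analytic : AnalyticOnNhd ℂ (thetaMap ψ) (tripleBall n r)
  theta_phase : ∀ q ∈ tripleBall n r,
    ψ q.1 q.2.2 - ψ q.2.1 q.2.2 = ∑ i, (q.1 i - q.2.1 i) * thetaMap ψ q i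
  det_ne_zero : ∀ q ∈ tripleBall n r, (thetaJac ψ q).det ≠ 0
  lower : ∀ x ∈ ball (0 : Cn n) r, ∀ y ∈ ball (0 : Cn n) r,
    δ * ‖y - x‖ ^ 2 ≤ (diastasis ψ x (y, cbar y)).re
  posDef : ∀ x ∈ ball (0 : Cn n) r, (mixedHess ψ x (cbar x)).PosDef
  volDensity_eq : ∀ x ∈ ball (0 : Cn n) r, (volDensity φ x : ℂ) = (mixedHess ψ x (cbar x)).det
  volDensity_lower : ∀ x ∈ ball (0 : Cn n) r, c₀ ≤ volDensity φ x

lemma cd_fst {Ψ : Cn n × Cn n → ℂ} {x z : Cn n} (h : DifferentiableAt ℂ Ψ (x, z)) (i : Fin n) :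
    cd i (fun w => Ψ (w, z)) x = fderiv ℂ Ψ (x, z) (e i, 0) := by
  have h1 : HasFDerivAt (fun w : Cn n => (w, z))
      ((ContinuousLinearMap.id ℂ (Cn n)).prod 0) x :=
    (hasFDerivAt_id x).prodMk (hasFDerivAt_const _ _)
  have h2 : HasFDerivAt (fun w => Ψ (w, z)) _ x := h.hasFDerivAt.comp x h1
  rw [cd, h2.fderiv]
  rfl

lemma cd_snd {Ψ : Cn n × Cn n → ℂ} {x z : Cn n} (h : DifferentiableAt ℂ Ψ (x, z)) (i : Fin n) :
    cd i (fun w => Ψ (x, w)) z = fderiv ℂ Ψ (x, z) (0, e i) := by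
  have h1 : HasFDerivAt (fun w : Cn n => (x, w))
      ((0 : Cn n →L[ℂ] Cn n).prod (ContinuousLinearMap.id ℂ (Cn n))) z :=
    (hasFDerivAt_const _ _).prodMk (hasFDerivAt_id z)
  have h2 : HasFDerivAt (fun w => Ψ (x, w)) _ z := h.hasFDerivAt.comp z h1
  rw [cd, h2.fderiv]
  rfl

/-- The segment map `(x, y, z) ↦ (y + t (x - y), z)`. -/
def segL (n : ℕ) (t : ℝ) : Cn3 n →L[ℂ] Cn n × Cn n :=
  (ContinuousLinearMap.snd ℂ (Cn n) (Cn n × Cn n)) + (t : ℂ) •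
    ((ContinuousLinearMap.fst ℂ (Cn n) (Cn n × Cn n)).prod ((ContinuousLinearMap.snd ℂ _ _).comp
      (ContinuousLinearMap.snd ℂ _ _)) - ContinuousLinearMap.snd ℂ (Cn n) (Cn n × Cn n))

lemma segL_apply (t : ℝ) (q : Cn3 n) : segL n t q = (q.2.1 + (t : ℂ) • (q.1 - q.2.1), q.2.2) := by
  obtain ⟨x, y, z⟩ := q
  simp [segL]

lemma norm_segL_le {t : ℝ} (ht : t ∈ Set.Icc (0 : ℝ) 1) : ‖segL n t‖ ≤ 1 := by
  refine ContinuousLinearMap.opNorm_le_bound _ zero_le_one fun q => ?_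
  rw [segL_apply, one_mul]
  have h1 : ‖q.1‖ ≤ ‖q‖ := norm_fst_le q
  have h2 : ‖q.2‖ ≤ ‖q‖ := norm_snd_le q
  exact norm_prod_le_iff.2 ⟨norm_add_smul_sub_le ((norm_fst_le q.2).trans h2) h1 ht,
    (norm_snd_le q.2).trans h2⟩

lemma continuous_segL : Continuous (segL n) := by
  unfold segL; fun_prop

lemma thetaMap_apply (ψ : Cn n → Cn n → ℂ) (q : Cn3 n) (i : Fin n) :
    thetaMap ψ q i = ∫ t in (0 : ℝ)..1, cd i (fun w => ψ w q.2.2) (segL n t q).1 := by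
  simp only [thetaMap, theta, segL_apply]
  refine intervalIntegral.integral_congr fun t _ => ?_
  congr 1
  module

lemma theta_diag (ψ : Cn n → Cn n → ℂ) (x z : Cn n) (i : Fin n) :
    theta ψ x x z i = cd i (fun w => ψ w z) x := by
  have h : ∀ t : ℝ, ((t : ℂ) • x + (1 - t : ℂ) • x) = x := fun t => by module
  simp only [theta, h]
  simp

/-- On `y = x` the segment is constant and `θ` is `∂ψ` itself. Consequently `Δ₀ = 1` there, which
makes the equations for the `b_m` triangular. -/
lemma thetaJac_diag (ψ : Cn n → Cn n → ℂ) (x z : Cn n) :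
    thetaJac ψ (x, x, z) = mixedHess ψ x z := by
  ext i j
  simp only [thetaJac, mixedHess, Matrix.of_apply, theta_diag]

section Germ

variable {Ψ : Cn n × Cn n → ℂ}

/-- The function of two variables with uncurried form `Ψ`. -/
def curry2 (Ψ : Cn n × Cn n → ℂ) (x z : Cn n) : ℂ := Ψ (x, z)

lemma eventually_segL {P : Cn n × Cn n → Prop} (h : ∀ᶠ p in 𝓝 (0 : Cn n × Cn n), P p) :
    ∀ᶠ q in 𝓝 (0 : Cn3 n), ∀ t ∈ Set.Icc (0 : ℝ) 1, P (segL n t q) := by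
  obtain ⟨ε, hε, hball⟩ := Metric.eventually_nhds_iff_ball.1 h
  filter_upwards [ball_mem_nhds 0 hε] with q hq t ht
  refine hball _ ?_
  rw [mem_ball_zero_iff] at hq ⊢
  refine lt_of_le_of_lt ((segL n t).le_of_opNorm_le (norm_segL_le ht) q) ?_
  simpa using hq

lemma analyticAt_of_components {E : Type*} [NormedAddCommGroup E] [NormedSpace ℂ E]
    {f : E → Cn n} {a : E} (h : ∀ i, AnalyticAt ℂ (fun q => f q i) a) : AnalyticAt ℂ f a := by
  have h1 : AnalyticAt ℂ (fun q => (fun i => f q i)) a := AnalyticAt.pi h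
  exact ((PiLp.continuousLinearEquiv 2 ℂ (fun _ : Fin n => ℂ)).symm.toContinuousLinearMap.analyticAt
    _).comp h1

lemma eventually_thetaMap_eq (hΨ : AnalyticAt ℂ Ψ 0) (i : Fin n) :
    ∀ᶠ q in 𝓝 (0 : Cn3 n), thetaMap (curry2 Ψ) q i =
      ∫ t in (0 : ℝ)..1, (1 : ℂ) • fderiv ℂ Ψ (segL n t q) (e i, 0) := by
  filter_upwards [eventually_segL hΨ.eventually_analyticAt] with q hq
  rw [thetaMap_apply]
  refine intervalIntegral.integral_congr fun t ht => ?_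
  rw [Set.uIcc_of_le zero_le_one] at ht
  have h2 : segL n t q = ((segL n t q).1, q.2.2) := by rw [segL_apply]
  have := hq t ht
  rw [h2] at this
  simp only [one_smul]
  rw [h2]
  exact cd_fst this.differentiableAt i

lemma analyticAt_thetaMap (hΨ : AnalyticAt ℂ Ψ 0) : AnalyticAt ℂ (thetaMap (curry2 Ψ)) 0 := by
  refine analyticAt_of_components fun i => ?_
  have h1 : AnalyticAt ℂ (fun p => fderiv ℂ Ψ p (e i, 0)) 0 :=
    ((ContinuousLinearMap.apply ℂ ℂ ((e i, 0) : Cn n × Cn n)).analyticAt _).comp hΨ.fderiv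
  have h2 := analyticAt_integral_comp_linear (a := (0 : Cn3 n)) h1 (g := fun _ => (1 : ℂ))
    continuous_const continuous_segL (fun t ht => norm_segL_le ht) (fun t => by simp)
  exact h2.congr ((eventually_thetaMap_eq hΨ i).mono fun q hq => hq.symm)

/-- The fundamental theorem of calculus along the segment from `y` to `x`; this is what `θ` is made
for. -/
lemma eventually_theta_phase (hΨ : AnalyticAt ℂ Ψ 0) :
    ∀ᶠ q in 𝓝 (0 : Cn3 n), curry2 Ψ q.1 q.2.2 - curry2 Ψ q.2.1 q.2.2 =
      ∑ i, (q.1 i - q.2.1 i) * thetaMap (curry2 Ψ) q i := by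
  have h1 := eventually_segment_sub_eq (a := (0 : Cn3 n)) hΨ
    (A := (ContinuousLinearMap.fst ℂ (Cn n) (Cn n × Cn n)).prod
      ((ContinuousLinearMap.snd ℂ _ _).comp (ContinuousLinearMap.snd ℂ _ _)))
    (B := ContinuousLinearMap.snd ℂ (Cn n) (Cn n × Cn n))
    (fun t ht => norm_segL_le ht) rfl rfl
  filter_upwards [h1, eventually_all.2 (eventually_thetaMap_eq hΨ),
    eventually_segL hΨ.eventually_analyticAt] with q h1 h2 h3
  have h4 : curry2 Ψ q.1 q.2.2 - curry2 Ψ q.2.1 q.2.2 = ∫ t in (0 : ℝ)..1,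
      fderiv ℂ Ψ (segL n t q) ((q.1, q.2.2) - q.2) := h1
  rw [h4]
  simp only [h2, ← smul_eq_mul (α := ℂ) (_ - _), ← intervalIntegral.integral_smul, one_smul]
  rw [← intervalIntegral.integral_finsetSum
    (f := fun i (t : ℝ) => (q.1 i - q.2.1 i) • fderiv ℂ Ψ (segL n t q) (e i, 0))]
  · refine intervalIntegral.integral_congr fun t _ => ?_
    have h5 := sum_smul_e (q.1 - q.2.1)
    have h4 : ((q.1, q.2.2) : Cn n × Cn n) - q.2 =
        ∑ i, (q.1 i - q.2.1 i) • ((e i, 0) : Cn n × Cn n) := by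
      refine Prod.ext ?_ ?_
      · rw [Prod.fst_sum]; exact h5.symm
      · simp [Prod.snd_sum]
    simp only [h4, map_sum, map_smul]
  · intro i _
    refine ContinuousOn.intervalIntegrable fun t ht => ?_
    rw [Set.uIcc_of_le zero_le_one] at ht
    have hc : ContinuousAt (fun t => fderiv ℂ Ψ (segL n t q) (e i, 0)) t :=
      ((h3 t ht).fderiv.continuousAt.comp (f := fun t => segL n t q)
        (continuous_segL.clm_apply continuous_const).continuousAt).clm_apply continuousAt_const
    exact (hc.const_smul (q.1 i - q.2.1 i)).continuousWithinAt

lemma mixedHess_eq {y z : Cn n} (hΨ : AnalyticAt ℂ Ψ (y, z)) (i j : Fin n) :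
    mixedHess (curry2 Ψ) y z i j = fderiv ℂ (fun p => fderiv ℂ Ψ p (e i, 0)) (y, z) (0, e j) := by
  have h1 : AnalyticAt ℂ (fun p => fderiv ℂ Ψ p (e i, 0)) (y, z) :=
    ((ContinuousLinearMap.apply ℂ ℂ ((e i, 0) : Cn n × Cn n)).analyticAt _).comp hΨ.fderiv
  rw [← cd_snd h1.differentiableAt]
  have h2 : ∀ᶠ w in 𝓝 z, AnalyticAt ℂ Ψ (y, w) :=
    (Continuous.prodMk_right y).continuousAt.eventually hΨ.eventually_analyticAt
  have h3 : (fun w => cd i (fun v => curry2 Ψ v w) y) =ᶠ[𝓝 z]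
      fun w => fderiv ℂ Ψ (y, w) (e i, 0) := by
    filter_upwards [h2] with w hw using cd_fst hw.differentiableAt i
  simp only [mixedHess, Matrix.of_apply, cd]
  rw [← h3.fderiv_eq]
  rfl

lemma analyticAt_mixedHess {p : Cn n × Cn n} (hΨ : AnalyticAt ℂ Ψ p) (i j : Fin n) :
    AnalyticAt ℂ (fun p : Cn n × Cn n => mixedHess (curry2 Ψ) p.1 p.2 i j) p := by
  have h1 : AnalyticAt ℂ (fun p => fderiv ℂ Ψ p (e i, 0)) p :=
    ((ContinuousLinearMap.apply ℂ ℂ ((e i, 0) : Cn n × Cn n)).analyticAt _).comp hΨ.fderiv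
  have h2 : AnalyticAt ℂ (fun p => fderiv ℂ (fun p => fderiv ℂ Ψ p (e i, 0)) p (0, e j)) p :=
    ((ContinuousLinearMap.apply ℂ ℂ ((0, e j) : Cn n × Cn n)).analyticAt _).comp h1.fderiv
  refine h2.congr ?_
  filter_upwards [hΨ.eventually_analyticAt] with p hp
  exact (mixedHess_eq (y := p.1) (z := p.2) hp i j).symm

lemma fderiv_graph {h : Cn n × Cn n → ℂ} {w : Cn n} (hh : DifferentiableAt ℂ h (w, cbar w))
    (d : Cn n) : fderiv ℝ (fun v => h (v, cbar v)) w d = fderiv ℂ h (w, cbar w) (d, cbar d) := by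
  have h1 : HasFDerivAt (fun v => h (v, cbar v))
      (((fderiv ℂ h (w, cbar w)).restrictScalars ℝ).comp (graphL n)) w :=
    (hh.hasFDerivAt.restrictScalars ℝ).comp w (graphL n).hasFDerivAt
  rw [h1.fderiv]
  rfl

lemma wirtinger_aux {h : Cn n × Cn n →L[ℂ] ℂ} (i : Fin n) :
    h (e i, cbar (e i)) = h (e i, 0) + h (0, e i) ∧
      h (I • e i, cbar (I • e i)) = I * h (e i, 0) - I * h (0, e i) := by
  rw [cbar_e, cbar_I_smul_e]
  have e1 : ((e i, e i) : Cn n × Cn n) = (e i, 0) + (0, e i) := by simp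
  have e2 : ((I • e i, -(I • e i)) : Cn n × Cn n) = I • (e i, 0) - I • (0, e i) := by simp
  rw [e1, e2, map_add, map_sub, map_smul, map_smul]
  exact ⟨rfl, rfl⟩

/-- Moving `w` by `d` moves the point of the graph by `(d, d̄)`; the combination over `d = e_i` and
`d = I e_i` isolates the `z`-part, as `wirtinger_graph` does for the first variable. -/
lemma wirtingerBar_graph {h : Cn n × Cn n → ℂ} {w : Cn n}
    (hh : DifferentiableAt ℂ h (w, cbar w)) (i : Fin n) :
    wirtingerBar i (fun v => h (v, cbar v)) w = fderiv ℂ h (w, cbar w) (0, e i) := by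
  obtain ⟨h1, h2⟩ := wirtinger_aux (h := fderiv ℂ h (w, cbar w)) i
  rw [wirtingerBar, fderiv_graph hh, fderiv_graph hh, h1, h2]
  linear_combination (1 / 2 : ℂ) * (fderiv ℂ h (w, cbar w) (e i, 0) -
    fderiv ℂ h (w, cbar w) (0, e i)) * I_mul_I

lemma wirtinger_graph {h : Cn n × Cn n → ℂ} {w : Cn n}
    (hh : DifferentiableAt ℂ h (w, cbar w)) (i : Fin n) :
    wirtinger i (fun v => h (v, cbar v)) w = fderiv ℂ h (w, cbar w) (e i, 0) := by
  obtain ⟨h1, h2⟩ := wirtinger_aux (h := fderiv ℂ h (w, cbar w)) i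
  rw [wirtinger, fderiv_graph hh, fderiv_graph hh, h1, h2]
  linear_combination (-1 / 2 : ℂ) * (fderiv ℂ h (w, cbar w) (e i, 0) -
    fderiv ℂ h (w, cbar w) (0, e i)) * I_mul_I

lemma wirtinger_congr {f g : Cn n → ℂ} {w : Cn n} (h : f =ᶠ[𝓝 w] g) (i : Fin n) :
    wirtinger i f w = wirtinger i g w := by
  simp only [wirtinger, h.fderiv_eq]

lemma wirtingerBar_congr {f g : Cn n → ℂ} {w : Cn n} (h : f =ᶠ[𝓝 w] g) (i : Fin n) :
    wirtingerBar i f w = wirtingerBar i g w := by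
  simp only [wirtingerBar, h.fderiv_eq]

lemma fderiv_fderiv_apply {E : Type*} [NormedAddCommGroup E] [NormedSpace ℂ E] {f : E → ℂ} {p : E}
    (hf : AnalyticAt ℂ f p) (d d' : E) :
    fderiv ℂ (fun p => fderiv ℂ f p d) p d' = fderiv ℂ (fderiv ℂ f) p d' d := by
  have h3 : HasFDerivAt (fun q => fderiv ℂ f q d)
      ((ContinuousLinearMap.apply ℂ ℂ d).comp (fderiv ℂ (fderiv ℂ f) p)) p :=
    (ContinuousLinearMap.apply ℂ ℂ d).hasFDerivAt.comp p hf.fderiv.differentiableAt.hasFDerivAt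
  rw [h3.fderiv]
  rfl

/-- On the graph `z = w̄`, `∂̄` acts as `∂_z` and `∂` as the derivative in the first variable.
Through this identity strict plurisubharmonicity makes `θ_z` invertible, and the volume density
becomes `det ψ_yz`. -/
lemma complexHessian_eq_mixedHess {φ : Cn n → ℝ} (hΨ : AnalyticAt ℂ Ψ 0)
    (hφ : ∀ᶠ x in 𝓝 (0 : Cn n), Ψ (x, cbar x) = φ x) :
    ∀ᶠ w in 𝓝 (0 : Cn n), complexHessian φ w = mixedHess (curry2 Ψ) w (cbar w) := by
  have hc : Tendsto (fun w : Cn n => (w, cbar w)) (𝓝 0) (𝓝 0) := by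
    have := (graphL n).continuous.tendsto 0
    rw [map_zero] at this
    exact this
  have h1 : ∀ᶠ w in 𝓝 (0 : Cn n), AnalyticAt ℂ Ψ (w, cbar w) :=
    hc.eventually hΨ.eventually_analyticAt
  have h2 : ∀ᶠ w in 𝓝 (0 : Cn n), ∀ j, wirtingerBar j (fun v => (φ v : ℂ)) w =
      fderiv ℂ Ψ (w, cbar w) (0, e j) := by
    filter_upwards [h1, hφ.eventually_nhds] with w hw hw2 j
    rw [← wirtingerBar_graph hw.differentiableAt]
    exact wirtingerBar_congr (hw2.mono fun v hv => hv.symm) j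
  filter_upwards [h1, h2.eventually_nhds] with w hw hw2
  ext i j
  have h3 : AnalyticAt ℂ (fun p => fderiv ℂ Ψ p (0, e j)) (w, cbar w) :=
    ((ContinuousLinearMap.apply ℂ ℂ ((0, e j) : Cn n × Cn n)).analyticAt _).comp hw.fderiv
  have h4 : IsSymmSndFDerivAt ℂ Ψ (w, cbar w) :=
    (hw.contDiffAt (n := 2)).isSymmSndFDerivAt (by simp)
  simp only [complexHessian, Matrix.of_apply]
  rw [wirtinger_congr (hw2.mono fun v hv => hv j) i, mixedHess_eq hw,
    wirtinger_graph h3.differentiableAt, fderiv_fderiv_apply hw, fderiv_fderiv_apply hw]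
  exact h4 _ _

lemma thetaJac_eq {ψ : Cn n → Cn n → ℂ} {q : Cn3 n} (h : DifferentiableAt ℂ (thetaMap ψ) q)
    (i j : Fin n) : thetaJac ψ q i j = fderiv ℂ (thetaMap ψ) q (0, 0, e j) i := by
  have h1 : HasFDerivAt (fun z : Cn n => ((q.1, q.2.1, z) : Cn3 n))
      ((0 : Cn n →L[ℂ] Cn n).prod ((0 : Cn n →L[ℂ] Cn n).prod (ContinuousLinearMap.id ℂ (Cn n))))
      q.2.2 :=
    (hasFDerivAt_const _ _).prodMk ((hasFDerivAt_const _ _).prodMk (hasFDerivAt_id _))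
  have h2 : HasFDerivAt (fun z => theta ψ q.1 q.2.1 z i)
      ((EuclideanSpace.proj i : Cn n →L[ℂ] ℂ).comp ((fderiv ℂ (thetaMap ψ) q).comp
        ((0 : Cn n →L[ℂ] Cn n).prod ((0 : Cn n →L[ℂ] Cn n).prod
          (ContinuousLinearMap.id ℂ (Cn n)))))) q.2.2 :=
    (EuclideanSpace.proj i : Cn n →L[ℂ] ℂ).hasFDerivAt.comp q.2.2
      (HasFDerivAt.comp (f := fun z : Cn n => ((q.1, q.2.1, z) : Cn3 n)) q.2.2 h.hasFDerivAt h1)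
  simp only [thetaJac, Matrix.of_apply, cd]
  rw [h2.fderiv]
  rfl

lemma analyticAt_thetaJac {ψ : Cn n → Cn n → ℂ} {q : Cn3 n} (h : AnalyticAt ℂ (thetaMap ψ) q)
    (i j : Fin n) : AnalyticAt ℂ (fun q => thetaJac ψ q i j) q := by
  have h1 : AnalyticAt ℂ (fun q => fderiv ℂ (thetaMap ψ) q (0, 0, e j) i) q :=
    (((EuclideanSpace.proj i : Cn n →L[ℂ] ℂ).comp
      (ContinuousLinearMap.apply ℂ (Cn n) ((0, 0, e j) : Cn3 n))).analyticAt _).comp h.fderiv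
  refine h1.congr ?_
  filter_upwards [h.eventually_analyticAt] with p hp
  exact (thetaJac_eq hp.differentiableAt i j).symm

lemma fderiv_thetaMap_z {ψ : Cn n → Cn n → ℂ} {q : Cn3 n}
    (h : DifferentiableAt ℂ (thetaMap ψ) q) (w : Cn n) (i : Fin n) :
    fderiv ℂ (thetaMap ψ) q (0, 0, w) i = ∑ j, thetaJac ψ q i j * w j := by
  have h4 : ((0, 0, w) : Cn3 n) = ∑ j, w j • ((0, 0, e j) : Cn3 n) := by
    have h5 := sum_smul_e w
    refine Prod.ext ?_ (Prod.ext ?_ ?_)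
    · simp [Prod.fst_sum]
    · simp [Prod.fst_sum, Prod.snd_sum]
    · simp only [Prod.snd_sum, Prod.smul_snd]
      exact h5.symm
  rw [h4, map_sum]
  simp only [map_smul, WithLp.ofLp_sum, Finset.sum_apply, PiLp.smul_apply, smul_eq_mul]
  exact Finset.sum_congr rfl fun j _ => by rw [thetaJac_eq h, mul_comm]

end Germ

/-- With `H = C* C` the form is `‖C w̄‖²`, and the injective `C` is bounded below in finite
dimension; `K` is the Lipschitz constant of its inverse. -/
lemma exists_coercive {H : Matrix (Fin n) (Fin n) ℂ} (hH : H.PosDef) :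
    ∃ l : ℝ, 0 < l ∧ ∀ w : Cn n, l * ‖w‖ ^ 2 ≤ (∑ j, w j * ∑ i, H j i * conj (w i)).re := by
  obtain ⟨C, hC⟩ := exists_conjTranspose_mul_self hH
  have hdet : C.det ≠ 0 := by
    intro h
    have h1 := hH.det_pos
    rw [hC, Matrix.det_mul, h, mul_zero] at h1
    exact h1.ne rfl
  have hker : LinearMap.ker (Matrix.toEuclideanLin C) = ⊥ := by
    rw [LinearMap.ker_eq_bot']
    intro m hm
    have h1 : C.mulVec (WithLp.ofLp m) = 0 := by
      have := congrArg WithLp.ofLp hm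
      simpa [Matrix.toLpLin_apply] using this
    have h2 := Matrix.eq_zero_of_mulVec_eq_zero hdet h1
    ext i
    exact congrFun h2 i
  obtain ⟨K, hK0, hK⟩ := (Matrix.toEuclideanLin C).exists_antilipschitzWith hker
  have hK0' : (0 : ℝ) < K := hK0
  refine ⟨(K : ℝ)⁻¹ ^ 2, by positivity, fun w => ?_⟩
  rw [hC, sum_form_eq, Complex.ofReal_re, ← mul_pow]
  refine pow_le_pow_left₀ (by positivity) ?_ 2
  rw [inv_mul_le_iff₀ hK0']
  have := hK.le_mul_dist (cbar w) 0
  simpa [dist_eq_norm] using this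

end PhaseProperties

/-! ### Existence of the phase and of the coordinates `(x, y, θ)`. -/

section PhaseExistence

variable {n : ℕ}

lemma analyticAt_coordMap {ψ : Cn n → Cn n → ℂ} {q : Cn3 n} (h : AnalyticAt ℂ (thetaMap ψ) q) :
    AnalyticAt ℂ (coordMap ψ) q := by
  have h1 : AnalyticAt ℂ (fun q : Cn3 n => q.2.1) q :=
    ((ContinuousLinearMap.fst ℂ (Cn n) (Cn n)).comp
      (ContinuousLinearMap.snd ℂ (Cn n) (Cn n × Cn n))).analyticAt q
  exact analyticAt_fst.prod (h1.prod h)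

/-- Local analytic inverse of the coordinate change. -/
lemma exists_coord_homeomorph {ψ : Cn n → Cn n → ℂ} (h : AnalyticAt ℂ (thetaMap ψ) 0)
    (hdet : (thetaJac ψ (0 : Cn3 n)).det ≠ 0) :
    ∃ f : OpenPartialHomeomorph (Cn3 n) (Cn3 n), (f : Cn3 n → Cn3 n) = coordMap ψ ∧
      (0 : Cn3 n) ∈ f.source ∧ AnalyticAt ℂ f.symm (f 0) := by
  set T := fderiv ℂ (thetaMap ψ) 0 with hT
  -- The derivative of the coordinate map is block triangular with identity blocks in `x` and `y`,
  -- so it is invertible as soon as `θ_z` is.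
  set D : Cn3 n →L[ℂ] Cn3 n := (ContinuousLinearMap.fst ℂ _ _).prod
    (((ContinuousLinearMap.fst ℂ _ _).comp (ContinuousLinearMap.snd ℂ _ _)).prod T) with hD
  have hinj : Function.Injective D := by
    refine (injective_iff_map_eq_zero D).2 ?_
    rintro ⟨x, y, z⟩ hq
    have hx : x = 0 := congrArg (fun q : Cn3 n => q.1) hq
    have hy : y = 0 := congrArg (fun q : Cn3 n => q.2.1) hq
    have hz : T (x, y, z) = 0 := congrArg (fun q : Cn3 n => q.2.2) hq
    subst hx hy
    have h1 : (thetaJac ψ (0 : Cn3 n)).mulVec (WithLp.ofLp z) = 0 := by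
      ext i
      have h2 := fderiv_thetaMap_z h.differentiableAt z i
      rw [← hT, hz] at h2
      exact h2.symm
    have h3 := Matrix.eq_zero_of_mulVec_eq_zero hdet h1
    have h4 : z = 0 := by
      ext i
      exact congrFun h3 i
    rw [h4]
    rfl
  let De : Cn3 n ≃L[ℂ] Cn3 n :=
    (LinearEquiv.ofInjectiveEndo D.toLinearMap hinj).toContinuousLinearEquiv
  have hDe : (De : Cn3 n →L[ℂ] Cn3 n) = D := by
    ext q <;> rfl
  have hstrict : HasStrictFDerivAt (coordMap ψ) (De : Cn3 n →L[ℂ] Cn3 n) 0 := by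
    rw [hDe]
    have h1 : HasStrictFDerivAt (fun q : Cn3 n => q.2.1)
        ((ContinuousLinearMap.fst ℂ _ _).comp (ContinuousLinearMap.snd ℂ (Cn n) (Cn n × Cn n))) 0 :=
      ((ContinuousLinearMap.fst ℂ (Cn n) (Cn n)).comp
        (ContinuousLinearMap.snd ℂ (Cn n) (Cn n × Cn n))).hasStrictFDerivAt
    exact hasStrictFDerivAt_fst.prodMk (h1.prodMk h.hasStrictFDerivAt)
  refine ⟨hstrict.toOpenPartialHomeomorph (coordMap ψ), rfl,
    hstrict.mem_toOpenPartialHomeomorph_source, ?_⟩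
  exact OpenPartialHomeomorph.analyticAt_symm' _ (i := De)
    hstrict.mem_toOpenPartialHomeomorph_source (analyticAt_coordMap h) hstrict.hasFDerivAt.fderiv

/-- Difference of the phase identity at `z` and at `x̄`. On `z = ȳ` both factors are small with `y -
x`, which shows that the diastasis vanishes to second order. -/
lemma diastasis_eq {ψ : Cn n → Cn n → ℂ} {x y z : Cn n}
    (h1 : ψ x z - ψ y z = ∑ i, (x i - y i) * thetaMap ψ (x, y, z) i)
    (h2 : ψ x (cbar x) - ψ y (cbar x) = ∑ i, (x i - y i) * thetaMap ψ (x, y, cbar x) i) :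
    diastasis ψ x (y, z) =
      ∑ i, (y i - x i) * (thetaMap ψ (x, y, z) i - thetaMap ψ (x, y, cbar x) i) := by
  have h3 : diastasis ψ x (y, z) = -(ψ x z - ψ y z) + (ψ x (cbar x) - ψ y (cbar x)) := by
    simp only [diastasis]; ring
  rw [h3, h1, h2, ← Finset.sum_neg_distrib, ← Finset.sum_add_distrib]
  exact Finset.sum_congr rfl fun i _ => by ring

/-- Quadratic lower bound for the diastasis. -/
lemma exists_diastasis_lower {Ψ : Cn n × Cn n → ℂ} (hΨ : AnalyticAt ℂ Ψ 0)
    (hpos : (mixedHess (curry2 Ψ) 0 0).PosDef) :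
    ∃ δ : ℝ, 0 < δ ∧ ∀ᶠ p in 𝓝 (0 : Cn n × Cn n),
      δ * ‖p.2 - p.1‖ ^ 2 ≤ (diastasis (curry2 Ψ) p.1 (p.2, cbar p.2)).re := by
  obtain ⟨l, hl, hcoer⟩ := exists_coercive hpos
  have han := analyticAt_thetaMap hΨ
  have hstrict := han.hasStrictFDerivAt
  -- Strict differentiability at the origin compares `(x, y, ȳ)` with `(x, y, x̄)` uniformly near
  -- it. An error of at most `(l/2)|y - x|` costs half of the coercivity constant, whence `δ = l/2`.
  have h1 := hstrict.isLittleO.def (half_pos hl)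
  have h0 : thetaJac (curry2 Ψ) (0 : Cn3 n) = mixedHess (curry2 Ψ) 0 0 := thetaJac_diag _ 0 0
  set T := fderiv ℂ (thetaMap (curry2 Ψ)) 0 with hT
  have hc1 : Tendsto (fun p : Cn n × Cn n => ((p.1, p.2, cbar p.2) : Cn3 n)) (𝓝 0) (𝓝 0) := by
    have : Continuous fun p : Cn n × Cn n => ((p.1, p.2, cbar p.2) : Cn3 n) :=
      continuous_fst.prodMk (continuous_snd.prodMk (continuous_cbar.comp continuous_snd))
    have h := this.tendsto 0
    simp only [Prod.fst_zero, Prod.snd_zero, cbar_zero] at h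
    exact h
  have hc2 : Tendsto (fun p : Cn n × Cn n => ((p.1, p.2, cbar p.1) : Cn3 n)) (𝓝 0) (𝓝 0) := by
    have : Continuous fun p : Cn n × Cn n => ((p.1, p.2, cbar p.1) : Cn3 n) :=
      continuous_fst.prodMk (continuous_snd.prodMk (continuous_cbar.comp continuous_fst))
    have h := this.tendsto 0
    simp only [Prod.fst_zero, Prod.snd_zero, cbar_zero] at h
    exact h
  have hc3 : Tendsto (fun p : Cn n × Cn n =>
      (((p.1, p.2, cbar p.2), (p.1, p.2, cbar p.1)) : Cn3 n × Cn3 n)) (𝓝 0) (𝓝 (0, 0)) :=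
    hc1.prodMk_nhds hc2
  have hph := eventually_theta_phase hΨ
  refine ⟨l / 2, half_pos hl, ?_⟩
  filter_upwards [hc3.eventually h1, hc1.eventually hph, hc2.eventually hph] with p hp hq1 hq2
  obtain ⟨x, y⟩ := p
  simp only at hp hq1 hq2 ⊢
  rw [diastasis_eq hq1 hq2]
  set w : Cn n := y - x with hw
  set R : Cn n := thetaMap (curry2 Ψ) (x, y, cbar y) - thetaMap (curry2 Ψ) (x, y, cbar x) -
    T (0, 0, cbar w) with hR
  have hsub : ((x, y, cbar y) : Cn3 n) - (x, y, cbar x) = (0, 0, cbar w) := by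
    rw [hw, cbar_sub]; simp
  rw [hsub] at hp
  have hnorm : ‖((0, 0, cbar w) : Cn3 n)‖ = ‖w‖ := by
    simp [Prod.norm_def]
  rw [hnorm] at hp
  have hsum : ∑ i, (y i - x i) * (thetaMap (curry2 Ψ) (x, y, cbar y) i -
      thetaMap (curry2 Ψ) (x, y, cbar x) i) =
      (∑ j, w j * ∑ i, mixedHess (curry2 Ψ) 0 0 j i * conj (w i)) + ∑ j, w j * R j := by
    rw [← Finset.sum_add_distrib]
    refine Finset.sum_congr rfl fun j _ => ?_
    have h2 := fderiv_thetaMap_z han.differentiableAt (cbar w) j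
    rw [h0] at h2
    simp only [cbar_apply] at h2
    have h3 : R j = thetaMap (curry2 Ψ) (x, y, cbar y) j - thetaMap (curry2 Ψ) (x, y, cbar x) j -
      T (0, 0, cbar w) j := rfl
    have h4 : w j = y j - x j := rfl
    rw [← h2, h3, h4]
    ring
  have hRest : ‖∑ j, w j * R j‖ ≤ l / 2 * ‖w‖ ^ 2 := by
    have h3 : ∑ j, w j * R j = inner ℂ (cbar w) R := by
      rw [PiLp.inner_apply]
      refine Finset.sum_congr rfl fun j _ => ?_
      rw [RCLike.inner_apply, cbar_apply, Complex.conj_conj, mul_comm]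
    rw [h3]
    refine (norm_inner_le_norm _ _).trans ?_
    rw [norm_cbar]
    calc ‖w‖ * ‖R‖ ≤ ‖w‖ * (l / 2 * ‖w‖) := by gcongr
      _ = _ := by ring
  rw [hsum, Complex.add_re]
  have h5 := hcoer w
  have h6 := (Complex.abs_re_le_norm (∑ j, w j * R j)).trans hRest
  have h7 := neg_abs_le (∑ j, w j * R j).re
  linarith

/-- Existence of the phase, the coordinates `(x, y, θ)` and the basic estimates near the origin. -/
theorem exists_isPhase {φ : Cn n → ℝ} (hφ : AnalyticAt ℝ φ 0)
    (hpsh : ∀ᶠ w in 𝓝 (0 : Cn n), StrictlyPshAt φ w) :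
    ∃ (ψ : Cn n → Cn n → ℂ) (ζ : Cn n → Cn n → Cn n → Cn n) (r δ c₀ : ℝ),
      0 < r ∧ 0 < δ ∧ 0 < c₀ ∧ IsPhase φ ψ ζ r δ c₀ := by
  obtain ⟨Ψ, hΨ, hΨφ, hΨs⟩ := exists_polarization hφ
  have hhess := complexHessian_eq_mixedHess hΨ hΨφ
  have h00 : complexHessian φ 0 = mixedHess (curry2 Ψ) 0 0 := by
    have := hhess.self_of_nhds
    simpa using this
  have hpos0 : (mixedHess (curry2 Ψ) 0 0).PosDef := by
    rw [← h00]; exact hpsh.self_of_nhds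
  have han := analyticAt_thetaMap hΨ
  have h0 : thetaJac (curry2 Ψ) (0 : Cn3 n) = mixedHess (curry2 Ψ) 0 0 := thetaJac_diag _ 0 0
  have hdet0 : (thetaJac (curry2 Ψ) (0 : Cn3 n)).det ≠ 0 := by
    rw [h0]; exact hpos0.det_pos.ne'
  obtain ⟨f, hfc, hf0, hfs⟩ := exists_coord_homeomorph han hdet0
  obtain ⟨δ, hδ, hlow⟩ := exists_diastasis_lower hΨ hpos0
  have hcg : Tendsto (fun w : Cn n => (w, cbar w)) (𝓝 0) (𝓝 0) := by
    have := (graphL n).continuous.tendsto 0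
    rw [map_zero] at this
    exact this
  -- Half the volume density at the origin, hence a lower bound for the density nearby by
  -- continuity.
  set c₀ : ℝ := (mixedHess (curry2 Ψ) 0 0).det.re / 2 with hc₀
  have hdetpos : 0 < (mixedHess (curry2 Ψ) 0 0).det.re := (Complex.pos_iff.1 hpos0.det_pos).1
  have hvol : ∀ᶠ w in 𝓝 (0 : Cn n), c₀ ≤ (mixedHess (curry2 Ψ) w (cbar w)).det.re := by
    have h1 : ContinuousAt (fun p : Cn n × Cn n => (mixedHess (curry2 Ψ) p.1 p.2).det.re) 0 :=
      Complex.continuous_re.continuousAt.comp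
        (analyticAt_det (analyticAt_mixedHess hΨ)).continuousAt
    have h2 := (h1.tendsto.comp hcg).eventually (lt_mem_nhds (half_lt_self hdetpos))
    exact h2.mono fun w hw => le_of_lt hw
  have e2 : ∀ᶠ p in 𝓝 (0 : Cn n × Cn n), AnalyticAt ℂ Ψ p ∧ conj (Ψ p) = Ψ (cbar p.2, cbar p.1) ∧
      δ * ‖p.2 - p.1‖ ^ 2 ≤ (diastasis (curry2 Ψ) p.1 (p.2, cbar p.2)).re :=
    hΨ.eventually_analyticAt.and (hΨs.and hlow)
  have e1 : ∀ᶠ w in 𝓝 (0 : Cn n), Ψ (w, cbar w) = φ w ∧ StrictlyPshAt φ w ∧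
      complexHessian φ w = mixedHess (curry2 Ψ) w (cbar w) ∧
      c₀ ≤ (mixedHess (curry2 Ψ) w (cbar w)).det.re := hΨφ.and (hpsh.and (hhess.and hvol))
  have e3 : ∀ᶠ q in 𝓝 (0 : Cn3 n), AnalyticAt ℂ (thetaMap (curry2 Ψ)) q ∧
      (curry2 Ψ q.1 q.2.2 - curry2 Ψ q.2.1 q.2.2 =
        ∑ i, (q.1 i - q.2.1 i) * thetaMap (curry2 Ψ) q i) ∧
      (thetaJac (curry2 Ψ) q).det ≠ 0 ∧ q ∈ f.source ∧ AnalyticAt ℂ f.symm (f q) := by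
    refine han.eventually_analyticAt.and ((eventually_theta_phase hΨ).and (Eventually.and ?_
      (Eventually.and (f.open_source.mem_nhds hf0) ?_)))
    · exact (analyticAt_det (analyticAt_thetaJac han)).continuousAt.eventually_ne hdet0
    · exact (f.continuousAt hf0).eventually hfs.eventually_analyticAt
  obtain ⟨r2, hr2, h2⟩ := Metric.eventually_nhds_iff_ball.1 e2
  obtain ⟨r1, hr1, h1⟩ := Metric.eventually_nhds_iff_ball.1 e1
  obtain ⟨r3, hr3, h3⟩ := Metric.eventually_nhds_iff_ball.1 e3
  set r : ℝ := min r1 (min r2 r3) with hr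
  have hb1 : ∀ x ∈ ball (0 : Cn n) r, x ∈ ball (0 : Cn n) r1 := fun x hx =>
    ball_subset_ball (min_le_left _ _) hx
  have hb2 : ∀ x ∈ ball (0 : Cn n) r, ∀ z ∈ ball (0 : Cn n) r,
      (x, z) ∈ ball (0 : Cn n × Cn n) r2 := by
    intro x hx z hz
    have h : r ≤ r2 := (min_le_right _ _).trans (min_le_left _ _)
    have := ball_prod_same (0 : Cn n) (0 : Cn n) r2
    rw [show (0 : Cn n × Cn n) = (0, 0) from rfl, ← this]
    exact ⟨ball_subset_ball h hx, ball_subset_ball h hz⟩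
  have hb3 : ∀ q ∈ tripleBall n r, q ∈ ball (0 : Cn3 n) r3 := by
    intro q hq
    have h : r ≤ r3 := (min_le_right _ _).trans (min_le_right _ _)
    rw [show (0 : Cn3 n) = (0, (0, 0)) from rfl, ← ball_prod_same, ← ball_prod_same]
    exact ⟨ball_subset_ball h hq.1, ball_subset_ball h hq.2.1, ball_subset_ball h hq.2.2⟩
  have hsrc : tripleBall n r ⊆ f.source := fun q hq => (h3 q (hb3 q hq)).2.2.2.1
  have hopen : IsOpen (tripleBall n r) := isOpen_ball.prod (isOpen_ball.prod isOpen_ball)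
  -- The function `ζ` is the last component of the local inverse; `r` is the least of the three
  -- radii on which the one-, two- and three-variable conditions hold.
  refine ⟨curry2 Ψ, fun x y ϑ => (f.symm (x, y, ϑ)).2.2, r, δ, c₀,
    lt_min hr1 (lt_min hr2 hr3), hδ, half_pos hdetpos, ?_⟩
  refine ⟨⟨fun p hp => (h2 p (hb2 _ hp.1 _ hp.2)).1, fun x hx => (h1 x (hb1 x hx)).1⟩,
    fun x hx z hz => (h2 _ (hb2 x hx z hz)).2.1, ⟨?_, ?_, ?_, ?_⟩,
    fun q hq => (h3 q (hb3 q hq)).1, fun q hq => (h3 q (hb3 q hq)).2.1,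
    fun q hq => (h3 q (hb3 q hq)).2.2.1, fun x hx y hy => (h2 _ (hb2 x hx y hy)).2.2, ?_, ?_, ?_⟩
  · exact fun q hq => analyticAt_coordMap (h3 q (hb3 q hq)).1
  · rw [← hfc]
    exact f.isOpen_image_of_subset_source hopen hsrc
  · rintro _ ⟨q, hq, rfl⟩
    have h4 := (h3 q (hb3 q hq)).2.2.2.2
    rw [hfc] at h4
    exact ((ContinuousLinearMap.snd ℂ (Cn n) (Cn n)).comp
      (ContinuousLinearMap.snd ℂ (Cn n) (Cn n × Cn n))).analyticAt _ |>.comp h4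
  · intro q hq
    have h4 := f.left_inv (hsrc hq)
    rw [hfc] at h4
    exact congrArg (fun q : Cn3 n => q.2.2) h4
  · intro x hx
    have h4 := h1 x (hb1 x hx)
    rw [← h4.2.2.1]
    exact h4.2.1
  · intro x hx
    have h4 := h1 x (hb1 x hx)
    rw [← h4.2.2.1, volDensity]
    have h5 := Complex.pos_iff.1 (Matrix.PosDef.det_pos h4.2.1)
    exact Complex.ext (by simp) (by simp [← h5.2])
  · intro x hx
    have h4 := h1 x (hb1 x hx)
    rw [volDensity, h4.2.2.1]
    exact h4.2.2.2

end PhaseExistence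

/-! ### The coefficients `b_m`: existence and uniqueness. -/

section AmplitudeCoefficients

variable {n : ℕ}

/-- The function of a triple `(x, y, θ)` with curried form `F`. -/
def uncurry3 (F : Cn n → Cn n → Cn n → ℂ) (q : Cn3 n) : ℂ := F q.1 q.2.1 q.2.2

lemma cd_pY {f : Cn3 n → ℂ} {x y ϑ : Cn n} (h : DifferentiableAt ℂ f (x, y, ϑ)) (i : Fin n) :
    cd i (fun y' => f (x, y', ϑ)) y = pY i f (x, y, ϑ) := by
  have h1 : HasFDerivAt (fun w : Cn n => ((x, w, ϑ) : Cn3 n))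
      ((0 : Cn n →L[ℂ] Cn n).prod ((ContinuousLinearMap.id ℂ (Cn n)).prod 0)) y :=
    (hasFDerivAt_const _ _).prodMk ((hasFDerivAt_id y).prodMk (hasFDerivAt_const _ _))
  have h2 : HasFDerivAt (fun w => f (x, w, ϑ)) _ y := h.hasFDerivAt.comp y h1
  rw [cd, h2.fderiv]
  rfl

lemma cd_pT {f : Cn3 n → ℂ} {x y ϑ : Cn n} (h : DifferentiableAt ℂ f (x, y, ϑ)) (i : Fin n) :
    cd i (fun ϑ' => f (x, y, ϑ')) ϑ = pT i f (x, y, ϑ) := by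
  have h1 : HasFDerivAt (fun w : Cn n => ((x, y, w) : Cn3 n))
      ((0 : Cn n →L[ℂ] Cn n).prod ((0 : Cn n →L[ℂ] Cn n).prod
        (ContinuousLinearMap.id ℂ (Cn n)))) ϑ :=
    (hasFDerivAt_const _ _).prodMk ((hasFDerivAt_const _ _).prodMk (hasFDerivAt_id ϑ))
  have h2 : HasFDerivAt (fun w => f (x, y, w)) _ ϑ := h.hasFDerivAt.comp ϑ h1
  rw [cd, h2.fderiv]
  rfl

lemma cd_congr {f g : Cn n → ℂ} {w : Cn n} (h : f =ᶠ[𝓝 w] g) (i : Fin n) :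
    cd i f w = cd i g w := by
  simp only [cd, h.fderiv_eq]

/-- Stated for germs rather than values, because the operator is iterated and each application
differentiates again. -/
lemma uncurry3_DthetaDy {F : Cn n → Cn n → Cn n → ℂ} {f : Cn3 n → ℂ} {p : Cn3 n}
    (hF : uncurry3 F =ᶠ[𝓝 p] f) (hf : AnalyticAt ℂ f p) :
    uncurry3 (DthetaDy F) =ᶠ[𝓝 p] LL f := by
  filter_upwards [hF.eventually_nhds, hf.eventually_analyticAt] with q hq hfq
  obtain ⟨x, y, ϑ⟩ := q
  simp only [uncurry3, DthetaDy, LL]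
  refine Finset.sum_congr rfl fun i _ => ?_
  rw [← cd_pT (analyticAt_pY hfq i).differentiableAt]
  refine cd_congr ?_ i
  have hc : ContinuousAt (fun w : Cn n => ((x, y, w) : Cn3 n)) ϑ := by fun_prop
  filter_upwards [hc.eventually hq.eventually_nhds, hc.eventually hfq.eventually_analyticAt]
    with w hw hfw
  rw [← cd_pY hfw.differentiableAt]
  refine cd_congr ?_ i
  have hc2 : ContinuousAt (fun y' : Cn n => ((x, y', w) : Cn3 n)) y := by fun_prop
  exact (hc2.eventually hw)

lemma uncurry3_iterate_DthetaDy {F : Cn n → Cn n → Cn n → ℂ} {f : Cn3 n → ℂ} {p : Cn3 n}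
    (hF : uncurry3 F =ᶠ[𝓝 p] f) (hf : AnalyticAt ℂ f p) (l : ℕ) :
    uncurry3 (DthetaDy^[l] F) =ᶠ[𝓝 p] LL^[l] f := by
  induction l with
  | zero => exact hF
  | succ l ih =>
    simp only [Function.iterate_succ_apply']
    exact uncurry3_DthetaDy ih (analyticAt_iterate_LL hf l)

lemma iterate_DthetaDy_apply {F : Cn n → Cn n → Cn n → ℂ} {f : Cn3 n → ℂ} {x y ϑ : Cn n}
    (hF : uncurry3 F =ᶠ[𝓝 (x, y, ϑ)] f) (hf : AnalyticAt ℂ f (x, y, ϑ)) (l : ℕ) :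
    (DthetaDy^[l] F) x y ϑ = (LL^[l] f) (x, y, ϑ) :=
  (uncurry3_iterate_DthetaDy hF hf l).self_of_nhds

/-- The amplitude `c(x, z(x, y, θ)) Δ₀(x, y, θ)`. -/
def amplitude (ψ : Cn n → Cn n → ℂ) (ζ : Cn n → Cn n → Cn n → Cn n) (c : Cn n → Cn n → ℂ)
    (x y ϑ : Cn n) : ℂ := c x (ζ x y ϑ) * Delta0 ψ ζ x y ϑ

lemma Delta0_eq (ψ : Cn n → Cn n → ℂ) (ζ : Cn n → Cn n → Cn n → Cn n) (x y ϑ : Cn n) :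
    Delta0 ψ ζ x y ϑ =
      (mixedHess ψ y (ζ x y ϑ)).det / (thetaJac ψ (x, y, ζ x y ϑ)).det := rfl

lemma analyticAt_det_mixedHess {ψ : Cn n → Cn n → ℂ} {p : Cn n × Cn n}
    (h : AnalyticAt ℂ (fun p : Cn n × Cn n => ψ p.1 p.2) p) :
    AnalyticAt ℂ (fun p : Cn n × Cn n => (mixedHess ψ p.1 p.2).det) p :=
  analyticAt_det fun i j => analyticAt_mixedHess (Ψ := fun p => ψ p.1 p.2) h i j

section Phase

variable {φ : Cn n → ℝ} {ψ : Cn n → Cn n → ℂ} {ζ : Cn n → Cn n → Cn n → Cn n} {r δ c₀ : ℝ}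

lemma IsPhase.ζ_theta (h : IsPhase φ ψ ζ r δ c₀) {x y z : Cn n} (hx : x ∈ ball (0 : Cn n) r)
    (hy : y ∈ ball (0 : Cn n) r) (hz : z ∈ ball (0 : Cn n) r) : ζ x y (theta ψ x y z) = z :=
  h.coordInverse.2.2.2 (x, y, z) ⟨hx, hy, hz⟩

lemma IsPhase.analyticAt_amplitude (h : IsPhase φ ψ ζ r δ c₀) {c : Cn n → Cn n → ℂ}
    (hc : AnalyticOnNhd ℂ (fun p : Cn n × Cn n => c p.1 p.2) (ball 0 r ×ˢ ball 0 r))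
    {x y z : Cn n} (hx : x ∈ ball (0 : Cn n) r)
    (hy : y ∈ ball (0 : Cn n) r) (hz : z ∈ ball (0 : Cn n) r) :
    AnalyticAt ℂ (uncurry3 (amplitude ψ ζ c)) (x, y, theta ψ x y z) := by
  have hζ : AnalyticAt ℂ (fun q : Cn3 n => ζ q.1 q.2.1 q.2.2) (x, y, theta ψ x y z) :=
    h.coordInverse.2.2.1 _ ⟨(x, y, z), ⟨hx, hy, hz⟩, rfl⟩
  have hz' := h.ζ_theta hx hy hz
  have h1 : AnalyticAt ℂ (fun q : Cn3 n => q.2.1) (x, y, theta ψ x y z) :=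
    ((ContinuousLinearMap.fst ℂ (Cn n) (Cn n)).comp
      (ContinuousLinearMap.snd ℂ (Cn n) (Cn n × Cn n))).analyticAt _
  have hxz : AnalyticAt ℂ (fun q : Cn3 n => (q.1, ζ q.1 q.2.1 q.2.2)) (x, y, theta ψ x y z) :=
    analyticAt_fst.prod hζ
  have hyz : AnalyticAt ℂ (fun q : Cn3 n => (q.2.1, ζ q.1 q.2.1 q.2.2)) (x, y, theta ψ x y z) :=
    h1.prod hζ
  have hxyz : AnalyticAt ℂ (fun q : Cn3 n => ((q.1, q.2.1, ζ q.1 q.2.1 q.2.2) : Cn3 n))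
      (x, y, theta ψ x y z) := analyticAt_fst.prod (h1.prod hζ)
  have e1 : AnalyticAt ℂ (fun q : Cn3 n => c q.1 (ζ q.1 q.2.1 q.2.2)) (x, y, theta ψ x y z) :=
    AnalyticAt.fun_comp_of_eq (hc (x, z) ⟨hx, hz⟩) hxz (by simp only [hz'])
  have e2 : AnalyticAt ℂ (fun q : Cn3 n => (mixedHess ψ q.2.1 (ζ q.1 q.2.1 q.2.2)).det)
      (x, y, theta ψ x y z) :=
    AnalyticAt.fun_comp_of_eq (g := fun p : Cn n × Cn n => (mixedHess ψ p.1 p.2).det)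
      (analyticAt_det_mixedHess (h.polarization.1 (y, z) ⟨hy, hz⟩)) hyz
      (by simp only [hz'])
  have e3 : AnalyticAt ℂ
      (fun q : Cn3 n => (thetaJac ψ (q.1, q.2.1, ζ q.1 q.2.1 q.2.2)).det)
      (x, y, theta ψ x y z) :=
    AnalyticAt.fun_comp_of_eq (g := fun q => (thetaJac ψ q).det) (y := (x, y, z))
      (analyticAt_det (analyticAt_thetaJac (h.theta_analytic (x, y, z) ⟨hx, hy, hz⟩))) hxyz
      (by simp only [hz'])
  refine e1.mul (e2.div e3 ?_)
  simp only [hz']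
  exact h.det_ne_zero (x, y, z) ⟨hx, hy, hz⟩

lemma IsPhase.amplitude_diag (h : IsPhase φ ψ ζ r δ c₀) (c : Cn n → Cn n → ℂ)
    {x z : Cn n} (hx : x ∈ ball (0 : Cn n) r) (hz : z ∈ ball (0 : Cn n) r) :
    amplitude ψ ζ c x x (theta ψ x x z) = c x z := by
  rw [amplitude, Delta0_eq, h.ζ_theta hx hx hz, ← thetaJac_diag,
    div_self (h.det_ne_zero (x, x, z) ⟨hx, hx, hz⟩), mul_one]

/-- The image of the coordinate map is open, so agreement of the coefficients on the balls gives
agreement of the amplitudes as germs. -/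
lemma IsPhase.uncurry3_amplitude_congr (h : IsPhase φ ψ ζ r δ c₀) {c c' : Cn n → Cn n → ℂ}
    (hcc : ∀ x ∈ ball (0 : Cn n) r, ∀ z ∈ ball (0 : Cn n) r, c x z = c' x z)
    {x y z : Cn n} (hx : x ∈ ball (0 : Cn n) r)
    (hy : y ∈ ball (0 : Cn n) r) (hz : z ∈ ball (0 : Cn n) r) :
    uncurry3 (amplitude ψ ζ c) =ᶠ[𝓝 (x, y, theta ψ x y z)] uncurry3 (amplitude ψ ζ c') := by
  have hmem : coordMap ψ '' tripleBall n r ∈ 𝓝 ((x, y, theta ψ x y z) : Cn3 n) :=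
    h.coordInverse.2.1.mem_nhds ⟨(x, y, z), ⟨hx, hy, hz⟩, rfl⟩
  filter_upwards [hmem]
  rintro _ ⟨⟨x', y', z'⟩, ⟨hx', hy', hz'⟩, rfl⟩
  simp only [uncurry3, coordMap, amplitude, h.ζ_theta hx' hy' hz', hcc x' hx' z' hz']

/-- The amplitude coefficients `b_m`, by recursion on `m`. -/
def bcoef (ψ : Cn n → Cn n → ℂ) (ζ : Cn n → Cn n → Cn n → Cn n) (m : ℕ) (x z : Cn n) : ℂ :=
  (if m = 0 then 1 else 0) - ∑ l : Fin m, ((l + 1 : ℕ).factorial : ℂ)⁻¹ *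
    (DthetaDy^[l + 1] (amplitude ψ ζ (bcoef ψ ζ (m - (l + 1))))) x x (theta ψ x x z)
termination_by m
decreasing_by omega

/-- Isolates `l = 0`, the only term involving the index `m` itself. By `IsPhase.amplitude_diag` that
term is `b_m(x, z)` on the diagonal, so the `m`-th equation solves for `b_m` in terms of earlier
coefficients. -/
lemma SCoeff_eq (a : ℕ → Cn n → Cn n → Cn n → ℂ) (m : ℕ) (x y ϑ : Cn n) :
    SCoeff a m x y ϑ = (∑ l ∈ Finset.range m, ((l + 1 : ℕ).factorial : ℂ)⁻¹ *
      (DthetaDy^[l + 1] (a (m - (l + 1)))) x y ϑ) + a m x y ϑ := by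
  rw [SCoeff, Finset.sum_range_succ']
  simp

lemma bcoef_eq (ψ : Cn n → Cn n → ℂ) (ζ : Cn n → Cn n → Cn n → Cn n) (m : ℕ) (x z : Cn n) :
    bcoef ψ ζ m x z = (if m = 0 then 1 else 0) -
      ∑ l ∈ Finset.range m, ((l + 1 : ℕ).factorial : ℂ)⁻¹ *
        (DthetaDy^[l + 1] (amplitude ψ ζ (bcoef ψ ζ (m - (l + 1))))) x x (theta ψ x x z) := by
  rw [bcoef, Finset.sum_range (fun l => ((l + 1 : ℕ).factorial : ℂ)⁻¹ *
        (DthetaDy^[l + 1] (amplitude ψ ζ (bcoef ψ ζ (m - (l + 1))))) x x (theta ψ x x z))]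

lemma IsPhase.isAnalyticFamily (h : IsPhase φ ψ ζ r δ c₀) : IsAnalyticFamily r (bcoef ψ ζ) := by
  intro m
  induction m using Nat.strong_induction_on with
  | _ m ih =>
  rintro ⟨x, z⟩ ⟨hx, hz⟩
  have hmap : AnalyticAt ℂ (fun p : Cn n × Cn n => ((p.1, p.1, theta ψ p.1 p.1 p.2) : Cn3 n))
      (x, z) := by
    have h1 : AnalyticAt ℂ (fun p : Cn n × Cn n => ((p.1, p.1, p.2) : Cn3 n)) (x, z) :=
      analyticAt_fst.prod (analyticAt_fst.prod analyticAt_snd)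
    exact AnalyticAt.fun_comp_of_eq (h.coordInverse.1 (x, x, z) ⟨hx, hx, hz⟩) h1 rfl
  have hsum : AnalyticAt ℂ (fun p : Cn n × Cn n => (if m = 0 then (1 : ℂ) else 0) -
      ∑ l ∈ Finset.range m, ((l + 1 : ℕ).factorial : ℂ)⁻¹ *
        (LL^[l + 1] (uncurry3 (amplitude ψ ζ (bcoef ψ ζ (m - (l + 1))))))
          (p.1, p.1, theta ψ p.1 p.1 p.2)) (x, z) := by
    refine analyticAt_const.sub (Finset.analyticAt_fun_sum _ fun l hl => analyticAt_const.mul ?_)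
    have hlm : m - (l + 1) < m := by have := Finset.mem_range.1 hl; omega
    have hL := analyticAt_iterate_LL (h.analyticAt_amplitude (ih _ hlm) hx hx hz) (l + 1)
    generalize LL^[l + 1] _ = G at hL ⊢
    exact AnalyticAt.fun_comp_of_eq hL hmap rfl
  refine hsum.congr ?_
  have hopen : ball (0 : Cn n) r ×ˢ ball (0 : Cn n) r ∈ 𝓝 (x, z) :=
    (isOpen_ball.prod isOpen_ball).mem_nhds ⟨hx, hz⟩
  filter_upwards [hopen]
  rintro ⟨x', z'⟩ ⟨hx', hz'⟩
  simp only
  rw [bcoef_eq]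
  congr 1
  refine Finset.sum_congr rfl fun l hl => ?_
  have hlm : m - (l + 1) < m := by have := Finset.mem_range.1 hl; omega
  rw [iterate_DthetaDy_apply (EventuallyEq.refl _ _)
    (h.analyticAt_amplitude (ih _ hlm) hx' hx' hz')]

lemma IsPhase.solvesAmplitude (h : IsPhase φ ψ ζ r δ c₀) : SolvesAmplitude ψ ζ r (bcoef ψ ζ) := by
  intro m x hx z hz
  have h1 : (fun j x y ϑ => bcoef ψ ζ j x (ζ x y ϑ) * Delta0 ψ ζ x y ϑ) =
    fun j => amplitude ψ ζ (bcoef ψ ζ j) := rfl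
  rw [h1, SCoeff_eq, h.amplitude_diag _ hx hz, bcoef_eq]
  ring

lemma IsPhase.solvesAmplitude_iff (h : IsPhase φ ψ ζ r δ c₀) {b : ℕ → Cn n → Cn n → ℂ}
    (hb : SolvesAmplitude ψ ζ r b) (m : ℕ) {x z : Cn n} (hx : x ∈ ball (0 : Cn n) r)
    (hz : z ∈ ball (0 : Cn n) r) :
    b m x z = (if m = 0 then 1 else 0) - ∑ l ∈ Finset.range m, ((l + 1 : ℕ).factorial : ℂ)⁻¹ *
        (DthetaDy^[l + 1] (amplitude ψ ζ (b (m - (l + 1))))) x x (theta ψ x x z) := by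
  have h2 := hb m x hx z hz
  have h1 : (fun j x y ϑ => b j x (ζ x y ϑ) * Delta0 ψ ζ x y ϑ) =
    fun j => amplitude ψ ζ (b j) := rfl
  rw [h1, SCoeff_eq, h.amplitude_diag _ hx hz] at h2
  rw [← h2]
  ring

/-- Strong induction: once the earlier coefficients agree on the balls, their amplitudes have equal
germs, hence equal derivatives, and both families satisfy the same formula for the `m`-th
coefficient. -/
lemma IsPhase.amplitude_unique (h : IsPhase φ ψ ζ r δ c₀) {b b' : ℕ → Cn n → Cn n → ℂ}
    (hb : IsAnalyticFamily r b) (hbs : SolvesAmplitude ψ ζ r b)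
    (hb's : SolvesAmplitude ψ ζ r b') (m : ℕ) :
    ∀ x ∈ ball (0 : Cn n) r, ∀ z ∈ ball (0 : Cn n) r, b' m x z = b m x z := by
  induction m using Nat.strong_induction_on with
  | _ m ih =>
  intro x hx z hz
  rw [h.solvesAmplitude_iff hbs m hx hz, h.solvesAmplitude_iff hb's m hx hz]
  congr 1
  refine Finset.sum_congr rfl fun l hl => ?_
  have hlm : m - (l + 1) < m := by have := Finset.mem_range.1 hl; omega
  have ha := h.analyticAt_amplitude (hb (m - (l + 1))) hx hx hz
  rw [iterate_DthetaDy_apply (h.uncurry3_amplitude_congr (ih _ hlm) hx hx hz) ha,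
    iterate_DthetaDy_apply (EventuallyEq.refl _ _) ha]

end Phase

end AmplitudeCoefficients

/-! ### The truncated amplitude modulo relations. -/

section AmplitudeExpansion

variable {n : ℕ} {φ : Cn n → ℝ} {ψ : Cn n → Cn n → ℂ} {ζ : Cn n → Cn n → Cn n → Cn n}
  {r δ c₀ : ℝ}

/-- Diagonal points near the base point lie in the open image of the coordinate map, so they have
the form `(x, x, θ(x, x, z))` and the amplitude equations apply to them. -/
lemma IsPhase.eventually_sum_iterate_LL (h : IsPhase φ ψ ζ r δ c₀) (hr : 0 < r)
    {b : ℕ → Cn n → Cn n → ℂ} (hb : IsAnalyticFamily r b) (hs : SolvesAmplitude ψ ζ r b) :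
    ∀ᶠ q in 𝓝 (coordMap ψ 0), ∀ m, ∑ l ∈ Finset.range (m + 1), (l.factorial : ℂ)⁻¹ *
      (LL^[l] (uncurry3 (amplitude ψ ζ (b (m - l))))) (diagL n q) = if m = 0 then 1 else 0 := by
  have h0 : (0 : Cn n) ∈ ball (0 : Cn n) r := mem_ball_self hr
  have hmem : coordMap ψ '' tripleBall n r ∈ 𝓝 (coordMap ψ 0) :=
    h.coordInverse.2.1.mem_nhds ⟨0, ⟨h0, h0, h0⟩, rfl⟩
  filter_upwards [eventually_diagL (p := coordMap ψ 0) rfl hmem] with q hq m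
  obtain ⟨⟨x, y, z⟩, ⟨hx, hy, hz⟩, hxyz⟩ := hq
  have e1 : x = q.1 := congrArg (fun q : Cn3 n => q.1) hxyz
  have e2 : y = q.1 := congrArg (fun q : Cn3 n => q.2.1) hxyz
  have e3 : theta ψ x y z = q.2.2 := congrArg (fun q : Cn3 n => q.2.2) hxyz
  have e4 : y = x := e2.trans e1.symm
  subst e4
  have hm := hs m y hx z hz
  rw [← hm, SCoeff]
  refine Finset.sum_congr rfl fun l _ => ?_
  have ha := h.analyticAt_amplitude (hb (m - l)) hx hx hz
  have h1 := iterate_DthetaDy_apply (EventuallyEq.refl _ _) ha l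
  rw [diagL_apply, ← e1, ← e3, ← h1]
  rfl

/-- The amplitude is `1 + O(k^{-(N+1)})` modulo the relations `∂_{θ_i} + k (x_i - y_i) ≡ 0`. -/
lemma IsPhase.exists_amplitude_expansion (h : IsPhase φ ψ ζ r δ c₀) (hr : 0 < r)
    {b : ℕ → Cn n → Cn n → ℂ} (hb : IsAnalyticFamily r b) (hs : SolvesAmplitude ψ ζ r b) (N : ℕ) :
    ∃ (R : Cn3 n → ℂ) (g : (Σ _ : ℕ, ℕ) → Fin n → Cn3 n → ℂ),
      AnalyticAt ℂ R (coordMap ψ 0) ∧ (∀ s i, AnalyticAt ℂ (g s i) (coordMap ψ 0)) ∧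
      ∀ᶠ q in 𝓝 (coordMap ψ 0), ∀ κ : ℂ, κ ≠ 0 →
        ∑ j ∈ Finset.range (N + 1), (κ ^ j)⁻¹ * uncurry3 (amplitude ψ ζ (b j)) q =
          1 + (κ ^ (N + 1))⁻¹ * R q +
          ∑ s ∈ (Finset.range (N + 1)).sigma (fun j => Finset.range (N + 1 - j)),
            (κ ^ (s.1 + s.2 + 1))⁻¹ *
              ∑ i, (pT i (g s i) q + κ * ((q.1 i - q.2.1 i) * g s i q)) := by
  have h0 : (0 : Cn n) ∈ ball (0 : Cn n) r := mem_ball_self hr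
  have hp : (coordMap ψ 0).2.1 = (coordMap ψ 0).1 := rfl
  have ha : ∀ j, AnalyticAt ℂ (uncurry3 (amplitude ψ ζ (b j))) (coordMap ψ 0) := fun j =>
    h.analyticAt_amplitude (hb j) h0 h0 h0
  -- Dividing the `j`-th amplitude to order `N + 1 - j` makes every remainder appear with the same
  -- power `κ^{-(N+1)}`.
  choose g hg hdiv using fun j => exists_amplitude_division hp (ha j) (N + 1 - j)
  refine ⟨fun q => ∑ j ∈ Finset.range (N + 1), (TT^[N + 1 - j] (uncurry3 (amplitude ψ ζ (b j)))) q,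
    fun s => g s.1 s.2, Finset.analyticAt_fun_sum _ fun j _ => analyticAt_iterate_TT hp (ha j) _,
    fun s i => hg s.1 s.2 i, ?_⟩
  have hdiv' : ∀ᶠ q in 𝓝 (coordMap ψ 0), ∀ j ∈ Finset.range (N + 1), _ :=
    (Finset.eventually_all _).2 fun j _ => hdiv j
  filter_upwards [hdiv', h.eventually_sum_iterate_LL hr hb hs] with q hq hsum κ hκ
  -- Grouped by `m = j + l ≤ N`, the coefficient of `κ^{-m}` is the left side of the `m`-th
  -- amplitude equation, so only `m = 0` survives.
  have hmain : ∑ j ∈ Finset.range (N + 1), (κ ^ j)⁻¹ * ∑ l ∈ Finset.range (N + 1 - j),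
      (κ ^ l)⁻¹ * ((l.factorial : ℂ)⁻¹ *
        (LL^[l] (uncurry3 (amplitude ψ ζ (b j)))) (diagL n q)) = 1 := by
    simp only [Finset.mul_sum]
    rw [← Finset.sum_range_diag_flip (N + 1) fun j l => (κ ^ j)⁻¹ * ((κ ^ l)⁻¹ *
      ((l.factorial : ℂ)⁻¹ * (LL^[l] (uncurry3 (amplitude ψ ζ (b j)))) (diagL n q)))]
    have hm : ∀ m ∈ Finset.range (N + 1), (∑ j ∈ Finset.range (m + 1), (κ ^ j)⁻¹ *
        ((κ ^ (m - j))⁻¹ * (((m - j).factorial : ℂ)⁻¹ *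
          (LL^[m - j] (uncurry3 (amplitude ψ ζ (b j)))) (diagL n q)))) =
        (κ ^ m)⁻¹ * if m = 0 then 1 else 0 := by
      intro m _
      rw [← hsum m, ← Finset.sum_flip, Finset.mul_sum]
      refine Finset.sum_congr rfl fun l hl => ?_
      have hlm : l ≤ m := Nat.lt_succ_iff.1 (Finset.mem_range.1 hl)
      rw [Nat.sub_sub_self hlm]
      have h3 : κ ^ m = κ ^ (m - l) * κ ^ l := by rw [← pow_add, Nat.sub_add_cancel hlm]
      rw [h3, mul_inv, mul_assoc]
    rw [Finset.sum_congr rfl hm]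
    simp
  rw [Finset.sum_sigma, Finset.mul_sum, ← hmain, ← Finset.sum_add_distrib,
    ← Finset.sum_add_distrib]
  refine Finset.sum_congr rfl fun j hj => ?_
  have hjN : j ≤ N + 1 := (Finset.mem_range.1 hj).le
  rw [hq j hj κ hκ, mul_add, mul_add]
  congr 1
  · congr 1
    rw [← mul_assoc, ← mul_inv, ← pow_add, Nat.add_sub_cancel' hjN]
  · rw [Finset.mul_sum]
    refine Finset.sum_congr rfl fun l _ => ?_
    rw [← mul_assoc, ← mul_inv, ← pow_add, add_assoc]

end AmplitudeExpansion

/-! ### Integrals with amplitude `1 + ε R` modulo relations. -/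

section AmplitudeIntegral

variable {n : ℕ}

lemma continuousOn_comp_graph {F : Type*} [TopologicalSpace F] {s : ℝ} {f : Cn n × Cn n → F}
    (hf : ContinuousOn f (ball 0 s ×ˢ ball 0 s)) :
    ContinuousOn (fun y => f (y, cbar y)) (ball 0 s) :=
  hf.comp (graphL n).continuous.continuousOn fun _ hy => graph_mem hy

/-- Reproducing property up to the error terms produced by an amplitude that is `1 + ε R` modulo
relations. -/
theorem norm_amplitude_integral_sub_le {s : ℝ} {χ : Cn n → ℝ} (hχ : ContDiff ℝ ∞ χ)
    (hsupp : tsupport χ ⊆ ball 0 s) {v : Cn n → ℂ} (hv : DifferentiableOn ℂ v (ball 0 s))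
    {Θ : Cn n × Cn n → Cn n} (hΘ : AnalyticOnNhd ℂ Θ (ball 0 s ×ˢ ball 0 s))
    (hdet : ∀ q ∈ ball (0 : Cn n) s ×ˢ ball (0 : Cn n) s, (jac Θ q).det ≠ 0)
    {P : Cn n × Cn n → ℂ} (hP : AnalyticOnNhd ℂ P (ball 0 s ×ˢ ball 0 s)) {x : Cn n}
    (hx : x ∈ ball (0 : Cn n) s) (hχx : χ x = 1)
    (hPΘ : ∀ q ∈ ball (0 : Cn n) s ×ˢ ball (0 : Cn n) s,
      P q = ∑ j, (q.1 j - x j) * (Θ q j - Θ (q.1, cbar x) j))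
    (hpos : (jac Θ (x, cbar x)).PosDef) {δ : ℝ} (hδ : 0 < δ)
    (hlow : ∀ y ∈ ball (0 : Cn n) s, δ * ‖y - x‖ ^ 2 ≤ (P (y, cbar y)).re)
    {S : Set (Cn n)} (hS : IsCompact S) (hSs : S ⊆ ball 0 s)
    (hχS : ∀ y, y ∉ S → ∃ a : ℝ, χ =ᶠ[𝓝 y] fun _ => a) {c : ℝ} (hc : 0 < c)
    (hcS : ∀ y ∈ S, c ≤ (P (y, cbar y)).re) {C : ℝ} (hC0 : 0 ≤ C)
    (hC : ∀ y ∈ S, ‖∑ i, (∑ j, (jac Θ (y, cbar y)).adjugate i j *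
      (Θ (y, cbar y) j - Θ (y, cbar x) j)) * wirtingerBar i (fun y => (χ y : ℂ)) y‖ ≤ C)
    {ι : Type*} {I : Finset ι} {g : ι → Fin n → Cn n × Cn n → ℂ}
    (hg : ∀ m j, AnalyticOnNhd ℂ (g m j) (ball 0 s ×ˢ ball 0 s)) {C' : ℝ}
    (hC' : ∀ m ∈ I, ∀ y ∈ S, ‖∑ i, (∑ j, (jac Θ (y, cbar y)).adjugate i j *
      g m j (y, cbar y)) * wirtingerBar i (fun y => (χ y : ℂ)) y‖ ≤ C')
    {R A : Cn n → ℂ} (hR : ContinuousOn R (ball 0 s)) {C'' : ℝ}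
    (hC'' : ∀ y ∈ tsupport χ, ‖R y * χ y‖ ≤ C'') {a : ι → ℂ} (ha : ∀ m ∈ I, ‖a m‖ ≤ 1) {ε : ℂ}
    {k : ℝ} (hk : 1 ≤ k)
    (hA : ∀ y ∈ ball (0 : Cn n) s, (jac Θ (y, cbar y)).det * A y =
      (jac Θ (y, cbar y)).det + ε * R y + ∑ m ∈ I, a m *
        (∑ i, ∑ j, (jac Θ (y, cbar y)).adjugate i j * fderiv ℂ (g m j) (y, cbar y) (0, e i)
          - (k : ℂ) * ((jac Θ (y, cbar y)).det * ∑ j, (y j - x j) * g m j (y, cbar y)))) :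
    ‖(k : ℂ) ^ n * (∫ y, v y * ((jac Θ (y, cbar y)).det * A y *
        Complex.exp (-((k : ℂ) * P (y, cbar y)))) * (χ y : ℂ)) - (Real.pi : ℂ) ^ n * v x‖ ≤
      (C * growthConst n c * (2 / c) + I.card * C') * (k ^ n *
        ∫ y in S, ‖v y‖ * Real.exp (-(k * (P (y, cbar y)).re))) +
      ‖ε‖ * C'' * (k ^ n * ∫ y in tsupport χ, ‖v y‖ * Real.exp (-(k * (P (y, cbar y)).re))) := by
  set W := ball (0 : Cn n) s ×ˢ ball (0 : Cn n) s with hW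
  have hk0 : (0 : ℝ) ≤ k := zero_le_one.trans hk
  set χc : Cn n → ℂ := fun y => (χ y : ℂ) with hχc
  have hχcc : Continuous χc := Complex.continuous_ofReal.comp hχ.continuous
  have hχcs' : tsupport χc ⊆ tsupport χ := by
    refine closure_mono fun y hy => ?_
    rw [Function.mem_support] at hy ⊢
    simpa [hχc] using hy
  have hχcs : tsupport χc ⊆ ball 0 s := hχcs'.trans hsupp
  have hχccpt : HasCompactSupport χc := Metric.isCompact_of_isClosed_isBounded
    (isClosed_tsupport _) (isBounded_ball.subset hχcs)
  have hχcpt : IsCompact (tsupport χ) := Metric.isCompact_of_isClosed_isBounded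
    (isClosed_tsupport _) (isBounded_ball.subset hsupp)
  set dJ : Cn n → ℂ := fun y => (jac Θ (y, cbar y)).det with hdJ
  set ex : Cn n → ℂ := fun y => Complex.exp (-((k : ℂ) * P (y, cbar y))) with hex
  set E : ι → Cn n → ℂ := fun m y =>
    ∑ i, ∑ j, (jac Θ (y, cbar y)).adjugate i j * fderiv ℂ (g m j) (y, cbar y) (0, e i)
      - (k : ℂ) * ((jac Θ (y, cbar y)).det * ∑ j, (y j - x j) * g m j (y, cbar y)) with hE
  have hdJc : ContinuousOn dJ (ball 0 s) := continuousOn_comp_graph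
    (f := fun q => (jac Θ q).det) fun q hq =>
      (analyticAt_det (analyticAt_jac (hΘ q hq))).continuousAt.continuousWithinAt
  have hPc : ContinuousOn (fun y => P (y, cbar y)) (ball 0 s) :=
    continuousOn_comp_graph hP.continuousOn
  have hexc : ContinuousOn ex (ball 0 s) := (continuousOn_const.mul hPc).neg.cexp
  have hEc : ∀ m, ContinuousOn (E m) (ball 0 s) := by
    intro m
    refine continuousOn_comp_graph (f := fun q : Cn n × Cn n =>
      ∑ i, ∑ j, (jac Θ q).adjugate i j * fderiv ℂ (g m j) q (0, e i)
      - (k : ℂ) * ((jac Θ q).det * ∑ j, (q.1 j - x j) * g m j q)) fun q hq => ?_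
    have h1 : ∀ i j, ContinuousAt (fun q => (jac Θ q).adjugate i j) q := fun i j =>
      (analyticAt_adjugate (analyticAt_jac (hΘ q hq)) i j).continuousAt
    have h2 : ∀ i j, ContinuousAt (fun q => fderiv ℂ (g m j) q (0, e i)) q := fun i j =>
      (hg m j q hq).fderiv.continuousAt.clm_apply continuousAt_const
    have h3 : ContinuousAt (fun q => (jac Θ q).det) q :=
      (analyticAt_det (analyticAt_jac (hΘ q hq))).continuousAt
    have h4 : ∀ j, ContinuousAt (g m j) q := fun j => (hg m j q hq).continuousAt
    have h5 : ContinuousAt (fun q : Cn n × Cn n =>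
        ∑ i, ∑ j, (jac Θ q).adjugate i j * fderiv ℂ (g m j) q (0, e i)) q :=
      tendsto_finsetSum _ fun i _ => tendsto_finsetSum _ fun j _ => (h1 i j).mul (h2 i j)
    have h6 : ContinuousAt (fun q : Cn n × Cn n => ∑ j, (q.1 j - x j) * g m j q) q := by
      refine tendsto_finsetSum _ fun j _ => ContinuousAt.mul ?_ (h4 j)
      fun_prop
    exact (h5.sub (continuousAt_const.mul (h3.mul h6))).continuousWithinAt
  have hi0 : Integrable (fun y => v y * (dJ y * ex y) * χc y) :=
    integrable_mul_tsupport hχcc hχccpt ((hv.continuousOn.mul (hdJc.mul hexc)).mono hχcs)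
  have hi1 : Integrable (fun y => v y * (R y * ex y) * χc y) :=
    integrable_mul_tsupport hχcc hχccpt ((hv.continuousOn.mul (hR.mul hexc)).mono hχcs)
  have hi2 : ∀ m, Integrable (fun y => v y * (E m y * ex y) * χc y) := fun m =>
    integrable_mul_tsupport hχcc hχccpt ((hv.continuousOn.mul ((hEc m).mul hexc)).mono hχcs)
  have hi3 : Integrable (fun y => v y * (dJ y * ex y) * χc y +
      ε * (v y * (R y * ex y) * χc y)) := hi0.add (hi1.const_mul ε)
  -- Leading term, remainder of size `ε`, and relations, each estimated separately.
  have hsplit : ∫ y, v y * (dJ y * A y * ex y) * χc y =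
      (∫ y, v y * (dJ y * ex y) * χc y) + ε * (∫ y, v y * (R y * ex y) * χc y) +
        ∑ m ∈ I, a m * ∫ y, v y * (E m y * ex y) * χc y := by
    simp only [← integral_const_mul]
    rw [← integral_finsetSum _ fun m _ => (hi2 m).const_mul (a m),
      ← integral_add hi0 (hi1.const_mul ε),
      ← integral_add hi3
        (integrable_finsetSum _ fun m _ => (hi2 m).const_mul (a m))]
    refine integral_congr_ae (Eventually.of_forall fun y => ?_)
    by_cases hy : y ∈ tsupport χ
    · have h1 : dJ y * A y = dJ y + ε * R y + ∑ m ∈ I, a m * E m y := hA y (hsupp hy)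
      have h2 : ∑ m ∈ I, a m * (v y * (E m y * ex y) * χc y) =
          v y * ((∑ m ∈ I, a m * E m y) * ex y) * χc y := by
        rw [Finset.sum_mul, Finset.mul_sum, Finset.sum_mul]
        exact Finset.sum_congr rfl fun m _ => by ring
      simp only [h1, h2]
      ring
    · have h0 : χ y = 0 := image_eq_zero_of_notMem_tsupport hy
      simp [hχc, h0]
  have hlead := norm_leading_term_sub_le hχ hsupp hv hΘ hdet hP hx hχx hPΘ hpos hδ hlow hS hSs
    hχS hc hcS hC0 hC hk
  have hintc : ContinuousOn (fun y => ‖v y‖ * Real.exp (-(k * (P (y, cbar y)).re))) (ball 0 s) :=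
    hv.continuousOn.norm.mul (Real.continuous_exp.comp_continuousOn
      (continuousOn_const.mul (Complex.continuous_re.comp_continuousOn hPc)).neg)
  have hrem : ‖∫ y, v y * (R y * ex y) * χc y‖ ≤
      C'' * ∫ y in tsupport χ, ‖v y‖ * Real.exp (-(k * (P (y, cbar y)).re)) := by
    have h1 : ∀ y, v y * (R y * ex y) * χc y = v y * (ex y * (R y * χc y)) := fun y => by ring
    simp only [h1]
    refine norm_integral_boundary_le (P := fun y => P (y, cbar y)) hχcpt.measurableSet
      (fun y hy => ?_) hC'' ((hintc.mono hsupp).integrableOn_compact hχcpt)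
    have h0 : χ y = 0 := image_eq_zero_of_notMem_tsupport hy
    simp [hχc, h0]
  -- A relation integrates to a term containing `∂̄χ`, which vanishes off `S` because `χ` is locally
  -- constant there.
  have hbd : ∀ m ∈ I, ‖∫ y, v y * (E m y * ex y) * χc y‖ ≤
      C' * ∫ y in S, ‖v y‖ * Real.exp (-(k * (P (y, cbar y)).re)) := by
    intro m hm
    have hrel := integral_relation hχ hsupp hv hΘ hdet hP (phase_relations hΘ hx hPΘ).2.2 (hg m)
      (k : ℂ)
    have h2 : (∫ y, v y * (E m y * ex y) * χc y) = _ := hrel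
    rw [h2, norm_neg]
    refine norm_integral_boundary_le (P := fun y => P (y, cbar y)) hS.measurableSet
      (fun y hy => ?_) (hC' m hm) ((hintc.mono hSs).integrableOn_compact hS)
    exact Finset.sum_eq_zero fun i _ => by rw [wirtingerBar_eq_zero (hχS y hy), mul_zero]
  set IS := ∫ y in S, ‖v y‖ * Real.exp (-(k * (P (y, cbar y)).re)) with hIS
  set IT := ∫ y in tsupport χ, ‖v y‖ * Real.exp (-(k * (P (y, cbar y)).re)) with hIT
  have hsum : ‖∑ m ∈ I, a m * ∫ y, v y * (E m y * ex y) * χc y‖ ≤ I.card * C' * IS := by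
    refine (norm_sum_le _ _).trans ?_
    rw [mul_assoc, ← nsmul_eq_mul]
    refine Finset.sum_le_card_nsmul _ _ _ fun m hm => ?_
    rw [norm_mul]
    calc _ ≤ 1 * ‖∫ y, v y * (E m y * ex y) * χc y‖ :=
          mul_le_mul_of_nonneg_right (ha m hm) (norm_nonneg _)
      _ ≤ _ := by rw [one_mul]; exact hbd m hm
  have hkn : ‖(k : ℂ) ^ n‖ = k ^ n := by
    rw [norm_pow, Complex.norm_real, Real.norm_of_nonneg hk0]
  have hfin : (k : ℂ) ^ n * (∫ y, v y * (dJ y * A y * ex y) * χc y) - (Real.pi : ℂ) ^ n * v x =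
      ((k : ℂ) ^ n * (∫ y, v y * (dJ y * ex y) * χc y) - (Real.pi : ℂ) ^ n * v x) +
      (k : ℂ) ^ n * (∑ m ∈ I, a m * ∫ y, v y * (E m y * ex y) * χc y) +
      (k : ℂ) ^ n * (ε * (∫ y, v y * (R y * ex y) * χc y)) := by
    rw [hsplit]; ring
  change ‖(k : ℂ) ^ n * (∫ y, v y * (dJ y * A y * ex y) * χc y) - (Real.pi : ℂ) ^ n * v x‖ ≤ _
  rw [hfin]
  refine (norm_add₃_le).trans ?_
  rw [norm_mul, norm_mul, norm_mul, hkn]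
  have e1 : k ^ n * ‖∑ m ∈ I, a m * ∫ y, v y * (E m y * ex y) * χc y‖ ≤
      k ^ n * (I.card * C' * IS) := by gcongr
  have e2 : k ^ n * (‖ε‖ * ‖∫ y, v y * (R y * ex y) * χc y‖) ≤ k ^ n * (‖ε‖ * (C'' * IT)) := by
    gcongr
  refine (add_le_add (add_le_add hlead e1) e2).trans (le_of_eq ?_)
  ring

end AmplitudeIntegral

/-! ### Uniformity of the constants in `x`. -/

section UniformBound

variable {n : ℕ}

lemma continuous_wirtingerBar {χ : Cn n → ℝ} (hχ : ContDiff ℝ ∞ χ) (i : Fin n) :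
    Continuous (wirtingerBar i fun y => (χ y : ℂ)) := by
  have h : ContDiff ℝ ∞ (fun y => (χ y : ℂ)) := Complex.ofRealCLM.contDiff.comp hχ
  have h1 : Continuous (fderiv ℝ fun y => (χ y : ℂ)) := h.continuous_fderiv (by simp)
  unfold wirtingerBar
  fun_prop

lemma tripleBall_mono {s r : ℝ} (h : s ≤ r) : tripleBall n s ⊆ tripleBall n r := fun _ hq =>
  ⟨ball_subset_ball h hq.1, ball_subset_ball h hq.2.1, ball_subset_ball h hq.2.2⟩

lemma continuous_triple_graph :
    Continuous fun p : Cn n × Cn n => ((p.1, p.2, cbar p.2) : Cn3 n) :=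
  continuous_fst.prodMk (continuous_snd.prodMk (continuous_cbar.comp continuous_snd))

/-- Uniform bounds on compact balls. -/
lemma exists_bound_on_balls {f : Cn n × Cn n → ℂ} {s a b : ℝ} (ha : a < s) (hb : b < s)
    (hf : ContinuousOn f (ball 0 s ×ˢ ball 0 s)) :
    ∃ C, 0 ≤ C ∧ ∀ x ∈ closedBall (0 : Cn n) a, ∀ y ∈ closedBall (0 : Cn n) b, ‖f (x, y)‖ ≤ C := by
  have hK : IsCompact (closedBall (0 : Cn n) a ×ˢ closedBall (0 : Cn n) b) :=
    (isCompact_closedBall 0 a).prod (isCompact_closedBall 0 b)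
  obtain ⟨C, hC⟩ := hK.exists_bound_of_continuousOn (hf.mono (Set.prod_mono
    (closedBall_subset_ball ha) (closedBall_subset_ball hb)))
  exact ⟨max C 0, le_max_right _ _, fun x hx y hy => (hC (x, y) ⟨hx, hy⟩).trans (le_max_left _ _)⟩

variable {φ : Cn n → ℝ} {ψ : Cn n → Cn n → ℂ} {ζ : Cn n → Cn n → Cn n → Cn n}
  {r δ c₀ : ℝ}

/-- The map `(y, z) ↦ θ(x, y, z)`. -/
def sliceTheta (ψ : Cn n → Cn n → ℂ) (x : Cn n) (q : Cn n × Cn n) : Cn n := thetaMap ψ (x, q)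

lemma hasFDerivAt_prodMk_right (x : Cn n) (q : Cn n × Cn n) :
    HasFDerivAt (fun q : Cn n × Cn n => ((x, q) : Cn3 n))
      ((0 : Cn n × Cn n →L[ℂ] Cn n).prod (ContinuousLinearMap.id ℂ (Cn n × Cn n))) q :=
  (hasFDerivAt_const x q).prodMk (hasFDerivAt_id q)

lemma IsPhase.analyticOnNhd_sliceTheta (h : IsPhase φ ψ ζ r δ c₀) {x : Cn n}
    (hx : x ∈ ball (0 : Cn n) r) :
    AnalyticOnNhd ℂ (sliceTheta ψ x) (ball 0 r ×ˢ ball 0 r) := fun q hq =>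
  AnalyticAt.fun_comp_of_eq (g := thetaMap ψ) (f := fun q => (x, q))
    (h.theta_analytic (x, q) ⟨hx, hq⟩) (analyticAt_const.prod analyticAt_id) rfl

lemma IsPhase.jac_sliceTheta (h : IsPhase φ ψ ζ r δ c₀) {x : Cn n} (hx : x ∈ ball (0 : Cn n) r)
    {q : Cn n × Cn n} (hq : q ∈ ball (0 : Cn n) r ×ˢ ball (0 : Cn n) r) :
    jac (sliceTheta ψ x) q = thetaJac ψ (x, q) := by
  have h1 := (h.theta_analytic (x, q) ⟨hx, hq⟩).differentiableAt
  have h2 : HasFDerivAt (sliceTheta ψ x) _ q :=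
    h1.hasFDerivAt.comp q (hasFDerivAt_prodMk_right x q)
  ext j i
  rw [thetaJac_eq h1, jac, Matrix.of_apply, h2.fderiv]
  rfl

lemma IsPhase.analyticOnNhd_diastasis (h : IsPhase φ ψ ζ r δ c₀) {x : Cn n}
    (hx : x ∈ ball (0 : Cn n) r) :
    AnalyticOnNhd ℂ (diastasis ψ x) (ball 0 r ×ˢ ball 0 r) := by
  intro q hq
  have hx' : cbar x ∈ ball (0 : Cn n) r := cbar_mem_ball.2 hx
  have h1 : AnalyticAt ℂ (fun q : Cn n × Cn n => ψ q.1 q.2) q := h.polarization.1 q hq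
  have h2 : AnalyticAt ℂ (fun q : Cn n × Cn n => ψ x q.2) q :=
    AnalyticAt.fun_comp_of_eq (g := fun p : Cn n × Cn n => ψ p.1 p.2)
      (f := fun q : Cn n × Cn n => (x, q.2)) (h.polarization.1 (x, q.2) ⟨hx, hq.2⟩)
      (analyticAt_const.prod analyticAt_snd) rfl
  have h3 : AnalyticAt ℂ (fun q : Cn n × Cn n => ψ q.1 (cbar x)) q :=
    AnalyticAt.fun_comp_of_eq (g := fun p : Cn n × Cn n => ψ p.1 p.2)
      (f := fun q : Cn n × Cn n => (q.1, cbar x)) (h.polarization.1 (q.1, cbar x) ⟨hq.1, hx'⟩)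
      (analyticAt_fst.prod analyticAt_const) rfl
  exact ((h1.add analyticAt_const).sub h2).sub h3

lemma IsPhase.diastasis_eq (h : IsPhase φ ψ ζ r δ c₀) {x : Cn n} (hx : x ∈ ball (0 : Cn n) r)
    {q : Cn n × Cn n} (hq : q ∈ ball (0 : Cn n) r ×ˢ ball (0 : Cn n) r) :
    diastasis ψ x q =
      ∑ j, (q.1 j - x j) * (sliceTheta ψ x q j - sliceTheta ψ x (q.1, cbar x) j) :=
  LocalBergman.diastasis_eq (h.theta_phase (x, q) ⟨hx, hq⟩)
    (h.theta_phase (x, q.1, cbar x) ⟨hx, hq.1, cbar_mem_ball.2 hx⟩)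

/-- Chain rule: for fixed `x`, moving `z` moves only the `θ`-component of the coordinate map. -/
lemma IsPhase.fderiv_comp_coordMap (h : IsPhase φ ψ ζ r δ c₀) {x : Cn n}
    (hx : x ∈ ball (0 : Cn n) r) {q : Cn n × Cn n}
    (hq : q ∈ ball (0 : Cn n) r ×ˢ ball (0 : Cn n) r) {G : Cn3 n → ℂ}
    (hG : AnalyticAt ℂ G (coordMap ψ (x, q))) (i : Fin n) :
    fderiv ℂ (fun q => G (coordMap ψ (x, q))) q (0, e i) =
      ∑ l, thetaJac ψ (x, q) l i * pT l G (coordMap ψ (x, q)) := by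
  have h1 := (h.theta_analytic (x, q) ⟨hx, hq⟩).differentiableAt
  have h2 : HasFDerivAt (sliceTheta ψ x) _ q :=
    h1.hasFDerivAt.comp q (hasFDerivAt_prodMk_right x q)
  have h3 : HasFDerivAt (fun q : Cn n × Cn n => coordMap ψ (x, q)) _ q :=
    (hasFDerivAt_const x q).prodMk (hasFDerivAt_fst.prodMk h2)
  have h4 : HasFDerivAt (fun q : Cn n × Cn n => G (coordMap ψ (x, q))) _ q :=
    hG.differentiableAt.hasFDerivAt.comp q h3
  rw [h4.fderiv]
  have h5 : ∀ w : Cn n, fderiv ℂ G (coordMap ψ (x, q)) (0, 0, w) =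
      ∑ l, w l * pT l G (coordMap ψ (x, q)) := by
    intro w
    have h6 : ((0, 0, w) : Cn3 n) = ∑ j, w j • ((0, 0, e j) : Cn3 n) := by
      have h7 := sum_smul_e w
      refine Prod.ext ?_ (Prod.ext ?_ ?_)
      · simp [Prod.fst_sum]
      · simp [Prod.fst_sum, Prod.snd_sum]
      · simp only [Prod.snd_sum, Prod.smul_snd]
        exact h7.symm
    rw [h6, map_sum]
    exact Finset.sum_congr rfl fun l _ => by rw [map_smul]; rfl
  refine (h5 (fderiv ℂ (thetaMap ψ) (x, q) (0, 0, e i))).trans ?_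
  exact Finset.sum_congr rfl fun l _ => by rw [thetaJac_eq h1]

/-- Since `adj(θ_z)` turns `∂_z` into `det(θ_z) ∂_θ`, the integrand of `integral_relation` is `det
θ_z` times the relation produced by the division. -/
lemma IsPhase.relation_eq (h : IsPhase φ ψ ζ r δ c₀) {x : Cn n}
    (hx : x ∈ ball (0 : Cn n) r) {q : Cn n × Cn n}
    (hq : q ∈ ball (0 : Cn n) r ×ˢ ball (0 : Cn n) r) {g : Fin n → Cn3 n → ℂ}
    (hg : ∀ i, AnalyticAt ℂ (g i) (coordMap ψ (x, q))) (k : ℂ) :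
    ∑ i, ∑ j, (thetaJac ψ (x, q)).adjugate i j *
        fderiv ℂ (fun q => g j (coordMap ψ (x, q))) q (0, e i)
      - k * ((thetaJac ψ (x, q)).det * ∑ j, (q.1 j - x j) * g j (coordMap ψ (x, q))) =
    (thetaJac ψ (x, q)).det * ∑ i, (pT i (g i) (coordMap ψ (x, q)) +
      k * ((x i - q.1 i) * g i (coordMap ψ (x, q)))) := by
  set J := thetaJac ψ (x, q) with hJ
  have h7 : ∀ l j, ∑ i, J l i * J.adjugate i j = if l = j then J.det else 0 := by
    intro l j
    have := congrFun (congrFun (Matrix.mul_adjugate J) l) j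
    rw [Matrix.mul_apply] at this
    rw [this]
    simp [Matrix.one_apply]
  have h1 : ∑ i, ∑ j, J.adjugate i j * fderiv ℂ (fun q => g j (coordMap ψ (x, q))) q (0, e i) =
      J.det * ∑ j, pT j (g j) (coordMap ψ (x, q)) := by
    calc _ = ∑ i, ∑ j, ∑ l, pT l (g j) (coordMap ψ (x, q)) * (J l i * J.adjugate i j) := by
          refine Finset.sum_congr rfl fun i _ => Finset.sum_congr rfl fun j _ => ?_
          rw [h.fderiv_comp_coordMap hx hq (hg j), Finset.mul_sum]
          exact Finset.sum_congr rfl fun l _ => by ring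
      _ = ∑ j, ∑ l, pT l (g j) (coordMap ψ (x, q)) * ∑ i, J l i * J.adjugate i j := by
          rw [Finset.sum_comm]
          refine Finset.sum_congr rfl fun j _ => ?_
          rw [Finset.sum_comm]
          exact Finset.sum_congr rfl fun l _ => by rw [Finset.mul_sum]
      _ = _ := by
          simp only [h7, mul_ite, mul_zero, Finset.sum_ite_eq', Finset.mem_univ, if_true,
            Finset.mul_sum]
          exact Finset.sum_congr rfl fun j _ => by ring
  rw [h1, Finset.sum_add_distrib, mul_add, sub_eq_add_neg]
  congr 1
  simp only [Finset.mul_sum]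
  rw [← Finset.sum_neg_distrib]
  exact Finset.sum_congr rfl fun i _ => by ring

/-- The reproducing property of an amplitude that is `1 + ε R` modulo relations, with constants
uniform in `x` near the origin. -/
theorem IsPhase.exists_reproducing_bound (h : IsPhase φ ψ ζ r δ c₀) (hδ : 0 < δ) {σ : ℝ}
    (hσ0 : 0 < σ) (hσ : σ ≤ r) {χ : Cn n → ℝ} (hχ : ContDiff ℝ ∞ χ)
    (hχ1 : ∀ y ∈ closedBall (0 : Cn n) (σ / 4), χ y = 1)
    (hχt : tsupport χ ⊆ closedBall 0 (σ / 2)) {ι : Type*} (I : Finset ι) {R : Cn3 n → ℂ}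
    {g : ι → Fin n → Cn3 n → ℂ} (hR : ∀ q ∈ tripleBall n σ, AnalyticAt ℂ R (coordMap ψ q))
    (hg : ∀ m i, ∀ q ∈ tripleBall n σ, AnalyticAt ℂ (g m i) (coordMap ψ q)) :
    ∃ C, 0 ≤ C ∧ ∀ x ∈ closedBall (0 : Cn n) (σ / 8), ∀ v : Cn n → ℂ,
      DifferentiableOn ℂ v (ball 0 σ) → ∀ (A : Cn n → ℂ) (a : ι → ℂ) (ε : ℂ) (k : ℝ), 1 ≤ k →
      (∀ m ∈ I, ‖a m‖ ≤ 1) →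
      (∀ y ∈ ball (0 : Cn n) σ, A y = 1 + ε * R (coordMap ψ (x, y, cbar y)) +
        ∑ m ∈ I, a m * ∑ i, (pT i (g m i) (coordMap ψ (x, y, cbar y)) +
          k * ((x i - y i) * g m i (coordMap ψ (x, y, cbar y))))) →
      ‖(k : ℂ) ^ n * (∫ y, v y * ((thetaJac ψ (x, y, cbar y)).det * A y *
          Complex.exp (-((k : ℂ) * diastasis ψ x (y, cbar y)))) * (χ y : ℂ)) -
          (Real.pi : ℂ) ^ n * v x‖ ≤
        C * (k ^ n * ∫ y in closedBall (0 : Cn n) (σ / 2) \ ball 0 (σ / 4),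
          ‖v y‖ * Real.exp (-(k * (diastasis ψ x (y, cbar y)).re))) +
        ‖ε‖ * C * (k ^ n * ∫ y in closedBall (0 : Cn n) (σ / 2),
          ‖v y‖ * Real.exp (-(k * (diastasis ψ x (y, cbar y)).re))) := by
  have h8 : σ / 8 < σ := by linarith
  have h2 : σ / 2 < σ := by linarith
  have hsubs : ball (0 : Cn n) σ ⊆ ball 0 r := ball_subset_ball hσ
  have hsub2 : ball (0 : Cn n) σ ×ˢ ball (0 : Cn n) σ ⊆ ball 0 r ×ˢ ball 0 r :=
    Set.prod_mono hsubs hsubs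
  have hsub3 := tripleBall_mono (n := n) hσ
  set S := closedBall (0 : Cn n) (σ / 2) \ ball 0 (σ / 4) with hS
  have hScpt : IsCompact S := (isCompact_closedBall _ _).diff isOpen_ball
  have hST : S ⊆ closedBall 0 (σ / 2) := Set.sdiff_subset
  have hmem : ∀ p ∈ ball (0 : Cn n) σ ×ˢ ball (0 : Cn n) σ,
      ((p.1, p.2, cbar p.2) : Cn3 n) ∈ tripleBall n σ := fun p hp =>
    ⟨hp.1, hp.2, cbar_mem_ball.2 hp.2⟩
  have hlift : ∀ {f : Cn3 n → ℂ}, (∀ q ∈ tripleBall n σ, ContinuousAt f q) →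
      ContinuousOn (fun p : Cn n × Cn n => f (p.1, p.2, cbar p.2))
        (ball 0 σ ×ˢ ball 0 σ) := by
    intro f hf p hp
    exact ((hf _ (hmem p hp)).comp (f := fun p : Cn n × Cn n => ((p.1, p.2, cbar p.2) : Cn3 n))
      continuous_triple_graph.continuousAt).continuousWithinAt
  have hcoord : ∀ q ∈ tripleBall n σ, ContinuousAt (coordMap ψ) q := fun q hq =>
    (h.coordInverse.1 q (hsub3 hq)).continuousAt
  have hcomp : ∀ {f : Cn3 n → ℂ}, (∀ q ∈ tripleBall n σ, AnalyticAt ℂ f (coordMap ψ q)) →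
      ContinuousOn (fun p : Cn n × Cn n => f (coordMap ψ (p.1, p.2, cbar p.2)))
        (ball 0 σ ×ˢ ball 0 σ) := fun {f} hf =>
    hlift (f := fun q => f (coordMap ψ q)) fun q hq =>
      ContinuousAt.comp (hf q hq).continuousAt (hcoord q hq)
  have hadj : ∀ i j, ContinuousOn
      (fun p : Cn n × Cn n => (thetaJac ψ (p.1, p.2, cbar p.2)).adjugate i j)
      (ball 0 σ ×ˢ ball 0 σ) := fun i j =>
    hlift (f := fun q => (thetaJac ψ q).adjugate i j) fun q hq =>
      (analyticAt_adjugate (analyticAt_thetaJac (h.theta_analytic q (hsub3 hq))) i j).continuousAt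
  have hdetc : ContinuousOn (fun p : Cn n × Cn n => (thetaJac ψ (p.1, p.2, cbar p.2)).det)
      (ball 0 σ ×ˢ ball 0 σ) :=
    hlift (f := fun q => (thetaJac ψ q).det) fun q hq =>
      (analyticAt_det (analyticAt_thetaJac (h.theta_analytic q (hsub3 hq)))).continuousAt
  have hw : ∀ i, ContinuousOn (fun p : Cn n × Cn n => wirtingerBar i (fun y => (χ y : ℂ)) p.2)
      (ball 0 σ ×ˢ ball 0 σ) := fun i =>
    ((continuous_wirtingerBar hχ i).comp continuous_snd).continuousOn
  have hth : ∀ j, ContinuousOn (fun p : Cn n × Cn n => thetaMap ψ (p.1, p.2, cbar p.2) j -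
      thetaMap ψ (p.1, p.2, cbar p.1) j) (ball 0 σ ×ˢ ball 0 σ) := by
    intro j p hp
    have e1 : ContinuousAt (fun q => thetaMap ψ q j) (p.1, p.2, cbar p.2) :=
      (EuclideanSpace.proj j : Cn n →L[ℂ] ℂ).continuous.continuousAt.comp
        (h.theta_analytic (p.1, p.2, cbar p.2) (hsub3 (hmem p hp))).continuousAt
    have e2 : ContinuousAt (fun q => thetaMap ψ q j) (p.1, p.2, cbar p.1) :=
      (EuclideanSpace.proj j : Cn n →L[ℂ] ℂ).continuous.continuousAt.comp
        (h.theta_analytic (p.1, p.2, cbar p.1)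
          (hsub3 ⟨hp.1, hp.2, cbar_mem_ball.2 hp.1⟩)).continuousAt
    have e3 : Continuous fun p : Cn n × Cn n => ((p.1, p.2, cbar p.1) : Cn3 n) :=
      continuous_fst.prodMk (continuous_snd.prodMk (continuous_cbar.comp continuous_fst))
    exact ((ContinuousAt.comp (f := fun p : Cn n × Cn n => ((p.1, p.2, cbar p.2) : Cn3 n))
      e1 continuous_triple_graph.continuousAt).sub
      (ContinuousAt.comp (f := fun p : Cn n × Cn n => ((p.1, p.2, cbar p.1) : Cn3 n))
        e2 e3.continuousAt)).continuousWithinAt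
  -- The boundary coefficients are jointly continuous in `(x, y)`; compactness of the closed balls
  -- makes the constants independent of `x`.
  obtain ⟨C₁, hC₁0, hC₁⟩ := exists_bound_on_balls h8 h2
    (f := fun p : Cn n × Cn n => ∑ i, (∑ j, (thetaJac ψ (p.1, p.2, cbar p.2)).adjugate i j *
      (thetaMap ψ (p.1, p.2, cbar p.2) j - thetaMap ψ (p.1, p.2, cbar p.1) j)) *
        wirtingerBar i (fun y => (χ y : ℂ)) p.2)
    (continuousOn_finsetSum _ fun i _ => (continuousOn_finsetSum _ fun j _ =>
      (hadj i j).mul (hth j)).mul (hw i))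
  choose C₂ hC₂0 hC₂ using fun m => exists_bound_on_balls h8 h2
    (f := fun p : Cn n × Cn n => ∑ i, (∑ j, (thetaJac ψ (p.1, p.2, cbar p.2)).adjugate i j *
      g m j (coordMap ψ (p.1, p.2, cbar p.2))) * wirtingerBar i (fun y => (χ y : ℂ)) p.2)
    (continuousOn_finsetSum _ fun i _ => (continuousOn_finsetSum _ fun j _ =>
      (hadj i j).mul (hcomp (hg m j))).mul (hw i))
  obtain ⟨C₃, hC₃0, hC₃⟩ := exists_bound_on_balls h8 h2
    (f := fun p : Cn n × Cn n => (thetaJac ψ (p.1, p.2, cbar p.2)).det *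
      R (coordMap ψ (p.1, p.2, cbar p.2)) * (χ p.2 : ℂ))
    ((hdetc.mul (hcomp hR)).mul (Complex.continuous_ofReal.comp
      (hχ.continuous.comp continuous_snd)).continuousOn)
  -- On the shell `|y| ≥ σ/4`, while `|x| ≤ σ/8`, so `|y - x| ≥ σ/8`.
  set c : ℝ := δ * (σ / 8) ^ 2 with hc
  have hc0 : 0 < c := by positivity
  set C₄ : ℝ := C₁ * growthConst n c * (2 / c) + I.card * ∑ m ∈ I, C₂ m with hC₄
  have hC₂s : 0 ≤ ∑ m ∈ I, C₂ m := Finset.sum_nonneg fun m _ => hC₂0 m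
  have hC₄0 : 0 ≤ C₄ := by
    have := growthConst_nonneg n hc0
    positivity
  refine ⟨max C₄ C₃, hC₄0.trans (le_max_left _ _), ?_⟩
  intro x hx8 v hv A a ε k hk ha hA
  have hx : x ∈ ball (0 : Cn n) σ := closedBall_subset_ball h8 hx8
  have hxr := hsubs hx
  have hballT : closedBall (0 : Cn n) (σ / 2) ⊆ ball 0 σ := closedBall_subset_ball h2
  have hjac : ∀ q ∈ ball (0 : Cn n) σ ×ˢ ball (0 : Cn n) σ,
      jac (sliceTheta ψ x) q = thetaJac ψ (x, q) := fun q hq => h.jac_sliceTheta hxr (hsub2 hq)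
  have hgr : ∀ y ∈ ball (0 : Cn n) σ, (y, cbar y) ∈ ball (0 : Cn n) σ ×ˢ ball (0 : Cn n) σ :=
    fun y hy => graph_mem hy
  have hPc : ContinuousOn (fun y => (diastasis ψ x (y, cbar y)).re) (ball 0 σ) :=
    Complex.continuous_re.comp_continuousOn (continuousOn_comp_graph
      ((h.analyticOnNhd_diastasis hxr).mono hsub2).continuousOn)
  have hkey := norm_amplitude_integral_sub_le (s := σ) hχ (hχt.trans hballT) hv
    (Θ := sliceTheta ψ x) ((h.analyticOnNhd_sliceTheta hxr).mono hsub2)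
    (fun q hq => by rw [hjac q hq]; exact h.det_ne_zero (x, q) ⟨hxr, hsub2 hq⟩)
    (P := diastasis ψ x) ((h.analyticOnNhd_diastasis hxr).mono hsub2) (x := x) hx
    (hχ1 x (closedBall_subset_closedBall (by linarith) hx8))
    (fun q hq => h.diastasis_eq hxr (hsub2 hq))
    (by rw [hjac _ (hgr x hx), thetaJac_diag]; exact h.posDef x hxr) hδ
    (fun y hy => h.lower x hxr y (hsubs hy)) (S := S) hScpt (hST.trans hballT) (fun y hy => by
      by_cases hy2 : y ∈ closedBall (0 : Cn n) (σ / 2)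
      · have hy4 : y ∈ ball (0 : Cn n) (σ / 4) := by
          by_contra hy4
          exact hy ⟨hy2, hy4⟩
        refine ⟨1, ?_⟩
        filter_upwards [isOpen_ball.mem_nhds hy4] with w hw using hχ1 w (ball_subset_closedBall hw)
      · exact ⟨0, notMem_tsupport_iff_eventuallyEq.1 fun h => hy2 (hχt h)⟩)
    hc0 (fun y hy => by
      refine le_trans ?_ (h.lower x hxr y (hsubs (hballT (hST hy))))
      refine mul_le_mul_of_nonneg_left (pow_le_pow_left₀ (by positivity) ?_ 2) hδ.le
      have e1 : σ / 4 ≤ ‖y‖ := by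
        have := hy.2
        rw [mem_ball_zero_iff, not_lt] at this
        exact this
      have e2 : ‖x‖ ≤ σ / 8 := mem_closedBall_zero_iff.1 hx8
      have e3 := norm_sub_norm_le y x
      linarith)
    hC₁0 (fun y hy => by
      rw [hjac _ (hgr y (hballT (hST hy)))]
      exact hC₁ x hx8 y (hST hy))
    (I := I) (g := fun m i q => g m i (coordMap ψ (x, q)))
    (fun m i q hq => AnalyticAt.fun_comp_of_eq (hg m i (x, q) ⟨hx, hq⟩)
      (AnalyticAt.fun_comp_of_eq (h.coordInverse.1 (x, q) (hsub3 ⟨hx, hq⟩))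
        (analyticAt_const.prod analyticAt_id) rfl) rfl)
    (C' := ∑ m ∈ I, C₂ m) (fun m hm y hy => by
      rw [hjac _ (hgr y (hballT (hST hy)))]
      exact (hC₂ m x hx8 y (hST hy)).trans
        (Finset.single_le_sum (f := C₂) (fun m _ => hC₂0 m) hm))
    (R := fun y => (thetaJac ψ (x, y, cbar y)).det * R (coordMap ψ (x, y, cbar y))) (A := A)
    ((hdetc.mul (hcomp hR)).comp (f := fun y : Cn n => (x, y)) (by fun_prop)
      fun y hy => ⟨hx, hy⟩)
    (C'' := C₃) (fun y hy => hC₃ x hx8 y (hχt hy)) (a := a) ha (ε := ε) hk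
    (fun y hy => by
      rw [hjac _ (hgr y hy), hA y hy, mul_add, mul_add, mul_one, Finset.mul_sum]
      congr 1
      · ring
      · refine Finset.sum_congr rfl fun m _ => ?_
        rw [h.relation_eq hxr (hsub2 (hgr y hy)) (fun i => hg m i (x, y, cbar y)
          ⟨hx, hgr y hy⟩) (k : ℂ)]
        ring)
  have hint : ∀ y, v y * ((thetaJac ψ (x, y, cbar y)).det * A y *
      Complex.exp (-((k : ℂ) * diastasis ψ x (y, cbar y)))) * (χ y : ℂ) =
      v y * ((jac (sliceTheta ψ x) (y, cbar y)).det * A y *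
      Complex.exp (-((k : ℂ) * diastasis ψ x (y, cbar y)))) * (χ y : ℂ) := by
    intro y
    by_cases hy : y ∈ tsupport χ
    · rw [hjac _ (hgr y (hballT (hχt hy)))]
    · have h0 : χ y = 0 := image_eq_zero_of_notMem_tsupport hy
      simp [h0]
  simp only [hint]
  refine hkey.trans ?_
  have hk0 : 0 ≤ k := zero_le_one.trans hk
  have hIS : 0 ≤ ∫ y in S, ‖v y‖ * Real.exp (-(k * (diastasis ψ x (y, cbar y)).re)) :=
    integral_nonneg fun y => by positivity
  have hIT : ∫ y in tsupport χ, ‖v y‖ * Real.exp (-(k * (diastasis ψ x (y, cbar y)).re)) ≤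
      ∫ y in closedBall (0 : Cn n) (σ / 2),
        ‖v y‖ * Real.exp (-(k * (diastasis ψ x (y, cbar y)).re)) := by
    refine setIntegral_mono_set ?_ (Eventually.of_forall fun y => by positivity)
      hχt.eventuallyLE
    refine ContinuousOn.integrableOn_compact (isCompact_closedBall _ _) ?_
    exact (hv.continuousOn.norm.mul (Real.continuous_exp.comp_continuousOn
      (continuousOn_const.mul hPc).neg)).mono hballT
  have hIT0 : 0 ≤ ∫ y in tsupport χ, ‖v y‖ * Real.exp (-(k * (diastasis ψ x (y, cbar y)).re)) :=
    integral_nonneg fun y => by positivity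
  refine add_le_add ?_ ?_
  · exact mul_le_mul_of_nonneg_right (le_max_left _ _) (by positivity)
  · have h9 : C₃ ≤ max C₄ C₃ := le_max_right _ _
    gcongr

end UniformBound

/-! ### Properties of the kernel and of the weight. -/

section KernelProperties

variable {n : ℕ} {φ : Cn n → ℝ} {ψ : Cn n → Cn n → ℂ} {ζ : Cn n → Cn n → Cn n → Cn n}
  {r δ c₀ : ℝ}

/-- `y ↦ conj (f(ȳ))` is holomorphic when `f` is. -/
lemma differentiableAt_conj_comp_cbar {f : Cn n → ℂ} {y : Cn n}
    (hf : DifferentiableAt ℂ f (cbar y)) : DifferentiableAt ℂ (fun y => conj (f (cbar y))) y := by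
  have h1 : HasFDerivAt (fun y => conj (f (cbar y)))
      ((Complex.conjCLE : ℂ →L[ℝ] ℂ).comp (((fderiv ℂ f (cbar y)).restrictScalars ℝ).comp
        (cbarL n).toContinuousLinearMap)) y :=
    (Complex.conjCLE : ℂ →L[ℝ] ℂ).hasFDerivAt.comp y
      ((hf.hasFDerivAt.restrictScalars ℝ).comp y
        (cbarL n).toContinuousLinearMap.hasFDerivAt)
  let g : Cn n →ₗ[ℂ] ℂ :=
    { toFun := fun w => conj (fderiv ℂ f (cbar y) (cbar w))
      map_add' := fun a b => by rw [cbar_add, map_add, map_add]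
      map_smul' := fun a b => by
        have : cbar (a • b) = conj a • cbar b := by ext i; simp [cbar_apply]
        rw [this, map_smul, smul_eq_mul, map_mul, Complex.conj_conj, RingHom.id_apply,
          smul_eq_mul] }
  refine (differentiableAt_iff_restrictScalars ℝ h1.differentiableAt).2
    ⟨LinearMap.toContinuousLinearMap g, ?_⟩
  rw [h1.fderiv]
  rfl

lemma IsPhase.φ_eq (h : IsPhase φ ψ ζ r δ c₀) {x : Cn n} (hx : x ∈ ball (0 : Cn n) r) :
    (ψ x (cbar x)).re = φ x := by
  rw [h.polarization.2 x hx, Complex.ofReal_re]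

lemma IsPhase.continuousOn_φ (h : IsPhase φ ψ ζ r δ c₀) : ContinuousOn φ (ball 0 r) := by
  have h1 : ContinuousOn (fun y => (ψ y (cbar y)).re) (ball 0 r) :=
    Complex.continuous_re.comp_continuousOn
      (continuousOn_comp_graph (f := fun p : Cn n × Cn n => ψ p.1 p.2)
        h.polarization.1.continuousOn)
  exact h1.congr fun y hy => (h.φ_eq hy).symm

lemma IsPhase.continuousOn_volDensity (h : IsPhase φ ψ ζ r δ c₀) :
    ContinuousOn (volDensity φ) (ball 0 r) := by
  have h1 : ContinuousOn (fun y => (mixedHess ψ y (cbar y)).det.re) (ball 0 r) :=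
    Complex.continuous_re.comp_continuousOn
      (continuousOn_comp_graph (f := fun p : Cn n × Cn n => (mixedHess ψ p.1 p.2).det)
        fun p hp =>
          (analyticAt_det_mixedHess (h.polarization.1 p hp)).continuousAt.continuousWithinAt)
  refine h1.congr fun y hy => ?_
  simp only
  rw [← h.volDensity_eq y hy, Complex.ofReal_re]

/-- Hermitian symmetry makes `ψ(x, ȳ)` and `ψ(y, x̄)` complex conjugates, so their real parts agree
and the definition of the diastasis determines them. -/
lemma IsPhase.re_diastasis (h : IsPhase φ ψ ζ r δ c₀) {x y : Cn n} (hx : x ∈ ball (0 : Cn n) r)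
    (hy : y ∈ ball (0 : Cn n) r) :
    (ψ x (cbar y)).re = (φ x + φ y - (diastasis ψ x (y, cbar y)).re) / 2 ∧
    (ψ y (cbar x)).re = (φ x + φ y - (diastasis ψ x (y, cbar y)).re) / 2 := by
  have h1 := h.conj_symm x hx (cbar y) (cbar_mem_ball.2 hy)
  rw [cbar_cbar] at h1
  have h2 : (ψ y (cbar x)).re = (ψ x (cbar y)).re := by rw [← h1, Complex.conj_re]
  have h3 : (diastasis ψ x (y, cbar y)).re =
      φ y + φ x - (ψ x (cbar y)).re - (ψ y (cbar x)).re := by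
    simp only [diastasis, Complex.sub_re, Complex.add_re, h.φ_eq hx, h.φ_eq hy]
  constructor <;> linarith

lemma IsPhase.continuousOn_re_diastasis (h : IsPhase φ ψ ζ r δ c₀) {x : Cn n}
    (hx : x ∈ ball (0 : Cn n) r) :
    ContinuousOn (fun y => (diastasis ψ x (y, cbar y)).re) (ball 0 r) :=
  Complex.continuous_re.comp_continuousOn
    (continuousOn_comp_graph (h.analyticOnNhd_diastasis hx).continuousOn)

/-- `|u(y)| e^{-kφ(y)/2} e^{-kρ(y)/2}`, with `ρ` the diastasis based at `x`. -/
def decay (φ : Cn n → ℝ) (ψ : Cn n → Cn n → ℂ) (k : ℕ) (u : Cn n → ℂ) (x y : Cn n) : ℝ :=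
  ‖u y‖ * Real.exp (-(k * φ y / 2)) * Real.exp (-(k * (diastasis ψ x (y, cbar y)).re / 2))

lemma decay_nonneg (k : ℕ) (u : Cn n → ℂ) (x y : Cn n) : 0 ≤ decay φ ψ k u x y := by
  unfold decay; positivity

section Bounds

variable {r' : ℝ} {k : ℕ} {u : Cn n → ℂ} {x : Cn n} {A : Set (Cn n)}

/-- Cauchy–Schwarz against `e^{-kρ/2}`, with `ρ` the real part of the diastasis. Its square has
Gaussian mass of order `k^{-n}` in real dimension `2n`, which accounts for `k^{-n/2}`. -/
lemma IsPhase.integral_decay_le (h : IsPhase φ ψ ζ r δ c₀) (hδ : 0 < δ) (hc₀ : 0 < c₀)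
    (hr' : r' ≤ r) (hx : x ∈ ball (0 : Cn n) r) (hk : 1 ≤ k) (hu : MemH φ r' k u)
    (hA : MeasurableSet A) (hAr : A ⊆ ball 0 r') :
    ∫ y in A, decay φ ψ k u x y ≤ (Real.sqrt c₀)⁻¹ * weightedNorm φ r' k u *
      (Real.sqrt ((Real.pi / δ) ^ n) * (k : ℝ) ^ (-(n : ℝ) / 2)) := by
  have hsub := ball_subset_ball (x := (0 : Cn n)) hr'
  have hρ := (h.continuousOn_re_diastasis hx).mono hsub
  obtain ⟨h1, h2⟩ := integral_exp_le_gaussian hA (hρ.mono hAr) hδ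
    (fun y hy => h.lower x hx y (hsub (hAr hy))) hk
  exact (integral_weighted_le hu (h.continuousOn_φ.mono hsub) hc₀
    (fun y hy => h.volDensity_lower y (hsub hy)) hρ hA hAr (by positivity) h1 h2).2

lemma IsPhase.integral_decay_le_exp (h : IsPhase φ ψ ζ r δ c₀) (hc₀ : 0 < c₀)
    (hr' : r' ≤ r) (hx : x ∈ ball (0 : Cn n) r) (hu : MemH φ r' k u)
    (hA : MeasurableSet A) (hAr : A ⊆ ball 0 r') {c : ℝ}
    (hc : ∀ y ∈ A, c ≤ (diastasis ψ x (y, cbar y)).re) :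
    IntegrableOn (decay φ ψ k u x) A ∧
    ∫ y in A, decay φ ψ k u x y ≤ (Real.sqrt c₀)⁻¹ * weightedNorm φ r' k u *
      (Real.sqrt (volume.real (ball (0 : Cn n) r')) * Real.exp (-(k * c / 2))) := by
  have hsub := ball_subset_ball (x := (0 : Cn n)) hr'
  have hρ := (h.continuousOn_re_diastasis hx).mono hsub
  obtain ⟨h1, h2⟩ := integral_exp_le_of_lower hA hAr (hρ.mono hAr) hc k
  exact integral_weighted_le hu (h.continuousOn_φ.mono hsub) hc₀
    (fun y hy => h.volDensity_lower y (hsub hy)) hρ hA hAr (by positivity) h1 h2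

end Bounds

/-- `∑_{j ≤ N} b_j(x, z) k^{-j}`. -/
def ampSum (b : ℕ → Cn n → Cn n → ℂ) (N : ℕ) (k : ℂ) (x z : Cn n) : ℂ :=
  ∑ j ∈ Finset.range (N + 1), (k ^ j)⁻¹ * b j x z

lemma IsPhase.kernelExpr_eq (h : IsPhase φ ψ ζ r δ c₀) {b : ℕ → Cn n → Cn n → ℂ}
    (hs : SolvesAmplitude ψ ζ r b) (N k : ℕ) {x z : Cn n} (hx : x ∈ ball (0 : Cn n) r)
    (hz : z ∈ ball (0 : Cn n) r) :
    kernelExpr ψ b N k x z =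
      ((k : ℂ) / Real.pi) ^ n * ampSum b N k x z * Complex.exp (k * ψ x z) := by
  -- The amplitude equation with `m = 0` identifies the constant `1` in the kernel with the term `j
  -- = 0` of the sum.
  have h0 : b 0 x z = 1 := by rw [h.solvesAmplitude_iff hs 0 hx hz]; simp
  rw [kernelExpr, ampSum, Finset.sum_range_succ', h0, pow_zero, inv_one, one_mul, add_comm,
    Finset.range_eq_Ico, Finset.sum_Ico_add' (fun j => ((k : ℂ) ^ j)⁻¹ * b j x z) 0 N 1]
  congr 3
  refine Finset.sum_congr rfl fun m _ => ?_
  rw [div_eq_inv_mul]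

/-- The factor `Δ₀` exchanges the volume density `det ψ_yz` for the Jacobian `det θ_z` required by
the integration by parts. -/
lemma IsPhase.ampSum_mul_det (h : IsPhase φ ψ ζ r δ c₀) (b : ℕ → Cn n → Cn n → ℂ) (N : ℕ) (k : ℂ)
    {q : Cn3 n} (hq : q ∈ tripleBall n r) :
    ampSum b N k q.1 q.2.2 * (mixedHess ψ q.2.1 q.2.2).det = (thetaJac ψ q).det *
      ∑ j ∈ Finset.range (N + 1), (k ^ j)⁻¹ * uncurry3 (amplitude ψ ζ (b j)) (coordMap ψ q) := by
  rw [ampSum, Finset.sum_mul, Finset.mul_sum]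
  refine Finset.sum_congr rfl fun j _ => ?_
  have h1 := h.det_ne_zero q hq
  simp only [uncurry3, coordMap, amplitude, Delta0_eq, h.ζ_theta hq.1 hq.2.1 hq.2.2]
  field_simp

lemma continuousOn_ampSum {b : ℕ → Cn n → Cn n → ℂ} (hb : IsAnalyticFamily r b) (j : ℕ) :
    ContinuousOn (fun p : Cn n × Cn n => b j p.1 (cbar p.2)) (ball 0 r ×ˢ ball 0 r) :=
  (hb j).continuousOn.comp (f := fun p : Cn n × Cn n => (p.1, cbar p.2))
    (continuous_fst.prodMk (continuous_cbar.comp continuous_snd)).continuousOn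
    fun _ hp => ⟨hp.1, cbar_mem_ball.2 hp.2⟩

lemma norm_ampSum_le (b : ℕ → Cn n → Cn n → ℂ) (N : ℕ) {k : ℕ} (hk : 1 ≤ k) (x z : Cn n) :
    ‖ampSum b N k x z‖ ≤ ∑ j ∈ Finset.range (N + 1), ‖b j x z‖ := by
  refine norm_sum_le_of_le _ fun j _ => ?_
  rw [norm_mul]
  refine mul_le_of_le_one_left (norm_nonneg _) ?_
  rw [norm_inv, norm_pow, Complex.norm_natCast]
  exact inv_le_one_of_one_le₀ (one_le_pow₀ (by exact_mod_cast hk))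

lemma differentiableAt_kernelExpr {b : ℕ → Cn n → Cn n → ℂ} (hb : IsAnalyticFamily r b)
    (hψ : IsPolarization φ r ψ) (N k : ℕ) {x z : Cn n} (hx : x ∈ ball (0 : Cn n) r)
    (hz : z ∈ ball (0 : Cn n) r) : DifferentiableAt ℂ (kernelExpr ψ b N k x) z := by
  have hsl : ∀ {f : Cn n → Cn n → ℂ}, AnalyticOnNhd ℂ (fun p : Cn n × Cn n => f p.1 p.2)
      (ball 0 r ×ˢ ball 0 r) → DifferentiableAt ℂ (f x) z := by
    intro f hf
    have h1 : DifferentiableAt ℂ (fun z : Cn n => (x, z)) z := by fun_prop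
    exact DifferentiableAt.comp (g := fun p : Cn n × Cn n => f p.1 p.2) z
      (hf (x, z) ⟨hx, hz⟩).differentiableAt h1
  refine DifferentiableAt.mul (DifferentiableAt.const_mul (DifferentiableAt.const_add _ ?_) _) ?_
  · refine DifferentiableAt.fun_sum fun m _ => ?_
    simp only [div_eq_mul_inv]
    exact (hsl (hb m)).mul_const _
  · exact ((hsl hψ.1).const_mul _).cexp

end KernelProperties

/-! ### Reproduction with a small cutoff. -/

section SmallCutoff

variable {n : ℕ} {φ : Cn n → ℝ} {ψ : Cn n → Cn n → ℂ} {ζ : Cn n → Cn n → Cn n → Cn n}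
  {r δ c₀ : ℝ}

/-- The integrand of the pairing of `u` with the local kernel. -/
def pairCore (φ : Cn n → ℝ) (ψ : Cn n → Cn n → ℂ) (b : ℕ → Cn n → Cn n → ℂ) (N k : ℕ)
    (u : Cn n → ℂ) (x y : Cn n) : ℂ :=
  ((k : ℂ) / Real.pi) ^ n * (u y * (ampSum b N k x (cbar y) * (volDensity φ y : ℂ)) *
    Complex.exp (k * (ψ x (cbar y) - φ y)))

/-- The holomorphic function `u(y) e^{-k(ψ(y, x̄) - φ(x))}`. -/
def twist (φ : Cn n → ℝ) (ψ : Cn n → Cn n → ℂ) (k : ℕ) (u : Cn n → ℂ) (x y : Cn n) : ℂ :=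
  u y * Complex.exp (-(k * (ψ y (cbar x) - φ x)))

lemma IsPhase.pairingIntegrand_eq (h : IsPhase φ ψ ζ r δ c₀) {b : ℕ → Cn n → Cn n → ℂ}
    (hs : SolvesAmplitude ψ ζ r b) (N k : ℕ) (χ : Cn n → ℝ) (u : Cn n → ℂ) {x y : Cn n}
    (hx : x ∈ ball (0 : Cn n) r) (hy : y ∈ ball (0 : Cn n) r) :
    pairingIntegrand φ k (fun y => χ y * u y) (localKernel ψ b N k x) y =
      pairCore φ ψ b N k u x y * (χ y : ℂ) := by
  have h1 : Complex.exp (k * (ψ x (cbar y) - φ y)) =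
      Complex.exp (k * ψ x (cbar y)) * Complex.exp (-(k * φ y)) := by
    rw [← Complex.exp_add]; congr 1; ring
  rw [pairingIntegrand, localKernel, Complex.conj_conj,
    h.kernelExpr_eq hs N k hx (cbar_mem_ball.2 hy), pairCore, h1]
  push_cast
  ring

/-- The exponent `k(ψ(x, ȳ) - φ(y))` splits into a part holomorphic in `y`, absorbed by `twist`, and
minus `k` times the diastasis. -/
lemma IsPhase.pairCore_eq (h : IsPhase φ ψ ζ r δ c₀) (b : ℕ → Cn n → Cn n → ℂ) (N k : ℕ)
    (u : Cn n → ℂ) {x y : Cn n} (hx : x ∈ ball (0 : Cn n) r) (hy : y ∈ ball (0 : Cn n) r) :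
    pairCore φ ψ b N k u x y = ((k : ℂ) / Real.pi) ^ n * (twist φ ψ k u x y *
      ((thetaJac ψ (x, y, cbar y)).det * (∑ j ∈ Finset.range (N + 1), ((k : ℂ) ^ j)⁻¹ *
        uncurry3 (amplitude ψ ζ (b j)) (coordMap ψ (x, y, cbar y))) *
        Complex.exp (-((k : ℂ) * diastasis ψ x (y, cbar y))))) := by
  have h1 : Complex.exp (k * (ψ x (cbar y) - φ y)) =
      Complex.exp (-(k * (ψ y (cbar x) - φ x))) *
        Complex.exp (-((k : ℂ) * diastasis ψ x (y, cbar y))) := by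
    rw [← Complex.exp_add, diastasis, ← h.polarization.2 x hx, ← h.polarization.2 y hy]
    congr 1
    ring
  have h2 := h.ampSum_mul_det b N k (q := (x, y, cbar y)) ⟨hx, hy, cbar_mem_ball.2 hy⟩
  simp only at h2
  rw [pairCore, h.volDensity_eq y hy, h2, h1, twist]
  ring

/-- Half of the diastasis is used to replace `Re ψ(y, x̄)` by `(φ(x) + φ(y))/2`; the other half
remains as decay. -/
lemma IsPhase.norm_twist_mul (h : IsPhase φ ψ ζ r δ c₀) (k : ℕ) (u : Cn n → ℂ) {x y : Cn n}
    (hx : x ∈ ball (0 : Cn n) r) (hy : y ∈ ball (0 : Cn n) r) :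
    ‖twist φ ψ k u x y‖ * Real.exp (-(k * (diastasis ψ x (y, cbar y)).re)) =
      Real.exp (k * φ x / 2) * decay φ ψ k u x y := by
  have h1 : (-((k : ℂ) * (ψ y (cbar x) - φ x))).re = -(k * ((ψ y (cbar x)).re - φ x)) := by
    rw [Complex.neg_re, ← Complex.ofReal_natCast, Complex.re_ofReal_mul, Complex.sub_re,
      Complex.ofReal_re]
  rw [twist, norm_mul, Complex.norm_exp, h1, (h.re_diastasis hx hy).2, decay, mul_assoc,
    ← Real.exp_add, mul_assoc, ← Real.exp_add, mul_left_comm, ← Real.exp_add]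
  congr 2
  ring

lemma IsPhase.norm_pairCore (h : IsPhase φ ψ ζ r δ c₀) (b : ℕ → Cn n → Cn n → ℂ) (N k : ℕ)
    (u : Cn n → ℂ) {x y : Cn n} (hx : x ∈ ball (0 : Cn n) r) (hy : y ∈ ball (0 : Cn n) r) :
    ‖pairCore φ ψ b N k u x y‖ = ((k : ℝ) / Real.pi) ^ n *
      (‖ampSum b N k x (cbar y)‖ * |volDensity φ y|) *
      (Real.exp (k * φ x / 2) * decay φ ψ k u x y) := by
  have h1 : ((k : ℂ) * (ψ x (cbar y) - φ y)).re = k * ((ψ x (cbar y)).re - φ y) := by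
    rw [← Complex.ofReal_natCast, Complex.re_ofReal_mul, Complex.sub_re, Complex.ofReal_re]
  have h2 : Real.exp (k * ((φ x + φ y - (diastasis ψ x (y, cbar y)).re) / 2 - φ y)) =
      Real.exp (k * φ x / 2) * (Real.exp (-(k * φ y / 2)) *
        Real.exp (-(k * (diastasis ψ x (y, cbar y)).re / 2))) := by
    rw [← Real.exp_add, ← Real.exp_add]
    congr 1
    ring
  rw [pairCore, norm_mul, norm_mul, norm_mul, norm_mul, norm_pow, norm_div, Complex.norm_natCast,
    Complex.norm_real, Complex.norm_real, Real.norm_of_nonneg Real.pi_pos.le, Real.norm_eq_abs,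
    Complex.norm_exp, h1, (h.re_diastasis hx hy).1, h2, decay]
  ring

lemma IsPhase.continuousOn_pairCore (h : IsPhase φ ψ ζ r δ c₀) {b : ℕ → Cn n → Cn n → ℂ}
    (hb : IsAnalyticFamily r b) (N k : ℕ) {u : Cn n → ℂ} {r' : ℝ} (hr' : r' ≤ r)
    (hu : ContinuousOn u (ball 0 r')) {x : Cn n} (hx : x ∈ ball (0 : Cn n) r) :
    ContinuousOn (pairCore φ ψ b N k u x) (ball 0 r') := by
  have hsub := ball_subset_ball (x := (0 : Cn n)) hr'
  have hpair : Continuous fun y : Cn n => (x, y) := by fun_prop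
  have h1 : ContinuousOn (fun y => ampSum b N k x (cbar y)) (ball 0 r') :=
    continuousOn_finsetSum _ fun j _ => continuousOn_const.mul
      ((continuousOn_ampSum hb j).comp (f := fun y : Cn n => (x, y)) hpair.continuousOn
        fun y hy => ⟨hx, hsub hy⟩)
  have h2 : ContinuousOn (fun y => (volDensity φ y : ℂ)) (ball 0 r') :=
    Complex.continuous_ofReal.comp_continuousOn (h.continuousOn_volDensity.mono hsub)
  have h3 : ContinuousOn (fun y => ψ x (cbar y)) (ball 0 r') :=
    h.polarization.1.continuousOn.comp (f := fun y : Cn n => (x, cbar y))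
      (continuous_const.prodMk continuous_cbar).continuousOn
      fun y hy => ⟨hx, cbar_mem_ball.2 (hsub hy)⟩
  have h4 : ContinuousOn (fun y => (φ y : ℂ)) (ball 0 r') :=
    Complex.continuous_ofReal.comp_continuousOn (h.continuousOn_φ.mono hsub)
  exact continuousOn_const.mul ((hu.mul (h1.mul h2)).mul
    (continuousOn_const.mul (h3.sub h4)).cexp)

lemma IsPhase.differentiableOn_twist (h : IsPhase φ ψ ζ r δ c₀) (k : ℕ) {u : Cn n → ℂ} {s : ℝ}
    (hs : s ≤ r) (hu : DifferentiableOn ℂ u (ball 0 s)) {x : Cn n} (hx : x ∈ ball (0 : Cn n) r) :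
    DifferentiableOn ℂ (twist φ ψ k u x) (ball 0 s) := by
  intro y hy
  have h1 : DifferentiableAt ℂ (fun y => ψ y (cbar x)) y := by
    have h2 : DifferentiableAt ℂ (fun y : Cn n => (y, cbar x)) y := by fun_prop
    exact DifferentiableAt.comp (g := fun p : Cn n × Cn n => ψ p.1 p.2) y
      (h.polarization.1 (y, cbar x)
        ⟨ball_subset_ball hs hy, cbar_mem_ball.2 hx⟩).differentiableAt h2
  exact (hu y hy).mul (((h1.sub_const _).const_mul _).neg.cexp).differentiableWithinAt

lemma twist_self (h : IsPhase φ ψ ζ r δ c₀) (k : ℕ) (u : Cn n → ℂ) {x : Cn n}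
    (hx : x ∈ ball (0 : Cn n) r) : twist φ ψ k u x x = u x := by
  rw [twist, h.polarization.2 x hx]
  simp

/-- A small cutoff `χ'` and a neighbourhood of the origin in which the pairing against the local
kernel, truncated by `χ'`, reproduces holomorphic functions up to `O(k^{-(N+1)})`. -/
theorem IsPhase.exists_small_cutoff (h : IsPhase φ ψ ζ r δ c₀) (hδ : 0 < δ)
    {b : ℕ → Cn n → Cn n → ℂ} (hb : IsAnalyticFamily r b) (hs : SolvesAmplitude ψ ζ r b)
    {r' : ℝ} (hr'0 : 0 < r') (hr' : r' ≤ r) (N : ℕ) :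
    ∃ (σ : ℝ) (χ' : Cn n → ℝ), 0 < σ ∧ σ ≤ r' ∧ ContDiff ℝ ∞ χ' ∧
      (∀ y ∈ closedBall (0 : Cn n) (σ / 4), χ' y = 1) ∧ tsupport χ' ⊆ closedBall 0 (σ / 2) ∧
      ∃ C, 0 ≤ C ∧ ∀ x ∈ closedBall (0 : Cn n) (σ / 8), ∀ k : ℕ, 1 ≤ k → ∀ u : Cn n → ℂ,
        DifferentiableOn ℂ u (ball 0 r') →
        ‖u x - ∫ y, pairCore φ ψ b N k u x y * (χ' y : ℂ)‖ ≤ (Real.pi ^ n)⁻¹ *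
          (C * ((k : ℝ) ^ n * (Real.exp (k * φ x / 2) *
              ∫ y in closedBall (0 : Cn n) (σ / 2) \ ball 0 (σ / 4), decay φ ψ k u x y)) +
            ((k : ℝ) ^ (N + 1))⁻¹ * C * ((k : ℝ) ^ n * (Real.exp (k * φ x / 2) *
              ∫ y in closedBall (0 : Cn n) (σ / 2), decay φ ψ k u x y))) := by
  obtain ⟨R, g, hR, hg, hexp⟩ := h.exists_amplitude_expansion (hr'0.trans_le hr') hb hs N
  set I := (Finset.range (N + 1)).sigma (fun j => Finset.range (N + 1 - j)) with hI
  have h0 : (0 : Cn n) ∈ ball (0 : Cn n) r := mem_ball_self (hr'0.trans_le hr')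
  have hc : ContinuousAt (coordMap ψ) 0 := (h.coordInverse.1 0 ⟨h0, h0, h0⟩).continuousAt
  have hev := hc.eventually (hexp.and (hR.eventually_analyticAt.and
    ((Finset.eventually_all I).2 fun m _ => eventually_all.2 fun i =>
      (hg m i).eventually_analyticAt)))
  obtain ⟨ε, hε, hball⟩ := Metric.eventually_nhds_iff_ball.1 hev
  -- Small enough that the expansion of the amplitude and the analyticity of `R` and of the fields
  -- hold over the whole triple ball of radius `σ`.
  set σ := min r' ε with hσ
  have hσ0 : 0 < σ := lt_min hr'0 hε
  have hσr : σ ≤ r := (min_le_left _ _).trans hr'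
  have hmem : ∀ q ∈ tripleBall n σ, q ∈ ball (0 : Cn3 n) ε := by
    intro q hq
    rw [show (0 : Cn3 n) = (0, (0, 0)) from rfl, ← ball_prod_same, ← ball_prod_same]
    exact tripleBall_mono (min_le_right _ _) hq
  let χb : ContDiffBump (0 : Cn n) :=
    ⟨σ / 4, σ / 2, by positivity, by linarith⟩
  have hχt : tsupport χb ⊆ closedBall 0 (σ / 2) := by rw [χb.tsupport_eq]
  have hχ1 : ∀ y ∈ closedBall (0 : Cn n) (σ / 4), χb y = 1 := fun y hy =>
    χb.one_of_mem_closedBall hy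
  refine ⟨σ, χb, hσ0, min_le_left _ _, χb.contDiff, hχ1, hχt, ?_⟩
  -- The index type is the subtype `I`: a common neighbourhood of analyticity was chosen only for
  -- the finitely many fields that occur.
  obtain ⟨C, hC0, hC⟩ := h.exists_reproducing_bound hδ hσ0 hσr χb.contDiff hχ1 hχt
    (Finset.univ : Finset I) (R := R) (g := fun m => g m)
    (fun q hq => (hball q (hmem q hq)).2.1)
    (fun m i q hq => (hball q (hmem q hq)).2.2 m m.2 i)
  refine ⟨C, hC0, fun x hx8 k hk u hu => ?_⟩
  have hk1 : (1 : ℝ) ≤ k := by exact_mod_cast hk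
  have hk0 : (k : ℂ) ≠ 0 := by exact_mod_cast (Nat.one_le_iff_ne_zero.1 hk)
  have hx : x ∈ ball (0 : Cn n) σ := closedBall_subset_ball (by linarith) hx8
  have hsub := ball_subset_ball (x := (0 : Cn n)) hσr
  have hT : closedBall (0 : Cn n) (σ / 2) ⊆ ball 0 σ := closedBall_subset_ball (by linarith)
  have hv : DifferentiableOn ℂ (twist φ ψ k u x) (ball 0 σ) :=
    h.differentiableOn_twist k hσr (hu.mono (ball_subset_ball (min_le_left _ _))) (hsub hx)
  have hmain := hC x hx8 (twist φ ψ k u x) hv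
    (fun y => ∑ j ∈ Finset.range (N + 1), ((k : ℂ) ^ j)⁻¹ *
        uncurry3 (amplitude ψ ζ (b j)) (coordMap ψ (x, y, cbar y)))
    (fun m => ((k : ℂ) ^ (m.1.1 + m.1.2 + 1))⁻¹) (((k : ℂ) ^ (N + 1))⁻¹) k hk1
    (fun m _ => by
      rw [norm_inv, norm_pow, Complex.norm_natCast]
      exact inv_le_one_of_one_le₀ (one_le_pow₀ hk1))
    (fun y hy => by
      have hq : ((x, y, cbar y) : Cn3 n) ∈ tripleBall n σ := ⟨hx, hy, cbar_mem_ball.2 hy⟩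
      rw [(hball _ (hmem _ hq)).1 k hk0]
      congr 1
      exact (Finset.sum_coe_sort I fun s : (Σ _ : ℕ, ℕ) => ((k : ℂ) ^ (s.1 + s.2 + 1))⁻¹ *
        ∑ i, (pT i (g s i) (coordMap ψ (x, y, cbar y)) + k * ((x i - y i) *
          g s i (coordMap ψ (x, y, cbar y))))).symm)
  have hpi : (Real.pi : ℂ) ^ n ≠ 0 := pow_ne_zero _ (by exact_mod_cast Real.pi_ne_zero)
  have hpair : ∫ y, pairCore φ ψ b N k u x y * (χb y : ℂ) = ((Real.pi : ℂ) ^ n)⁻¹ *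
      ((k : ℂ) ^ n * ∫ y, twist φ ψ k u x y * ((thetaJac ψ (x, y, cbar y)).det *
        (∑ j ∈ Finset.range (N + 1), ((k : ℂ) ^ j)⁻¹ *
        uncurry3 (amplitude ψ ζ (b j)) (coordMap ψ (x, y, cbar y))) *
        Complex.exp (-((k : ℂ) * diastasis ψ x (y, cbar y)))) * (χb y : ℂ)) := by
    rw [← mul_assoc, ← integral_const_mul]
    refine integral_congr_ae (Eventually.of_forall fun y => ?_)
    by_cases hy : y ∈ tsupport χb
    · simp only
      rw [h.pairCore_eq b N k u (hsub hx) (hsub (hT (hχt hy))), div_pow]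
      ring
    · have : χb y = 0 := image_eq_zero_of_notMem_tsupport hy
      simp [this]
  have hdecay : ∀ A ⊆ ball (0 : Cn n) σ, MeasurableSet A →
      ∫ y in A, ‖twist φ ψ k u x y‖ * Real.exp (-(k * (diastasis ψ x (y, cbar y)).re)) =
        Real.exp (k * φ x / 2) * ∫ y in A, decay φ ψ k u x y := by
    intro A hA hAm
    rw [← integral_const_mul]
    exact setIntegral_congr_fun hAm fun y hy => h.norm_twist_mul k u (hsub hx) (hsub (hA hy))
  rw [hdecay _ hT measurableSet_closedBall, hdecay _ (Set.sdiff_subset.trans hT)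
    (measurableSet_closedBall.diff measurableSet_ball), twist_self h k u (hsub hx), norm_inv,
    norm_pow, Complex.norm_natCast, Complex.ofReal_natCast] at hmain
  rw [hpair, norm_sub_rev]
  set J := ∫ y, twist φ ψ k u x y * ((thetaJac ψ (x, y, cbar y)).det *
        (∑ j ∈ Finset.range (N + 1), ((k : ℂ) ^ j)⁻¹ *
        uncurry3 (amplitude ψ ζ (b j)) (coordMap ψ (x, y, cbar y))) *
        Complex.exp (-((k : ℂ) * diastasis ψ x (y, cbar y)))) * (χb y : ℂ) with hJ
  have hfac : ((Real.pi : ℂ) ^ n)⁻¹ * ((k : ℂ) ^ n * J) - u x =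
      ((Real.pi : ℂ) ^ n)⁻¹ * ((k : ℂ) ^ n * J - (Real.pi : ℂ) ^ n * u x) := by
    field_simp
  rw [hfac, norm_mul, norm_inv, norm_pow, Complex.norm_real, Real.norm_of_nonneg Real.pi_pos.le]
  exact mul_le_mul_of_nonneg_left hmain (by positivity)

end SmallCutoff

/-! ### The error estimate for an arbitrary cutoff. -/

section KernelEstimate

variable {n : ℕ} {φ : Cn n → ℝ} {ψ : Cn n → Cn n → ℂ} {ζ : Cn n → Cn n → Cn n → Cn n}
  {r δ c₀ : ℝ}

/-- Contribution to the pairing from a cutoff that vanishes near the origin. -/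
lemma IsPhase.exists_far_bound (h : IsPhase φ ψ ζ r δ c₀) (hδ : 0 ≤ δ) (hc₀ : 0 < c₀)
    {b : ℕ → Cn n → Cn n → ℂ} (hb : IsAnalyticFamily r b)
    {r' : ℝ} (hr' : r' ≤ r) (N : ℕ) {η : Cn n → ℝ} (hη : Continuous η)
    {T : Set (Cn n)} (hT : IsCompact T) (hTr : T ⊆ ball 0 r') (hηT : ∀ y ∉ T, η y = 0) {σ : ℝ}
    (hσ0 : 0 < σ) (hσ : σ ≤ r') (hη0 : ∀ y ∈ ball (0 : Cn n) (σ / 4), η y = 0) :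
    ∃ C, 0 ≤ C ∧ ∀ x ∈ closedBall (0 : Cn n) (σ / 8), ∀ k : ℕ, 1 ≤ k → ∀ u : Cn n → ℂ,
      MemH φ r' k u → ‖∫ y, pairCore φ ψ b N k u x y * (η y : ℂ)‖ ≤ (Real.pi ^ n)⁻¹ *
        (C * ((k : ℝ) ^ n * (Real.exp (k * φ x / 2) * ((Real.sqrt c₀)⁻¹ *
          weightedNorm φ r' k u * (Real.sqrt (volume.real (ball (0 : Cn n) r')) *
            Real.exp (-(k * (δ * (σ / 8) ^ 2) / 2))))))) := by
  have hsub := ball_subset_ball (x := (0 : Cn n)) hr'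
  have hK : IsCompact (closedBall (0 : Cn n) (σ / 8) ×ˢ T) := (isCompact_closedBall _ _).prod hT
  have h8 : closedBall (0 : Cn n) (σ / 8) ⊆ ball 0 r' := closedBall_subset_ball (by linarith)
  have hKr : closedBall (0 : Cn n) (σ / 8) ×ˢ T ⊆ ball 0 r ×ˢ ball 0 r :=
    Set.prod_mono (h8.trans hsub) (hTr.trans hsub)
  have hcont : ContinuousOn (fun p : Cn n × Cn n =>
      (∑ j ∈ Finset.range (N + 1), ‖b j p.1 (cbar p.2)‖) * |volDensity φ p.2| * |η p.2|)
      (closedBall (0 : Cn n) (σ / 8) ×ˢ T) := by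
    refine ContinuousOn.mul (ContinuousOn.mul ?_ ?_) (hη.comp continuous_snd).abs.continuousOn
    · exact (continuousOn_finsetSum _ fun j _ => (continuousOn_ampSum hb j).norm).mono hKr
    · exact (h.continuousOn_volDensity.comp (f := fun p : Cn n × Cn n => p.2)
        continuous_snd.continuousOn fun p hp => hp.2).abs.mono hKr
  obtain ⟨C, hC⟩ := hK.exists_bound_of_continuousOn hcont
  refine ⟨max C 0, le_max_right _ _, fun x hx k hk u hu => ?_⟩
  have hxr := hsub (h8 hx)
  -- The cutoff `η` vanishes off `A`, and on `A` the point `y` is at distance at least `σ/8` from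
  -- `x`.
  set A := T \ ball (0 : Cn n) (σ / 4) with hA
  have hAm : MeasurableSet A := hT.measurableSet.diff measurableSet_ball
  have hAr : A ⊆ ball 0 r' := Set.sdiff_subset.trans hTr
  obtain ⟨hi, hle⟩ := h.integral_decay_le_exp hc₀ hr' hxr hu hAm hAr (c := δ * (σ / 8) ^ 2)
    (fun y hy => by
      refine le_trans ?_ (h.lower x hxr y (hsub (hAr hy)))
      refine mul_le_mul_of_nonneg_left (pow_le_pow_left₀ (by positivity) ?_ 2) hδ
      have e1 : σ / 4 ≤ ‖y‖ := by
        have := hy.2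
        rw [mem_ball_zero_iff, not_lt] at this
        exact this
      have e2 : ‖x‖ ≤ σ / 8 := mem_closedBall_zero_iff.1 hx
      have e3 := norm_sub_norm_le y x
      linarith)
  have hpt : ∀ y, ‖pairCore φ ψ b N k u x y * (η y : ℂ)‖ ≤
      A.indicator (fun y => ((k : ℝ) / Real.pi) ^ n * max C 0 *
        (Real.exp (k * φ x / 2) * decay φ ψ k u x y)) y := by
    intro y
    by_cases hy : y ∈ A
    · rw [Set.indicator_of_mem hy, norm_mul, h.norm_pairCore b N k u hxr (hsub (hAr hy)),
        Complex.norm_real, Real.norm_eq_abs]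
      have h1 := hC (x, y) ⟨hx, hy.1⟩
      rw [Real.norm_of_nonneg (by positivity)] at h1
      have h2 := norm_ampSum_le b N hk x (cbar y)
      have h3 : ‖ampSum b N k x (cbar y)‖ * |volDensity φ y| * |η y| ≤ max C 0 :=
        le_trans (by gcongr) (h1.trans (le_max_left _ _))
      have h4 := decay_nonneg (φ := φ) (ψ := ψ) k u x y
      calc _ = ((k : ℝ) / Real.pi) ^ n *
            (‖ampSum b N k x (cbar y)‖ * |volDensity φ y| * |η y|) *
            (Real.exp (k * φ x / 2) * decay φ ψ k u x y) := by ring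
        _ ≤ _ := by gcongr
    · have h0 : η y = 0 := by
        by_cases hyT : y ∈ T
        · refine hη0 y ?_
          by_contra hyb
          exact hy ⟨hyT, hyb⟩
        · exact hηT y hyT
      simp [Set.indicator_of_notMem hy, h0]
  have hb2 := norm_integral_le_of_norm_le ((integrable_indicator_iff hAm).2
    ((hi.const_mul (Real.exp (k * φ x / 2))).const_mul (((k : ℝ) / Real.pi) ^ n * max C 0)))
    (Eventually.of_forall hpt)
  rw [integral_indicator hAm, integral_const_mul, integral_const_mul] at hb2
  have hC0 : 0 ≤ max C 0 := le_max_right _ _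
  refine hb2.trans ((mul_le_mul_of_nonneg_left (mul_le_mul_of_nonneg_left hle
    (Real.exp_pos _).le) (by positivity)).trans (le_of_eq ?_))
  rw [div_pow]
  ring

/-- The truncated kernels are local Bergman kernels modulo `O(k^{n/2 - N - 1})`. -/
theorem IsPhase.isBergmanKernelMod (h : IsPhase φ ψ ζ r δ c₀) (hδ : 0 < δ) (hc₀ : 0 < c₀)
    {b : ℕ → Cn n → Cn n → ℂ} (hb : IsAnalyticFamily r b) (hs : SolvesAmplitude ψ ζ r b)
    {r' : ℝ} (hr'0 : 0 < r') (hr' : r' ≤ r) {χ : Cn n → ℝ} (hχ : IsCutoff r' χ) (N : ℕ) :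
    IsBergmanKernelMod φ r' χ (localKernel ψ b N)
      (fun k => (k : ℝ) ^ ((n : ℝ) / 2 - (N + 1))) := by
  have hsub := ball_subset_ball (x := (0 : Cn n)) hr'
  obtain ⟨σ, χ', hσ0, hσ, hχ's, hχ'1, hχ't, C₁, hC₁0, hC₁⟩ :=
    h.exists_small_cutoff hδ hb hs hr'0 hr' N
  have hcpt : IsCompact (tsupport χ) := Metric.isCompact_of_isClosed_isBounded
    (isClosed_tsupport _) (isBounded_ball.subset hχ.2.1)
  have hT' : closedBall (0 : Cn n) (σ / 2) ⊆ ball 0 r' := closedBall_subset_ball (by linarith)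
  -- Both cutoffs equal one on the ball of radius `σ/4`, because `σ/4 ≤ r'/2`; their difference
  -- therefore contributes only an exponentially small term.
  obtain ⟨C₂, hC₂0, hC₂⟩ := h.exists_far_bound hδ.le hc₀ hb hr' N (η := fun y => χ y - χ' y)
    (hχ.1.continuous.sub hχ's.continuous)
    (T := tsupport χ ∪ closedBall 0 (σ / 2)) (hcpt.union (isCompact_closedBall _ _))
    (Set.union_subset hχ.2.1 hT')
    (fun y hy => by
      rw [Set.mem_union, not_or] at hy
      rw [image_eq_zero_of_notMem_tsupport hy.1,
        image_eq_zero_of_notMem_tsupport fun h => hy.2 (hχ't h), sub_zero]) hσ0 hσ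
    (fun y hy => by
      rw [hχ.2.2 y (ball_subset_ball (by linarith) hy), hχ'1 y (ball_subset_closedBall hy),
        sub_self])
  set c : ℝ := δ * (σ / 8) ^ 2 with hc
  have hc0 : 0 < c := by positivity
  obtain ⟨C₃, hC₃0, hC₃⟩ := exists_pow_mul_exp_le (n : ℝ) ((n : ℝ) / 2 - (N + 1)) (half_pos hc0)
  set V := Real.sqrt (volume.real (ball (0 : Cn n) r')) with hV
  set D := Real.sqrt ((Real.pi / δ) ^ n) with hD
  -- The three summands come from the shell where the small cutoff varies, the remainder of order
  -- `k^{-(N+1)}`, and the change of cutoff.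
  refine ⟨σ / 8, by positivity, by linarith, (Real.sqrt c₀)⁻¹ * (Real.pi ^ n)⁻¹ *
    (C₁ * V * C₃ + C₁ * D + C₂ * V * C₃), fun k hk x hx => ?_⟩
  have hx8 : x ∈ closedBall (0 : Cn n) (σ / 8) := ball_subset_closedBall hx
  have hxr : x ∈ ball (0 : Cn n) r := hsub (ball_subset_ball (by linarith) hx)
  refine ⟨fun y hy => (differentiableAt_conj_comp_cbar (differentiableAt_kernelExpr hb
    h.polarization N k hxr (cbar_mem_ball.2 (hsub hy)))).differentiableWithinAt, ?_⟩
  intro u hu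
  have hcore := h.continuousOn_pairCore hb N k hr' hu.1.continuousOn hxr
  have hint : ∀ η : Cn n → ℝ, Continuous η → tsupport η ⊆ ball 0 r' →
      Integrable (fun y => pairCore φ ψ b N k u x y * (η y : ℂ)) := by
    intro η hη hηs
    have hs' : tsupport (fun y => (η y : ℂ)) ⊆ tsupport η := by
      refine closure_mono fun y hy => ?_
      rw [Function.mem_support] at hy ⊢
      simpa using hy
    exact integrable_mul_tsupport (Complex.continuous_ofReal.comp hη)
      (Metric.isCompact_of_isClosed_isBounded (isClosed_tsupport _)
        (isBounded_ball.subset (hs'.trans hηs))) (hcore.mono (hs'.trans hηs))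
  have hi1 := hint χ hχ.1.continuous hχ.2.1
  have hi2 := hint χ' hχ's.continuous (hχ't.trans hT')
  have hpe : ∀ y ∈ ball (0 : Cn n) r', pairingIntegrand φ k (fun y => χ y * u y)
      (localKernel ψ b N k x) y = pairCore φ ψ b N k u x y * (χ y : ℂ) := fun y hy =>
    h.pairingIntegrand_eq hs N k χ u hxr (hsub hy)
  refine ⟨(integrableOn_congr_fun hpe measurableSet_ball).2 hi1.integrableOn, ?_⟩
  have hpair : pairing φ r' k (fun y => χ y * u y) (localKernel ψ b N k x) =
      (∫ y, pairCore φ ψ b N k u x y * (χ' y : ℂ)) +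
        ∫ y, pairCore φ ψ b N k u x y * ((χ y - χ' y : ℝ) : ℂ) := by
    rw [pairing, setIntegral_congr_fun measurableSet_ball hpe,
      setIntegral_eq_integral_of_forall_compl_eq_zero fun y hy => by
        rw [image_eq_zero_of_notMem_tsupport fun h => hy (hχ.2.1 h)]; simp]
    have h1 : ∀ y, pairCore φ ψ b N k u x y * ((χ y - χ' y : ℝ) : ℂ) =
        pairCore φ ψ b N k u x y * (χ y : ℂ) - pairCore φ ψ b N k u x y * (χ' y : ℂ) :=
      fun y => by push_cast; ring
    simp only [h1]
    rw [integral_sub hi1 hi2]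
    ring
  have hk0 : (0 : ℝ) < k := by exact_mod_cast hk
  set M := (Real.sqrt c₀)⁻¹ * weightedNorm φ r' k u with hM
  have hM0 : 0 ≤ M := mul_nonneg (inv_nonneg.2 (Real.sqrt_nonneg _)) (Real.sqrt_nonneg _)
  set X := Real.exp (k * φ x / 2) with hX
  have hX0 : 0 ≤ X := (Real.exp_pos _).le
  set a := (k : ℝ) ^ ((n : ℝ) / 2 - (N + 1)) with ha
  have ha0 : 0 ≤ a := Real.rpow_nonneg hk0.le _
  have hexp : (k : ℝ) ^ n * Real.exp (-(k * c / 2)) ≤ C₃ * a := by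
    have := hC₃ k hk
    rwa [Real.rpow_natCast, ← mul_div_assoc] at this
  -- Remainder order, kernel prefactor and Gaussian `L²` norm combine to the exponent `n/2 - (N +
  -- 1)`.
  have hpow : ((k : ℝ) ^ (N + 1))⁻¹ * ((k : ℝ) ^ n * (k : ℝ) ^ (-(n : ℝ) / 2)) = a := by
    rw [← Real.rpow_natCast, ← Real.rpow_natCast, ← Real.rpow_neg hk0.le, ← Real.rpow_add hk0,
      ← Real.rpow_add hk0]
    congr 1
    push_cast
    ring
  have hS : ∫ y in closedBall (0 : Cn n) (σ / 2) \ ball 0 (σ / 4), decay φ ψ k u x y ≤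
      M * (V * Real.exp (-(k * c / 2))) := by
    refine (h.integral_decay_le_exp hc₀ hr' hxr hu
      (measurableSet_closedBall.diff measurableSet_ball) (Set.sdiff_subset.trans hT')
      fun y hy => ?_).2
    refine le_trans ?_ (h.lower x hxr y (hsub (hT' hy.1)))
    refine mul_le_mul_of_nonneg_left (pow_le_pow_left₀ (by positivity) ?_ 2) hδ.le
    have e1 : σ / 4 ≤ ‖y‖ := by
      have := hy.2
      rw [mem_ball_zero_iff, not_lt] at this
      exact this
    have e2 : ‖x‖ ≤ σ / 8 := mem_closedBall_zero_iff.1 hx8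
    have e3 := norm_sub_norm_le y x
    linarith
  have hTb : ∫ y in closedBall (0 : Cn n) (σ / 2), decay φ ψ k u x y ≤
      M * (D * (k : ℝ) ^ (-(n : ℝ) / 2)) :=
    h.integral_decay_le hδ hc₀ hr' hxr hk hu measurableSet_closedBall hT'
  have hV0 : 0 ≤ V := Real.sqrt_nonneg _
  have hD0 : 0 ≤ D := Real.sqrt_nonneg _
  have e1 : C₁ * ((k : ℝ) ^ n * (X *
      ∫ y in closedBall (0 : Cn n) (σ / 2) \ ball 0 (σ / 4), decay φ ψ k u x y)) ≤
      C₁ * V * C₃ * (a * X * M) := by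
    calc _ ≤ C₁ * ((k : ℝ) ^ n * (X * (M * (V * Real.exp (-(k * c / 2)))))) := by gcongr
      _ = C₁ * V * (X * M) * ((k : ℝ) ^ n * Real.exp (-(k * c / 2))) := by ring
      _ ≤ C₁ * V * (X * M) * (C₃ * a) := by gcongr
      _ = _ := by ring
  have e2 : ((k : ℝ) ^ (N + 1))⁻¹ * C₁ * ((k : ℝ) ^ n * (X *
      ∫ y in closedBall (0 : Cn n) (σ / 2), decay φ ψ k u x y)) ≤ C₁ * D * (a * X * M) := by
    calc _ ≤ ((k : ℝ) ^ (N + 1))⁻¹ * C₁ * ((k : ℝ) ^ n *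
          (X * (M * (D * (k : ℝ) ^ (-(n : ℝ) / 2))))) := by gcongr
      _ = C₁ * D * (X * M) * (((k : ℝ) ^ (N + 1))⁻¹ *
          ((k : ℝ) ^ n * (k : ℝ) ^ (-(n : ℝ) / 2))) := by ring
      _ = _ := by rw [hpow]; ring
  have e3 : C₂ * ((k : ℝ) ^ n * (X * (M * (V * Real.exp (-(k * c / 2)))))) ≤
      C₂ * V * C₃ * (a * X * M) := by
    calc _ = C₂ * V * (X * M) * ((k : ℝ) ^ n * Real.exp (-(k * c / 2))) := by ring
      _ ≤ C₂ * V * (X * M) * (C₃ * a) := by gcongr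
      _ = _ := by ring
  have hpi : 0 ≤ (Real.pi ^ n)⁻¹ := by positivity
  have f1 := (hC₁ x hx8 k hk u hu.1).trans (mul_le_mul_of_nonneg_left (add_le_add e1 e2) hpi)
  have f2 := (hC₂ x hx8 k hk u hu).trans (mul_le_mul_of_nonneg_left e3 hpi)
  rw [hpair, ← sub_sub]
  refine (norm_sub_le _ _).trans ((add_le_add f1 f2).trans (le_of_eq ?_))
  rw [hM]
  ring

end KernelEstimate

end LocalBergman

end

/-! ### The local asymptotic Bergman kernel. -/

theorem proposition2p5 (n : ℕ) (φ : Cn n → ℝ) (hφ : AnalyticAt ℝ φ 0)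
    (hpsh : ∀ᶠ w in 𝓝 (0 : Cn n), LocalBergman.StrictlyPshAt φ w) :
    ∃ r₀ : ℝ, 0 < r₀ ∧
    ∃ (ψ : Cn n → Cn n → ℂ) (ζ : Cn n → Cn n → Cn n → Cn n) (b : ℕ → Cn n → Cn n → ℂ),
      LocalBergman.IsPolarization φ r₀ ψ ∧
      LocalBergman.IsCoordInverse ψ r₀ ζ ∧
      LocalBergman.IsAnalyticFamily r₀ b ∧
      LocalBergman.SolvesAmplitude ψ ζ r₀ b ∧
      (∀ b' : ℕ → Cn n → Cn n → ℂ, LocalBergman.IsAnalyticFamily r₀ b' →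
        LocalBergman.SolvesAmplitude ψ ζ r₀ b' →
        ∀ m, ∀ x ∈ ball (0 : Cn n) r₀, ∀ z ∈ ball (0 : Cn n) r₀, b' m x z = b m x z) ∧
      ∀ r : ℝ, 0 < r → r ≤ r₀ → ∀ χ : Cn n → ℝ, LocalBergman.IsCutoff r χ → ∀ N : ℕ,
        LocalBergman.IsBergmanKernelMod φ r χ (LocalBergman.localKernel ψ b N)
          (fun k => (k : ℝ) ^ ((n : ℝ) / 2 - (N + 1))) := by
  obtain ⟨ψ, ζ, r₀, δ, c₀, hr₀, hδ, hc₀, h⟩ := LocalBergman.exists_isPhase hφ hpsh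
  exact ⟨r₀, hr₀, ψ, ζ, LocalBergman.bcoef ψ ζ, h.polarization, h.coordInverse,
    h.isAnalyticFamily, h.solvesAmplitude,
    fun b' _ hs' => h.amplitude_unique h.isAnalyticFamily h.solvesAmplitude hs',
    fun r hr hrr χ hχ N =>
      h.isBergmanKernelMod hδ hc₀ h.isAnalyticFamily h.solvesAmplitude hr hrr hχ N⟩
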